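/- Let $\nu>0$, $\sigma>0$. Let $\mathcal V$ be the space of divergence-free fields in $C_0^\infty(\mathbb R^2;\mathbb R^2)$, and let $\mathbb H$ and $\mathbb V$ be the completions of $\mathcal V$ in the norms $\|v\|_{\mathbb H}^2=\int_{\mathbb R^2}|v|^2dx$ and $\|v\|_{\mathbb V}^2=\int_{\mathbb R^2}|v|^2dx+\int_{\mathbb R^2}|\nabla v|^2dx$. Put $b(u,v,w)=\sum_{i,j=1}^2\int_{\mathbb R^2}u_i\,\partial_i v_j\,w_j\,dx$ for $u,v,w\in\mathbb V$, and let $(\cdot,\cdot)$ denote $L^2$ inner products. Let $\Omega$ be the set of $\omega\in C(\mathbb R;\mathbb R)$ with $\omega(0)=0$ and $\int_{-\infty}^0 e^{\xi}|\omega(\xi)|\,d\xi<\infty$ (a shift-invariant set of full two-sided Wiener measure). For $\omega\in\Omega$ and $t\in\mathbb R$ put $\theta_t\omega=\omega(\cdot+t)-\omega(t)$, let $y(\omega)=-\int_{-\infty}^0 e^{\xi}\omega(\xi)\,d\xi$ (so that $t\mapsto y(\theta_t\omega)=\int_{-\infty}^te^{-(t-\xi)}d\omega(\xi)$ is the stationary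 Ornstein–Uhlenbeck solution of $dy+y\,dt=d\omega$), and let $z(t,\omega)=e^{-\sigma y(\theta_t\omega)}$. Let $f\in L^2_{\rm loc}(\mathbb R;L^2(\mathbb R^2;\mathbb R^2))$. For $\omega\in\Omega$, $\tau\in\mathbb R$ and $u_\tau\in\mathbb H$, a weak solution of the pathwise system $$\frac{du}{dt}+\nu A u+\Big[\frac{\sigma^2}{2}-\sigma y(\theta_t\omega)\Big]u+z^{-1}(t,\omega)B(u)=z(t,\omega)\mathcal P f\quad (t>\tau),\qquad u|_{t=\tau}=u_\tau,\qquad\text{(CNSE)}$$ where $A=-\mathcal P\Delta$, $B(u)=\mathcal P[(u\cdot\nabla)u]$ and $\mathcal P$ is the orthogonal projection of $L^2(\mathbb R^2;\mathbb R^2)$ onto $\mathbb H$, is a function $u\in C([\tau,\infty);\mathbb H)\cap L^2_{\rm loc}([\tau,\infty);\mathbb V)$ such that for all $\psi\in\mathbb V$ and $t\ge\tau$ $$(u(t),\psi)+\nu\int_\tau^t(\nabla u,\nabla\psi)\,ds+\int_\tau^t\Big[\frac{\sigma^2}{2}-\sigma y(\theta_s\omega)\Big](u,\psi)\,ds+\int_\tau^t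 z^{-1}(s,\omega)\,b(u,u,\psi)\,ds=(u_\tau,\psi)+\int_\tau^t z(s,\omega)(f,\psi)\,ds .$$ Then for all $\omega\in\Omega$ and $\tau\in\mathbb R$: (i) for every $u_\tau\in\mathbb H$, (CNSE) has exactly one weak solution $u(\cdot)=u(\cdot;\tau,\omega,u_\tau)$ on $[\tau,\infty)$; (ii) for every $t>\tau$ and every $u_\tau\in\mathbb H$ one has $u(t;\tau,\omega,u_\tau)\in\mathbb V$, and the map $u_\tau\mapsto u(t;\tau,\omega,u_\tau)$ is continuous from $\mathbb H$ to $\mathbb V$; (iii) consequently the random cocycle of the 2D stochastic Navier–Stokes equations $dv=-[\nu Av+B(v)-\mathcal Pf]\,dt+\sigma v\,dW$ on $\mathbb R^2$, given by $$\Phi(t,\tau,\omega,v_\tau)=\frac{u(t+\tau;\tau,\theta_{-\tau}\omega,z(\tau,\theta_{-\tau}\omega)v_\tau)}{z(t+\tau,\theta_{-\tau}\omega)},$$ is $(\mathbb H,\mathbb V)$-continuous: for every $t>0$, $\Phi(t,\tau,\omega,\cdot)$ maps $\mathbb H$ into $\mathbb V$ and is continuous from $\mathbb H$ to $\mathbb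 V$. -/

import Mathlib

noncomputable section

open MeasureTheory Set
open scoped RealInnerProductSpace

namespace SNSE

/-- The Euclidean plane, used both as the spatial domain and as the space of velocities. -/
abbrev Plane : Type := EuclideanSpace ℝ (Fin 2)

/-- Values of gradients of vector fields: the `i`-th entry is the partial derivative `∂ᵢ v`, and
the norm is the Euclidean (Frobenius) one, `|∇v|² = ∑ i, |∂ᵢ v|²`. -/
abbrev GradVal : Type := PiLp 2 (fun _ : Fin 2 => Plane)

/-- `𝕃²(ℝ²) = L²(ℝ²; ℝ²)`. -/
abbrev L2 : Type := Lp Plane 2 (volume : Measure Plane)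

/-- Square integrable gradient fields. -/
abbrev L2Grad : Type := Lp GradVal 2 (volume : Measure Plane)

/-- Pairs `(v, g)` with norm `(‖v‖² + ‖g‖²)^{1/2}`; a field `v` in `H¹` is recorded as
`(v, ∇v)`. -/
abbrev L2Pair : Type := WithLp 2 (L2 × L2Grad)

/-- The classical gradient. -/
def grad (φ : Plane → Plane) (x : Plane) : GradVal :=
  WithLp.toLp 2 (fun i : Fin 2 => fderiv ℝ φ x (EuclideanSpace.single i (1 : ℝ)))

/-- The classical divergence. -/
def divergence (φ : Plane → Plane) (x : Plane) : ℝ :=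
  ∑ i : Fin 2, grad φ x i i

lemma grad_add {φ ψ : Plane → Plane} (hφ : ContDiff ℝ (⊤ : ℕ∞) φ) (hψ : ContDiff ℝ (⊤ : ℕ∞) ψ) :
    grad (φ + ψ) = grad φ + grad ψ := by
  funext x
  ext i j
  simp [grad, fderiv_add (hφ.differentiable (by simp) x) (hψ.differentiable (by simp) x)]

lemma grad_smul (c : ℝ) {φ : Plane → Plane} (hφ : ContDiff ℝ (⊤ : ℕ∞) φ) :
    grad (c • φ) = c • grad φ := by
  funext x
  ext i j
  simp [grad, fderiv_const_smul (hφ.differentiable (by simp) x)]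

/-- `𝒱`: smooth, compactly supported, divergence free vector fields on the plane. -/
def testFields : Submodule ℝ (Plane → Plane) where
  carrier := {φ | ContDiff ℝ (⊤ : ℕ∞) φ ∧ HasCompactSupport φ ∧ ∀ x, divergence φ x = 0}
  add_mem' := by
    rintro φ ψ ⟨h1, h2, h3⟩ ⟨k1, k2, k3⟩
    refine ⟨h1.add k1, h2.add k2, fun x => ?_⟩
    have h := h3 x
    have k := k3 x
    simp only [divergence, grad_add h1 k1, Fin.sum_univ_two, Pi.add_apply, PiLp.add_apply] at *
    linarith
  zero_mem' := by
    refine ⟨contDiff_const, HasCompactSupport.zero, fun x => ?_⟩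
    simp [divergence, grad]
  smul_mem' := by
    rintro c φ ⟨h1, h2, h3⟩
    refine ⟨contDiff_const.smul h1, h2.smul_left (f := fun _ => c), fun x => ?_⟩
    have h := h3 x
    simp only [divergence, grad_smul c h1, Fin.sum_univ_two, Pi.smul_apply, PiLp.smul_apply,
      smul_eq_mul] at *
    rw [← mul_add, h, mul_zero]

lemma memLp_test (φ : testFields) : MemLp (φ : Plane → Plane) 2 (volume : Measure Plane) :=
  φ.2.1.continuous.memLp_of_hasCompactSupport φ.2.2.1

lemma memLp_grad_test (φ : testFields) :
    MemLp (grad (φ : Plane → Plane)) 2 (volume : Measure Plane) := by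
  have hc : Continuous (grad (φ : Plane → Plane)) := by
    have h := φ.2.1.continuous_fderiv (by simp)
    unfold grad
    fun_prop
  refine hc.memLp_of_hasCompactSupport ?_
  refine (φ.2.2.1.fderiv (𝕜 := ℝ)).mono' ?_
  intro x hx
  refine subset_tsupport _ ?_
  intro h0
  apply hx
  ext i j
  simp [grad, h0]

/-- The inclusion `𝒱 → 𝕃²(ℝ²)`. -/
def testToL2 : testFields →ₗ[ℝ] L2 where
  toFun φ := (memLp_test φ).toLp _
  map_add' _ _ := rfl
  map_smul' _ _ := rfl

/-- The map `φ ↦ (φ, ∇φ)` on `𝒱`. -/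
def testToPair : testFields →ₗ[ℝ] L2Pair where
  toFun φ := WithLp.toLp 2 ((memLp_test φ).toLp _, (memLp_grad_test φ).toLp _)
  map_add' φ ψ := by
    have h : (memLp_grad_test (φ + ψ)).toLp _
        = (memLp_grad_test φ).toLp _ + (memLp_grad_test ψ).toLp _ := by
      rw [← MemLp.toLp_add]
      exact MemLp.toLp_congr _ _ (by rw [← grad_add φ.2.1 ψ.2.1]; rfl)
    rw [h]
    rfl
  map_smul' c φ := by
    have h : (memLp_grad_test (c • φ)).toLp _ = c • (memLp_grad_test φ).toLp _ := by
      rw [← MemLp.toLp_const_smul]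
      exact MemLp.toLp_congr _ _ (by rw [← grad_smul c φ.2.1]; rfl)
    rw [h]
    rfl

/-- `ℍ`: the closure of `𝒱` in the `L²` norm. -/
def spaceH : Submodule ℝ L2 := (LinearMap.range testToL2).topologicalClosure

/-- `𝕍`: the completion of `𝒱` in the `H¹` norm `(‖v‖² + ‖∇v‖²)^{1/2}`, realised as the closure
of the pairs `(φ, ∇φ)`. The second component is determined by the first, being its weak
gradient. -/
def spaceV : Submodule ℝ L2Pair := (LinearMap.range testToPair).topologicalClosure

/-- The field underlying an element of `𝕍`. -/
def field (w : spaceV) : L2 := (w : L2Pair).fst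

/-- The gradient of an element of `𝕍`. -/
def gradV (w : spaceV) : L2Grad := (w : L2Pair).snd

/-- The trilinear form `b(u, v, w) = ∫ ∑ᵢⱼ uᵢ (∂ᵢ vⱼ) wⱼ dx` on `𝕍`. -/
def trilinear (u v w : spaceV) : ℝ :=
  ∫ x : Plane, ∑ i : Fin 2, ∑ j : Fin 2, field u x i * gradV v x i j * field w x j

/-- The Wiener shift `θ_t ω = ω(· + t) - ω(t)`. -/
def shift (t : ℝ) (ω : C(ℝ, ℝ)) : C(ℝ, ℝ) :=
  ⟨fun s => ω (s + t) - ω t, by fun_prop⟩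

/-- The set of admissible paths: continuous paths through `0` for which the Ornstein-Uhlenbeck
integral below converges. It contains every path with `ω(t)/t → 0` as `t → -∞`, is invariant
under the shifts, and has full two-sided Wiener measure. -/
def pathSet : Set C(ℝ, ℝ) :=
  {ω | ω 0 = 0 ∧ IntegrableOn (fun ξ : ℝ => Real.exp ξ * ω ξ) (Iic 0)}

/-- The Ornstein-Uhlenbeck variable `y(ω) = ∫_{-∞}^0 e^ξ dω(ξ)`, in its pathwise form
`-∫_{-∞}^0 e^ξ ω(ξ) dξ` obtained from an integration by parts; `t ↦ ouVar (shift t ω)` is the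
stationary solution `∫_{-∞}^t e^{-(t-ξ)} dω(ξ)` of `dy + y dt = dω`. -/
def ouVar (ω : C(ℝ, ℝ)) : ℝ := -∫ ξ in Iic (0 : ℝ), Real.exp ξ * ω ξ

/-- `z(t, ω) = e^{-σ y(θ_t ω)}`. -/
def zFactor (σ t : ℝ) (ω : C(ℝ, ℝ)) : ℝ := Real.exp (-σ * ouVar (shift t ω))

/-- `f ∈ L²_loc(ℝ; 𝕃²(ℝ²))`. -/
def IsL2Loc (f : ℝ → L2) : Prop :=
  ∀ a b : ℝ, MemLp f 2 (volume.restrict (Icc a b))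

/-- `u` is a weak solution on `[τ, ∞)`, with initial value `u₀` at time `τ`, of
`du/dt + ν A u + [σ²/2 - σ y(θ_t ω)] u + z⁻¹(t, ω) B(u) = z(t, ω) 𝒫 f` in `𝕍*`:
`u ∈ C([τ, ∞); ℍ) ∩ L²_loc([τ, ∞); 𝕍)` and the time-integrated equation holds against every
`ψ ∈ 𝕍`. Here `w` is `u` regarded as an `𝕍`-valued function. Only the values of `u` on `[τ, ∞)`
matter. -/
structure IsWeakSolution (ν σ : ℝ) (f : ℝ → L2) (ω : C(ℝ, ℝ)) (τ : ℝ) (u₀ : spaceH)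
    (u : ℝ → spaceH) : Prop where
  continuousOn : ContinuousOn u (Ici τ)
  initial : u τ = u₀
  equation : ∃ w : ℝ → spaceV,
    (∀ T : ℝ, MemLp w 2 (volume.restrict (Icc τ T))) ∧
    (∀ᵐ s ∂(volume.restrict (Ici τ)), field (w s) = (u s : L2)) ∧
    ∀ ψ : spaceV, ∀ t : ℝ, τ ≤ t →
      ⟪(u t : L2), field ψ⟫
        + ν * (∫ s in τ..t, ⟪gradV (w s), gradV ψ⟫)
        + (∫ s in τ..t, (σ ^ 2 / 2 - σ * ouVar (shift s ω)) * ⟪(u s : L2), field ψ⟫)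
        + (∫ s in τ..t, (zFactor σ s ω)⁻¹ * trilinear (w s) (w s) ψ)
      = ⟪(u₀ : L2), field ψ⟫ + ∫ s in τ..t, zFactor σ s ω * ⟪f s, field ψ⟫

open Classical in
/-- The solution `u(t; τ, ω, u₀)` of the pathwise system (the value `0` is used only if there
is no solution). -/
def solution (ν σ : ℝ) (f : ℝ → L2) (ω : C(ℝ, ℝ)) (τ : ℝ) (u₀ : spaceH) : ℝ → spaceH :=
  if h : ∃ u, IsWeakSolution ν σ f ω τ u₀ u then h.choose else 0

/-- The cocycle
`Φ(t, τ, ω, v₀) = u(t + τ; τ, θ_{-τ} ω, z(τ, θ_{-τ} ω) v₀) / z(t + τ, θ_{-τ} ω)`. -/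
def cocycle (ν σ : ℝ) (f : ℝ → L2) (t τ : ℝ) (ω : C(ℝ, ℝ)) (v₀ : spaceH) : spaceH :=
  (zFactor σ (t + τ) (shift (-τ) ω))⁻¹ •
    solution ν σ f (shift (-τ) ω) τ (zFactor σ τ (shift (-τ) ω) • v₀) (t + τ)

/-- A map `S : ℍ → ℍ` is `(ℍ, 𝕍)`-continuous: it takes values in `𝕍` and is continuous from
`ℍ` with its `L²` norm to `𝕍` with its `H¹` norm. -/
def IsHVContinuous (S : spaceH → spaceH) : Prop :=
  ∃ U : spaceH → spaceV, (∀ x, field (U x) = (S x : L2)) ∧ Continuous U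

end SNSE

end

set_option linter.unusedSectionVars false

noncomputable section

open MeasureTheory Set Filter Topology
open scoped RealInnerProductSpace ENNReal NNReal

namespace SNSE

open ContinuousLinearMap (adjoint)

section

/-! ### Gronwall inequalities -/

/-! For a fixed path the factors `z`, `z⁻¹` and `y(θ_t ω)` are continuous in time, so the system is
a deterministic 2D Navier-Stokes equation with continuous coefficients and a force in `L²_loc`.
Replacing `ν A` by `ν (1 + A)` and correcting the damping by `-ν` makes the principal part `ν Λ`,
where `Λ` is the operator of the full `𝕍` inner product. Everything is then proved for an abstract
embedding `ι : V → H` and a trilinear form `b` satisfying `IsNSETriple`: skew-symmetry, the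
Ladyzhenskaya bound, and a second bound that tests with the `H` norm alone when the middle argument
lies in the range of `adjoint ι`, the domain of `Λ`.

Existence. With `J = (1 + l Λ)⁻¹` and the Yosida approximation of `Λ`, the regularized equation is
an ODE in `H` with locally Lipschitz right-hand side; it is global since `b(u, v, v) = 0`.
Gronwall's inequality gives bounds in `H` and in `V` that do not depend on `l`. For initial values
in `V` and continuous forces, `regSol_cauchy` shows that two regularized solutions differ in squared
norm by `O(l + m)`. Hence they converge strongly, without any compactness, which the whole plane
would not provide. Lipschitz dependence in `H` then extends existence to data in `H` and `L²`
forces.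

Uniqueness. Skew-symmetry puts `B(u)` in `L²(V*)` for every weak solution, so the difference of two
solutions obeys the energy identity (`energy_identity`), and a Gronwall argument with an integrable
coefficient shows that it vanishes.

Smoothing and continuity. For two solutions `u`, `v` on `[τ, T]`, the energy estimate for the
difference bounds `∫ ‖u - v‖_V²` by a multiple of `|u(τ) - v(τ)|²`, while the `V` norms of both
solutions are square integrable. Averaging produces a time `s` at which `u(s)`, `v(s)` are bounded
in `V` and `‖u(s) - v(s)‖_V` is at most a multiple of `|u(τ) - v(τ)|`. From `s` on, the Lipschitz
estimate in `V`, uniform in the starting time, carries this to `T`. So `u(τ) ↦ u(T)` is locally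
Lipschitz from `H` to `V` (`isSol_lipschitz_HV`), and no pointwise-in-time control of the force is
needed.

The concrete spaces. Ladyzhenskaya's inequality is the embedding of `W^{1,1}` in `L²` applied to
`|φ|²`. The second bound on `b` needs gradients in `L⁴` for fields in the domain of `Λ`; as
translations act isometrically on `𝕍`, difference quotients provide it. The cocycle is a solution
map composed with multiplications by constants. -/

lemma hasDerivAt_integral_of_continuousOn {E : Type*} [NormedAddCommGroup E] [NormedSpace ℝ E]
    [CompleteSpace E] {τ T t : ℝ} {y : ℝ → E} (hy : ContinuousOn y (Icc τ T)) (ht : t ∈ Ioo τ T) :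
    HasDerivAt (fun r => ∫ s in τ..r, y s) (y t) t := by
  have hint : IntervalIntegrable y volume τ t :=
    (hy.mono (Icc_subset_Icc_right ht.2.le)).intervalIntegrable_of_Icc ht.1.le
  refine intervalIntegral.integral_hasDerivAt_right hint ?_ ?_
  · exact (hy.mono Ioo_subset_Icc_self).stronglyMeasurableAtFilter isOpen_Ioo t ht
  · exact hy.continuousAt (Icc_mem_nhds ht.1 ht.2)

lemma continuousOn_integral_of_continuousOn {E : Type*} [NormedAddCommGroup E] [NormedSpace ℝ E]
    {τ T : ℝ} (hτT : τ ≤ T) {y : ℝ → E} (hy : ContinuousOn y (Icc τ T)) :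
    ContinuousOn (fun r => ∫ s in τ..r, y s) (Icc τ T) := by
  have h := intervalIntegral.continuousOn_primitive_interval' (a := τ)
    (hy.intervalIntegrable_of_Icc (μ := volume) hτT) left_mem_uIcc
  rwa [uIcc_of_le hτT] at h

/-- Gronwall's inequality with a dissipative term `y`. -/
lemma gronwall_dissipative {τ T : ℝ} (hτT : τ ≤ T) {x x' y k h : ℝ → ℝ}
    (hx : ContinuousOn x (Icc τ T)) (hx' : ∀ t ∈ Ioo τ T, HasDerivAt x (x' t) t)
    (hy : ContinuousOn y (Icc τ T)) (hk : ContinuousOn k (Icc τ T))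
    (hh : ContinuousOn h (Icc τ T)) (hx0 : 0 ≤ x τ) (hy0 : ∀ t ∈ Icc τ T, 0 ≤ y t)
    (hk0 : ∀ t ∈ Icc τ T, 0 ≤ k t) (hh0 : ∀ t ∈ Icc τ T, 0 ≤ h t)
    (hle : ∀ t ∈ Ioo τ T, x' t + y t ≤ k t * x t + h t) {t : ℝ} (ht : t ∈ Icc τ T) :
    x t + ∫ s in τ..t, y s ≤ Real.exp (∫ s in τ..T, k s) * (x τ + ∫ s in τ..T, h s) := by
  have nonneg_int : ∀ {q : ℝ → ℝ}, (∀ t ∈ Icc τ T, 0 ≤ q t) → ∀ r ∈ Icc τ T,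
      0 ≤ ∫ s in τ..r, q s := fun hq r hr =>
    intervalIntegral.integral_nonneg hr.1 fun s hs => hq s ⟨hs.1, hs.2.trans hr.2⟩
  have mono_int : ∀ {q : ℝ → ℝ}, ContinuousOn q (Icc τ T) → (∀ t ∈ Icc τ T, 0 ≤ q t) →
      (∫ s in τ..t, q s) ≤ ∫ s in τ..T, q s := by
    intro q hqc hq
    have h1 := hqc.mono (Icc_subset_Icc_right ht.2)
    have h2 := hqc.mono (Icc_subset_Icc_left ht.1)
    rw [← intervalIntegral.integral_add_adjacent_intervals
      (h1.intervalIntegrable_of_Icc (μ := volume) ht.1)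
      (h2.intervalIntegrable_of_Icc (μ := volume) ht.2)]
    have := intervalIntegral.integral_nonneg (μ := volume) ht.2
      fun s hs => hq s ⟨ht.1.trans hs.1, hs.2⟩
    linarith
  -- The integral of `y` sits inside the exponential factor, where differentiation only produces the
  -- favourable term `-k ∫ y`. The integral of `h` sits outside, which is harmless because the
  -- factor is at most one.
  set φ : ℝ → ℝ := fun t => Real.exp (-∫ s in τ..t, k s) * (x t + ∫ s in τ..t, y s)
    - ∫ s in τ..t, h s with hφ
  have hanti : AntitoneOn φ (Icc τ T) := by
    refine antitoneOn_of_hasDerivWithinAt_nonpos (convex_Icc τ T)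
      (f' := fun t => (Real.exp (-∫ s in τ..t, k s) * -k t) * (x t + ∫ s in τ..t, y s)
        + Real.exp (-∫ s in τ..t, k s) * (x' t + y t) - h t) ?_ ?_ ?_
    · exact ((continuousOn_integral_of_continuousOn hτT hk).neg.rexp.mul
        (hx.add (continuousOn_integral_of_continuousOn hτT hy))).sub
        (continuousOn_integral_of_continuousOn hτT hh)
    · intro r hr
      rw [interior_Icc] at hr
      exact ((((hasDerivAt_integral_of_continuousOn hk hr).neg.exp).mul
        ((hx' r hr).add (hasDerivAt_integral_of_continuousOn hy hr))).sub
        (hasDerivAt_integral_of_continuousOn hh hr)).hasDerivWithinAt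
    · intro r hr
      rw [interior_Icc] at hr
      have hr' := Ioo_subset_Icc_self hr
      have e0 := Real.exp_pos (-∫ s in τ..r, k s)
      have e1 : Real.exp (-∫ s in τ..r, k s) ≤ 1 :=
        Real.exp_le_one_iff.2 (neg_nonpos.2 (nonneg_int hk0 r hr'))
      have h1 := hle r hr
      have h2 := mul_nonneg (hk0 r hr') (nonneg_int hy0 r hr')
      have h3 := hh0 r hr'
      have h4 : Real.exp (-∫ s in τ..r, k s) *
          (x' r + y r - k r * (x r + ∫ s in τ..r, y s)) ≤
          Real.exp (-∫ s in τ..r, k s) * h r :=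
        mul_le_mul_of_nonneg_left (by linarith) e0.le
      have h5 : Real.exp (-∫ s in τ..r, k s) * h r ≤ 1 * h r :=
        mul_le_mul_of_nonneg_right e1 h3
      linarith
  have h0 := hanti (left_mem_Icc.2 hτT) ht ht.1
  simp only [hφ, intervalIntegral.integral_same, neg_zero, Real.exp_zero, one_mul, add_zero,
    sub_zero] at h0
  have e0 := Real.exp_pos (∫ s in τ..t, k s)
  have h1 : x t + ∫ s in τ..t, y s
      ≤ Real.exp (∫ s in τ..t, k s) * (x τ + ∫ s in τ..t, h s) := by
    have : x t + ∫ s in τ..t, y s = Real.exp (∫ s in τ..t, k s) *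
        (Real.exp (-∫ s in τ..t, k s) * (x t + ∫ s in τ..t, y s)) := by
      rw [← mul_assoc, ← Real.exp_add]; simp
    rw [this]
    exact mul_le_mul_of_nonneg_left (by linarith) e0.le
  refine h1.trans (mul_le_mul (Real.exp_le_exp.2 (mono_int hk hk0)) ?_ ?_ (Real.exp_pos _).le)
  · linarith [mono_int hh hh0]
  · linarith [nonneg_int hh0 t ht]

/-- Uniqueness form of Gronwall's inequality with an integrable coefficient. -/
lemma eq_zero_of_le_integral_mul {τ T : ℝ} {x k : ℝ → ℝ} (hx : ContinuousOn x (Icc τ T))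
    (hx0 : ∀ t ∈ Icc τ T, 0 ≤ x t) (hk : IntegrableOn k (Icc τ T))
    (hk0 : ∀ t ∈ Icc τ T, 0 ≤ k t)
    (hle : ∀ t ∈ Icc τ T, x t ≤ ∫ s in τ..t, k s * x s) :
    ∀ t ∈ Icc τ T, x t = 0 := by
  intro t ht
  have hτT : τ ≤ T := ht.1.trans ht.2
  have hkx : IntegrableOn (fun s => k s * x s) (Icc τ T) :=
    hk.mul_continuousOn hx isCompact_Icc
  have ii : ∀ {q : ℝ → ℝ}, IntegrableOn q (Icc τ T) → ∀ r ∈ Icc τ T, ∀ s ∈ Icc τ T,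
      IntervalIntegrable q volume r s := by
    intro q hq r hr s hs
    refine IntegrableOn.intervalIntegrable (hq.mono_set ?_)
    exact uIcc_subset_Icc hr hs
  have hτ : τ ∈ Icc τ T := left_mem_Icc.2 hτT
  set Y : ℝ → ℝ := fun t => ∫ s in τ..t, k s * x s with hY
  have cont : ∀ {q : ℝ → ℝ}, IntegrableOn q (Icc τ T) →
      ContinuousOn (fun t => ∫ s in τ..t, q s) (Icc τ T) := by
    intro q hq
    have := intervalIntegral.continuousOn_primitive_interval (a := τ) (b := T)
      (f := q) (μ := volume) (by rwa [uIcc_of_le hτT])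
    rwa [uIcc_of_le hτT] at this
  have hYsub : ∀ r ∈ Icc τ T, ∀ s ∈ Icc τ T, Y s - Y r = ∫ q in r..s, k q * x q :=
    fun r hr s hs => intervalIntegral.integral_interval_sub_left (ii hkx τ hτ s hs)
      (ii hkx τ hτ r hr)
  have hYmono : ∀ r ∈ Icc τ T, ∀ s ∈ Icc τ T, r ≤ s → Y r ≤ Y s := by
    intro r hr s hs hrs
    have h1 := hYsub r hr s hs
    have h2 : 0 ≤ ∫ q in r..s, k q * x q := intervalIntegral.integral_nonneg hrs
      fun q hq => mul_nonneg (hk0 q ⟨hr.1.trans hq.1, hq.2.trans hs.2⟩)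
        (hx0 q ⟨hr.1.trans hq.1, hq.2.trans hs.2⟩)
    linarith
  have hY0 : ∀ r ∈ Icc τ T, 0 ≤ Y r := fun r hr => by
    simpa [hY] using hYmono τ hτ r hr hr.1
  -- As `k` is only integrable, the argument is by continuation: the zero set of `Y` is closed, and
  -- to the right of a zero `r`, as long as `∫ k < 1/2`, monotonicity of `Y` gives `Y s ≤ (∫ k) Y
  -- s`, which forces `Y s = 0`.
  have key : Icc τ T ⊆ {r | Y r = 0} := by
    refine IsClosed.Icc_subset_of_forall_mem_nhdsWithin ?_ (by simp [hY]) ?_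
    · rw [inter_comm]
      exact (cont hkx).preimage_isClosed_of_isClosed isClosed_Icc isClosed_singleton
    · rintro r ⟨hr, hrT⟩
      have hr' : r ∈ Icc τ T := ⟨hrT.1, hrT.2.le⟩
      have hc := (cont hk) r hr'
      have h1 : ∀ᶠ s in 𝓝[Icc τ T] r,
          (∫ q in τ..s, k q) < (∫ q in τ..r, k q) + 1 / 2 :=
        hc.eventually (gt_mem_nhds (by linarith))
      have h2 : 𝓝[>] r ≤ 𝓝[Icc τ T] r := by
        rw [← nhdsWithin_Ioc_eq_nhdsGT hrT.2]
        exact nhdsWithin_mono _ fun s hs => ⟨hr'.1.trans hs.1.le, hs.2⟩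
      filter_upwards [h2 h1, h2 self_mem_nhdsWithin, self_mem_nhdsWithin] with s hs hsT hrs
      have hrs' : r ≤ s := le_of_lt hrs
      have e1 : Y s = ∫ q in r..s, k q * x q := by
        have := hYsub r hr' s hsT
        rw [show Y r = 0 from hr] at this
        linarith
      have e2 : (∫ q in r..s, k q * x q) ≤ ∫ q in r..s, k q * Y s := by
        refine intervalIntegral.integral_mono_on hrs' (ii hkx r hr' s hsT)
          ((ii hk r hr' s hsT).mul_const _) fun q hq => ?_
        have hq' : q ∈ Icc τ T := ⟨hr'.1.trans hq.1, hq.2.trans hsT.2⟩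
        exact mul_le_mul_of_nonneg_left ((hle q hq').trans (hYmono q hq' s hsT hq.2)) (hk0 q hq')
      have e3 : (∫ q in r..s, k q) = (∫ q in τ..s, k q) - ∫ q in τ..r, k q :=
        (intervalIntegral.integral_interval_sub_left (ii hk τ hτ s hsT) (ii hk τ hτ r hr')).symm
      rw [intervalIntegral.integral_mul_const] at e2
      have h3 := hY0 s hsT
      change Y s = 0
      nlinarith
  have h1 := hle t ht
  have h2 : Y t = 0 := key ht
  have h3 := hx0 t ht
  change x t ≤ Y t at h1
  linarith

end

section

/-! ### Global solutions of dissipative ordinary differential equations -/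

/-- The radial retraction onto the ball of radius `ρ`. -/
def radialRetract {E : Type*} [NormedAddCommGroup E] [NormedSpace ℝ E] (ρ : ℝ) (x : E) : E :=
  (ρ / max ρ ‖x‖) • x

section Retract

variable {E : Type*} [NormedAddCommGroup E] [NormedSpace ℝ E] {ρ : ℝ}

lemma norm_radialRetract_le (hρ : 0 < ρ) (x : E) : ‖radialRetract ρ x‖ ≤ ρ := by
  have hm : 0 < max ρ ‖x‖ := lt_max_of_lt_left hρ
  rw [radialRetract, norm_smul, Real.norm_of_nonneg (by positivity), div_mul_eq_mul_div,
    div_le_iff₀ hm]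
  exact mul_le_mul_of_nonneg_left (le_max_right _ _) hρ.le

lemma radialRetract_of_norm_le (hρ : 0 < ρ) {x : E} (hx : ‖x‖ ≤ ρ) : radialRetract ρ x = x := by
  rw [radialRetract, max_eq_left hx, div_self hρ.ne', one_smul]

/-- Moving the point and changing the scaling factor each cost at most `‖x - y‖`. The constant is
not optimal in a Hilbert space, but any Lipschitz constant suffices for Picard-Lindelöf. -/
lemma norm_radialRetract_sub_le (hρ : 0 < ρ) (x y : E) :
    ‖radialRetract ρ x - radialRetract ρ y‖ ≤ 2 * ‖x - y‖ := by
  set m := max ρ ‖x‖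
  set n := max ρ ‖y‖
  have hm : 0 < m := lt_max_of_lt_left hρ
  have hn : 0 < n := lt_max_of_lt_left hρ
  have e : radialRetract ρ x - radialRetract ρ y
      = (ρ / m) • (x - y) + (ρ / m - ρ / n) • y := by
    simp only [radialRetract, m, n]; module
  have h1 : ‖(ρ / m) • (x - y)‖ ≤ ‖x - y‖ := by
    rw [norm_smul, Real.norm_of_nonneg (by positivity)]
    refine mul_le_of_le_one_left (norm_nonneg _) ?_
    rw [div_le_one hm]; exact le_max_left _ _
  have h2 : ‖(ρ / m - ρ / n) • y‖ ≤ ‖x - y‖ := by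
    have e2 : ρ / m - ρ / n = (ρ / m) * ((n - m) / n) := by field_simp
    have e3 : |n - m| ≤ ‖x - y‖ := by
      refine (abs_max_sub_max_le_max _ _ _ _).trans ?_
      simp only [sub_self, abs_zero]
      rw [max_eq_right (abs_nonneg _), norm_sub_rev]
      exact abs_norm_sub_norm_le _ _
    rw [e2, norm_smul, norm_mul, norm_div, norm_div, Real.norm_of_nonneg hρ.le,
      Real.norm_of_nonneg hm.le, Real.norm_of_nonneg hn.le, Real.norm_eq_abs]
    have h3 : ρ / m ≤ 1 := by rw [div_le_one hm]; exact le_max_left _ _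
    have h4 : ‖y‖ / n ≤ 1 := by rw [div_le_one hn]; exact le_max_right _ _
    calc ρ / m * (|n - m| / n) * ‖y‖ = (ρ / m) * (‖y‖ / n) * |n - m| := by ring
      _ ≤ 1 * 1 * |n - m| := by gcongr
      _ ≤ ‖x - y‖ := by linarith
  rw [e]
  refine (norm_add_le _ _).trans ?_
  linarith

end Retract

/-- Global existence for an ordinary differential equation whose right-hand side is Lipschitz on
bounded sets and satisfies a one-sided growth bound. -/
lemma exists_global_solution {E : Type*} [NormedAddCommGroup E] [InnerProductSpace ℝ E]
    [CompleteSpace E] {τ T : ℝ} (hτT : τ ≤ T) (F : ℝ → E → E)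
    (hFt : ∀ x, ContinuousOn (fun t => F t x) (Icc τ T))
    (hFx : ∀ ρ > 0, ∃ L : ℝ, ∀ t ∈ Icc τ T, ∀ x y, ‖x‖ ≤ ρ → ‖y‖ ≤ ρ →
      ‖F t x - F t y‖ ≤ L * ‖x - y‖)
    {A G : ℝ} (hA : 0 ≤ A) (hG : 0 ≤ G)
    (hdiss : ∀ t ∈ Icc τ T, ∀ x, ⟪F t x, x⟫ ≤ A * ‖x‖ ^ 2 + G * ‖x‖) (x₀ : E) :
    ∃ u : ℝ → E, u τ = x₀ ∧ ContinuousOn u (Icc τ T) ∧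
      ∀ t ∈ Ioo τ T, HasDerivAt u (F t (u t)) t := by
  -- The a priori bound on `‖u‖²`: by `‖u‖ ≤ ‖u‖² + 1`, the growth hypothesis gives `(‖u‖²)' ≤ 2 (A
  -- + G) ‖u‖² + 2 G`.
  set ρ₀ : ℝ := Real.exp (∫ _ in τ..T, 2 * (A + G)) * (‖x₀‖ ^ 2 + ∫ _ in τ..T, 2 * G) with hρ₀
  have hρ₀0 : 0 ≤ ρ₀ := by
    have : 0 ≤ ∫ _ in τ..T, 2 * G :=
      intervalIntegral.integral_nonneg hτT fun _ _ => by positivity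
    positivity
  -- Since `r ≤ r² + 1`, a bound `ρ₀` on the square is a bound `ρ` on the norm. The truncation at
  -- radius `ρ` is therefore never active along the solution.
  set ρ : ℝ := ρ₀ + 1 with hρ
  have hρ0 : 0 < ρ := by positivity
  obtain ⟨L, hL⟩ := hFx ρ hρ0
  obtain ⟨M, hM⟩ := isCompact_Icc.exists_bound_of_continuousOn (hFt 0)
  have hbd : ∀ t ∈ Icc τ T, ∀ x, ‖F t (radialRetract ρ x)‖ ≤ |L| * ρ + |M| := by
    intro t ht x
    have h1 := hL t ht (radialRetract ρ x) 0 (norm_radialRetract_le hρ0 x) (by simpa using hρ0.le)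
    have h2 : ‖F t (radialRetract ρ x)‖ ≤ ‖F t (radialRetract ρ x) - F t 0‖ + ‖F t 0‖ := by
      simpa using norm_add_le (F t (radialRetract ρ x) - F t 0) (F t 0)
    have h3 : L * ‖radialRetract ρ x - 0‖ ≤ |L| * ρ := by
      rw [sub_zero]
      exact mul_le_mul (le_abs_self L) (norm_radialRetract_le hρ0 x) (norm_nonneg _) (abs_nonneg _)
    have h4 := (hM t ht).trans (le_abs_self M)
    linarith
  -- The truncated field is globally bounded, so the ball can be given radius (bound) times (length
  -- of the interval), and one application of Picard-Lindelöf covers all of `[τ, T]`.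
  have hPL : IsPicardLindelof (fun t x => F t (radialRetract ρ x))
      (⟨τ, left_mem_Icc.2 hτT⟩ : Icc τ T) x₀ (Real.toNNReal ((|L| * ρ + |M|) * (T - τ))) 0
      (Real.toNNReal (|L| * ρ + |M|)) (Real.toNNReal (|L| * 2)) := by
    refine ⟨?_, ?_, ?_, ?_⟩
    · intro t ht
      refine LipschitzOnWith.of_dist_le_mul fun x _ y _ => ?_
      rw [dist_eq_norm, dist_eq_norm, Real.coe_toNNReal _ (by positivity)]
      refine (hL t ht _ _ (norm_radialRetract_le hρ0 x) (norm_radialRetract_le hρ0 y)).trans ?_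
      have h1 := norm_radialRetract_sub_le hρ0 x y
      calc L * ‖radialRetract ρ x - radialRetract ρ y‖ ≤ |L| * (2 * ‖x - y‖) :=
            mul_le_mul (le_abs_self L) h1 (norm_nonneg _) (abs_nonneg _)
        _ = |L| * 2 * ‖x - y‖ := by ring
    · intro x _
      exact hFt _
    · intro t ht x _
      rw [Real.coe_toNNReal _ (by positivity)]
      exact hbd t ht x
    · rw [Real.coe_toNNReal _ (by positivity),
        Real.coe_toNNReal _ (mul_nonneg (by positivity) (sub_nonneg.2 hτT))]
      simp [max_eq_left (sub_nonneg.2 hτT)]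
  obtain ⟨u, hu0, hu⟩ := hPL.exists_eq_forall_mem_Icc_hasDerivWithinAt₀
  have huc : ContinuousOn u (Icc τ T) := fun t ht => (hu t ht).continuousWithinAt
  have hud : ∀ t ∈ Ioo τ T, HasDerivAt u (F t (radialRetract ρ (u t))) t := fun t ht =>
    (hu t (Ioo_subset_Icc_self ht)).hasDerivAt (Icc_mem_nhds ht.1 ht.2)
  have hu0' : u τ = x₀ := hu0
  have hbound : ∀ t ∈ Icc τ T, ‖u t‖ ^ 2 ≤ ρ₀ := by
    intro t ht
    have := gronwall_dissipative hτT (x := fun t => ‖u t‖ ^ 2)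
      (x' := fun t => 2 * ⟪u t, F t (radialRetract ρ (u t))⟫) (y := fun _ => 0)
      (k := fun _ => 2 * (A + G)) (h := fun _ => 2 * G) (huc.norm.pow 2)
      (fun t ht => (hud t ht).norm_sq) continuousOn_const continuousOn_const continuousOn_const
      (by positivity) (fun _ _ => le_rfl) (fun _ _ => by positivity) (fun _ _ => by positivity)
      (by
        intro t ht
        -- The retraction is multiplication by some `c ∈ (0, 1]`, so dividing the growth bound at `c
        -- • u t` by `c` gives a bound for the truncated field that is no worse.
        set c : ℝ := ρ / max ρ ‖u t‖ with hc
        have hm : 0 < max ρ ‖u t‖ := lt_max_of_lt_left hρ0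
        have hc0 : 0 < c := by positivity
        have hc1 : c ≤ 1 := by rw [hc, div_le_one hm]; exact le_max_left _ _
        have h1 := hdiss t (Ioo_subset_Icc_self ht) (radialRetract ρ (u t))
        have e1 : radialRetract ρ (u t) = c • u t := rfl
        rw [e1] at h1 ⊢
        rw [inner_smul_right, norm_smul, Real.norm_of_nonneg hc0.le] at h1
        rw [real_inner_comm]
        have h2 : ⟪F t (c • u t), u t⟫ ≤ A * c * ‖u t‖ ^ 2 + G * ‖u t‖ := by
          refine le_of_mul_le_mul_left ?_ hc0
          calc c * ⟪F t (c • u t), u t⟫ ≤ _ := h1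
            _ = _ := by ring
        have h3 : A * c * ‖u t‖ ^ 2 ≤ A * ‖u t‖ ^ 2 :=
          mul_le_mul_of_nonneg_right (mul_le_of_le_one_right hA hc1) (by positivity)
        have h4 : ‖u t‖ ≤ ‖u t‖ ^ 2 + 1 := by nlinarith [sq_nonneg (‖u t‖ - 1)]
        have h5 := mul_le_mul_of_nonneg_left h4 hG
        linarith) ht
    simpa [hu0', hρ₀] using this
  refine ⟨u, hu0', huc, fun t ht => ?_⟩
  have h1 := hbound t (Ioo_subset_Icc_self ht)
  have h2 : ‖u t‖ ≤ ρ := by nlinarith [sq_nonneg (‖u t‖ - 1)]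
  have h3 := hud t ht
  rwa [radialRetract_of_norm_le hρ0 h2] at h3

end

section

/-! ### Resolvents of a Hilbert triple -/

section Resolvent

variable {H V : Type*} [NormedAddCommGroup H] [InnerProductSpace ℝ H] [CompleteSpace H]
  [NormedAddCommGroup V] [InnerProductSpace ℝ V] [CompleteSpace V]


/-- With `Λ` the operator of the form `⟪·, ·⟫_V`, so that `ι ι† = Λ⁻¹`, this is the Yosida
approximation `(Λ⁻¹ + l)⁻¹ = Λ (1 + l Λ)⁻¹`. -/
def yosida (ι : V →L[ℝ] H) (l : ℝ) : H →L[ℝ] H :=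
  Ring.inverse (ι ∘L adjoint ι + l • (1 : H →L[ℝ] H))

/-- The resolvent `(1 + l Λ)⁻¹` as an operator into the smaller space. -/
def smoother (ι : V →L[ℝ] H) (l : ℝ) : H →L[ℝ] V := adjoint ι ∘L yosida ι l

variable (ι : V →L[ℝ] H) {l : ℝ}

/-- Since `⟪ι ι† h, h⟫ = ‖ι† h‖² ≥ 0`, the shift by `l` makes the form coercive, and Lax-Milgram
inverts it. -/
lemma isUnit_shifted (hl : 0 < l) : IsUnit (ι ∘L adjoint ι + l • (1 : H →L[ℝ] H)) := by
  set S : H →L[ℝ] H := ι ∘L adjoint ι + l • (1 : H →L[ℝ] H) with hS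
  have hco : IsCoercive ((innerSL ℝ : H →L[ℝ] H →L[ℝ] ℝ) ∘L S) := by
    refine ⟨l, hl, fun h => ?_⟩
    have : ((innerSL ℝ : H →L[ℝ] H →L[ℝ] ℝ) ∘L S) h h = ‖adjoint ι h‖ ^ 2 + l * ‖h‖ ^ 2 := by
      change ⟪ι (adjoint ι h) + l • h, h⟫ = _
      rw [inner_add_left, ← ContinuousLinearMap.adjoint_inner_right, real_inner_smul_left,
        real_inner_self_eq_norm_sq, real_inner_self_eq_norm_sq]
    rw [this]
    nlinarith [sq_nonneg ‖adjoint ι h‖]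
  set e := hco.continuousLinearEquivOfBilin
  have he : (e : H →L[ℝ] H) = S := by
    ext h
    refine ext_inner_right ℝ fun w => ?_
    exact hco.continuousLinearEquivOfBilin_apply h w
  rw [← he]
  exact ⟨ContinuousLinearEquiv.toUnit e, rfl⟩

variable (hl : 0 < l)

include hl

lemma shifted_yosida (h : H) : ι (adjoint ι (yosida ι l h)) + l • yosida ι l h = h := by
  have := Ring.mul_inverse_cancel _ (isUnit_shifted ι hl)
  simpa [yosida] using DFunLike.congr_fun this h

lemma yosida_shifted (h : H) : yosida ι l (ι (adjoint ι h)) + l • yosida ι l h = h := by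
  have := Ring.inverse_mul_cancel _ (isUnit_shifted ι hl)
  simpa [yosida] using DFunLike.congr_fun this h

/-- The basic splitting `h = J h + l Λ_l h` into a part in `V` and a remainder that is small
whenever the Yosida approximation is controlled. -/
lemma smoother_add (h : H) : ι (smoother ι l h) + l • yosida ι l h = h :=
  shifted_yosida ι hl h

lemma inner_yosida_symm (h g : H) : ⟪yosida ι l h, g⟫ = ⟪h, yosida ι l g⟫ := by
  conv_lhs => rw [← shifted_yosida ι hl g]
  conv_rhs => rw [← shifted_yosida ι hl h]
  rw [inner_add_left, inner_add_right, ← ContinuousLinearMap.adjoint_inner_left ι,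
    ← ContinuousLinearMap.adjoint_inner_right ι, real_inner_smul_left, real_inner_smul_right]

/-- Identifies `⟪Λ_l h, h⟫` as the regularized squared `V` norm. It is the quantity propagated by
the `V` estimates, and it dominates `‖J h‖²`. -/
lemma inner_yosida_self (h : H) :
    ⟪yosida ι l h, h⟫ = ‖smoother ι l h‖ ^ 2 + l * ‖yosida ι l h‖ ^ 2 := by
  have e : ⟪yosida ι l h, h⟫
      = ⟪yosida ι l h, ι (adjoint ι (yosida ι l h)) + l • yosida ι l h⟫ := by
    rw [shifted_yosida ι hl h]
  rw [e, inner_add_right, ← ContinuousLinearMap.adjoint_inner_left,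
    inner_smul_right, real_inner_self_eq_norm_sq, real_inner_self_eq_norm_sq]
  rfl

lemma norm_sq_eq_smoother (h : H) : ‖h‖ ^ 2 = ‖ι (smoother ι l h)‖ ^ 2
    + 2 * l * ‖smoother ι l h‖ ^ 2 + l ^ 2 * ‖yosida ι l h‖ ^ 2 := by
  conv_lhs => rw [← smoother_add ι hl h]
  rw [norm_add_sq_real, inner_smul_right, norm_smul, mul_pow, Real.norm_eq_abs, sq_abs]
  have : ⟪ι (smoother ι l h), yosida ι l h⟫ = ‖smoother ι l h‖ ^ 2 := by
    rw [← ContinuousLinearMap.adjoint_inner_right, ← real_inner_self_eq_norm_sq]; rfl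
  rw [this]; ring

lemma norm_smoother_le (h : H) : ‖ι (smoother ι l h)‖ ≤ ‖h‖ := by
  have := norm_sq_eq_smoother ι hl h
  refine abs_le_of_sq_le_sq' ?_ (norm_nonneg _) |>.2
  have : 0 ≤ 2 * l * ‖smoother ι l h‖ ^ 2 := by positivity
  have : 0 ≤ l ^ 2 * ‖yosida ι l h‖ ^ 2 := by positivity
  linarith

/-- `Λ⁻¹` commutes with its Yosida approximations. -/
lemma yosida_comp_comm (h : H) : yosida ι l (ι (adjoint ι h)) = ι (smoother ι l h) := by
  have h1 := yosida_shifted ι hl h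
  have h2 := smoother_add ι hl h
  exact add_right_cancel (h1.trans h2.symm)

/-- On the domain of `Λ` the resolvent converges at rate `l`, because `(1 - J) Λ⁻¹ q = l Λ_l Λ⁻¹ q =
l J q` and `J` is a contraction. -/
lemma norm_smoother_sub_le (q : H) :
    ‖ι (adjoint ι q) - ι (smoother ι l (ι (adjoint ι q)))‖ ≤ l * ‖q‖ := by
  have h1 := smoother_add ι hl (ι (adjoint ι q))
  have h2 : ι (adjoint ι q) - ι (smoother ι l (ι (adjoint ι q)))
      = l • yosida ι l (ι (adjoint ι q)) := by
    rw [sub_eq_iff_eq_add, add_comm]; exact h1.symm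
  rw [h2, yosida_comp_comm ι hl, norm_smul, Real.norm_of_nonneg hl.le]
  exact mul_le_mul_of_nonneg_left (norm_smoother_le ι hl q) hl.le

/-- The resolvent on `V` and the one on `H` are intertwined by `ι†`. -/
lemma yosida_adjoint (h : H) : yosida (adjoint ι) l (adjoint ι h) = smoother ι l h := by
  have h1 := yosida_shifted (adjoint ι) hl (smoother ι l h)
  rw [ContinuousLinearMap.adjoint_adjoint] at h1
  have h2 : adjoint ι h = adjoint ι (ι (smoother ι l h)) + l • smoother ι l h := by
    conv_lhs => rw [← smoother_add ι hl h]
    simp [smoother]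
  rw [h2, map_add, map_smul]
  exact h1

lemma smoother_comp_eq (v : V) :
    smoother ι l (ι v) = v - l • yosida (adjoint ι) l v := by
  have h1 := yosida_shifted (adjoint ι) hl v
  rw [ContinuousLinearMap.adjoint_adjoint, yosida_adjoint ι hl] at h1
  exact eq_sub_of_add_eq h1

/-- The resolvent identities hold for any bounded operator between Hilbert spaces. Applied to
`adjoint ι` they exchange the roles of `H` and `V`, so contractivity on `H` becomes contractivity on
`V`. -/
lemma norm_smoother_comp_le (v : V) : ‖smoother ι l (ι v)‖ ≤ ‖v‖ := by
  have h := norm_smoother_le (adjoint ι) hl v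
  have e : adjoint ι (smoother (adjoint ι) l v) = smoother ι l (ι v) := by
    rw [smoother_comp_eq ι hl]
    exact eq_sub_of_add_eq (smoother_add (adjoint ι) hl v)
  rwa [e] at h

lemma sq_norm_smoother_le (h : H) : ‖l • smoother ι l h‖ ^ 2 ≤ l * ‖h‖ ^ 2 := by
  have := norm_sq_eq_smoother ι hl h
  have h1 : 0 ≤ l ^ 2 * ‖yosida ι l h‖ ^ 2 := by positivity
  have h2 : 0 ≤ ‖ι (smoother ι l h)‖ ^ 2 := by positivity
  rw [norm_smul, mul_pow, Real.norm_eq_abs, sq_abs]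
  have h3 : 0 ≤ l * ‖smoother ι l h‖ ^ 2 := by positivity
  calc l ^ 2 * ‖smoother ι l h‖ ^ 2 = l * (l * ‖smoother ι l h‖ ^ 2) := by ring
    _ ≤ l * ‖h‖ ^ 2 := mul_le_mul_of_nonneg_left (by linarith) hl.le

/-- Keeps the regularized `V` energy of an initial value in `V` bounded independently of `l`. -/
lemma inner_yosida_le (v : V) : ⟪yosida ι l (ι v), ι v⟫ ≤ ‖v‖ ^ 2 := by
  rw [← ContinuousLinearMap.adjoint_inner_left]
  refine (real_inner_le_norm _ _).trans ?_
  rw [sq]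
  exact mul_le_mul_of_nonneg_right (norm_smoother_comp_le ι hl v) (norm_nonneg _)

lemma sq_norm_smoother_le_inner (h : H) : ‖smoother ι l h‖ ^ 2 ≤ ⟪yosida ι l h, h⟫ := by
  rw [inner_yosida_self ι hl]
  have : 0 ≤ l * ‖yosida ι l h‖ ^ 2 := by positivity
  linarith

omit hl

/-- The orthogonal complement of the range of the adjoint is the kernel of `ι`. -/
lemma dense_range_adjoint (hι : Function.Injective ι) :
    Dense (range (adjoint ι : H → V)) := by
  have h : (LinearMap.range (adjoint ι).toLinearMap).topologicalClosure = ⊤ := by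
    rw [Submodule.topologicalClosure_eq_top_iff, eq_bot_iff]
    intro v hv
    have : ι v = 0 := by
      refine ext_inner_left ℝ fun h => ?_
      rw [← ContinuousLinearMap.adjoint_inner_left, inner_zero_right]
      exact (Submodule.mem_orthogonal _ v).1 hv _ ⟨h, rfl⟩
    exact hι (by simpa using this)
  have := Submodule.dense_iff_topologicalClosure_eq_top.2 h
  exact this

/-- On `V` the resolvents converge strongly to the identity. -/
lemma tendsto_smoother (hι : Function.Injective ι) (v : V) :
    Tendsto (fun l : ℝ => smoother ι l (ι v)) (𝓝[>] 0) (𝓝 v) := by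
  rw [Metric.tendsto_nhds]
  intro ε hε
  obtain ⟨_, ⟨h, rfl⟩, hh⟩ := (dense_range_adjoint ι hι).exists_dist_lt v (half_pos (half_pos hε))
  have h1 : ∀ᶠ l : ℝ in 𝓝[>] 0, l * ‖h‖ ^ 2 < (ε / 2) ^ 2 := by
    have : Tendsto (fun l : ℝ => l * ‖h‖ ^ 2) (𝓝[>] 0) (𝓝 (0 * ‖h‖ ^ 2)) :=
      (tendsto_id.mono_left nhdsWithin_le_nhds).mul_const _
    rw [zero_mul] at this
    exact this.eventually (gt_mem_nhds (by positivity))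
  filter_upwards [h1, self_mem_nhdsWithin] with l hl1 hl
  have hl : 0 < l := hl
  -- On the dense range of `adjoint ι` the error is `l J h`, of norm at most `√l ‖h‖`. Contractivity
  -- on `V` extends the convergence to all of `V`.
  have h2 : ‖smoother ι l (ι (adjoint ι h)) - adjoint ι h‖ < ε / 2 := by
    rw [smoother_comp_eq ι hl, yosida_adjoint ι hl, sub_sub_cancel_left, norm_neg]
    refine lt_of_pow_lt_pow_left₀ 2 (by positivity) ((sq_norm_smoother_le ι hl h).trans_lt hl1)
  rw [dist_eq_norm] at hh ⊢
  have e : smoother ι l (ι v) - v = smoother ι l (ι (v - adjoint ι h)) +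
      (smoother ι l (ι (adjoint ι h)) - adjoint ι h) - (v - adjoint ι h) := by
    simp only [map_sub]; abel
  rw [e]
  have h3 := norm_smoother_comp_le ι hl (v - adjoint ι h)
  have h4 := norm_sub_le (smoother ι l (ι (v - adjoint ι h)) +
      (smoother ι l (ι (adjoint ι h)) - adjoint ι h)) (v - adjoint ι h)
  have h5 := norm_add_le (smoother ι l (ι (v - adjoint ι h)))
      (smoother ι l (ι (adjoint ι h)) - adjoint ι h)
  linarith

/-- A limit in `H` of a sequence that is bounded in `V` lies in `V`, with the same bound. -/
lemma exists_lift_of_tendsto (hι : Function.Injective ι) {x : ℕ → V} {y : H} {M : ℝ}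
    (hx : ∀ n, ‖x n‖ ≤ M) (hy : Tendsto (fun n => ι (x n)) atTop (𝓝 y)) :
    ∃ v : V, ι v = y ∧ ‖v‖ ≤ M := by
  have hM : 0 ≤ M := (norm_nonneg _).trans (hx 0)
  have hdense : DenseRange (adjoint ι : H → V) := dense_range_adjoint ι hι
  -- Weak convergence in `V`: against `ι† h` the pairing is `⟪ι (x n), h⟫`, which converges, and the
  -- uniform bound handles the remainder. The tolerance is chosen so that `2 M · ε / (4 (M + 1)) < ε
  -- / 2`. The limit functional is then represented by Riesz.
  have hc : ∀ v : V, CauchySeq (fun n => ⟪x n, v⟫) := by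
    intro v
    rw [Metric.cauchySeq_iff']
    intro ε hε
    obtain ⟨h, hh⟩ := hdense.exists_dist_lt v (show 0 < ε / (4 * (M + 1)) by positivity)
    have h1 : CauchySeq (fun n => ⟪ι (x n), h⟫) := (hy.inner tendsto_const_nhds).cauchySeq
    rw [Metric.cauchySeq_iff'] at h1
    obtain ⟨N, hN⟩ := h1 (ε / 2) (half_pos hε)
    refine ⟨N, fun n hn => ?_⟩
    have h2 := hN n hn
    rw [Real.dist_eq, ← inner_sub_left] at h2 ⊢
    rw [← map_sub, ← ContinuousLinearMap.adjoint_inner_right] at h2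
    have e : ⟪x n - x N, v⟫ = ⟪x n - x N, adjoint ι h⟫ + ⟪x n - x N, v - adjoint ι h⟫ := by
      rw [← inner_add_right]; simp
    rw [e]
    have h3 : |⟪x n - x N, v - adjoint ι h⟫| ≤ (2 * M) * (ε / (4 * (M + 1))) := by
      refine (abs_real_inner_le_norm _ _).trans (mul_le_mul ?_ ?_ (norm_nonneg _) (by positivity))
      · have := norm_sub_le (x n) (x N)
        linarith [hx n, hx N]
      · rw [dist_eq_norm] at hh; exact hh.le
    have h4 : (2 * M) * (ε / (4 * (M + 1))) < ε / 2 := by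
      rw [mul_div_assoc', div_lt_div_iff₀ (by positivity) (by positivity)]
      nlinarith
    refine (abs_add_le _ _).trans_lt ?_
    linarith
  have hlim : ∀ v : V, ∃ c : ℝ, Tendsto (fun n => ⟪x n, v⟫) atTop (𝓝 c) := fun v =>
    cauchySeq_tendsto_of_complete (hc v)
  choose φ hφ using hlim
  have hφb : ∀ v, |φ v| ≤ M * ‖v‖ := fun v =>
    le_of_tendsto' (hφ v).abs fun n => (abs_real_inner_le_norm _ _).trans
      (mul_le_mul_of_nonneg_right (hx n) (norm_nonneg _))
  let Φ : V →ₗ[ℝ] ℝ :=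
    { toFun := φ
      map_add' := fun v w => tendsto_nhds_unique (hφ (v + w))
        (by simpa only [inner_add_right] using (hφ v).add (hφ w))
      map_smul' := fun c v => tendsto_nhds_unique (hφ (c • v))
        (by simpa only [inner_smul_right, RingHom.id_apply, smul_eq_mul] using (hφ v).const_mul c) }
  let Ψ : V →L[ℝ] ℝ := Φ.mkContinuous M hφb
  refine ⟨(InnerProductSpace.toDual ℝ V).symm Ψ, ?_, ?_⟩
  · refine ext_inner_right ℝ fun h => ?_
    rw [← ContinuousLinearMap.adjoint_inner_right, InnerProductSpace.toDual_symm_apply]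
    refine tendsto_nhds_unique (hφ (adjoint ι h)) ?_
    simpa only [ContinuousLinearMap.adjoint_inner_right] using hy.inner tendsto_const_nhds
  · rw [LinearIsometryEquiv.norm_map]
    exact Φ.mkContinuous_norm_le hM hφb

end Resolvent

end

/-! ### The abstract Navier-Stokes setting and its Yosida regularization -/

section

variable {H V : Type*} [NormedAddCommGroup H] [InnerProductSpace ℝ H] [CompleteSpace H]
  [NormedAddCommGroup V] [InnerProductSpace ℝ V] [CompleteSpace V]

/-- The functional setting of the two-dimensional Navier-Stokes equations: a Hilbert space `V`
embedded in `H` and a skew-symmetric trilinear form with the Ladyzhenskaya-type estimates. -/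
structure IsNSETriple (ι : V →L[ℝ] H) (b : V →L[ℝ] V →L[ℝ] V →L[ℝ] ℝ) (C : ℝ) : Prop where
  injective : Function.Injective ι
  denseRange : DenseRange ι
  norm_le : ∀ v, ‖ι v‖ ≤ ‖v‖
  const_nonneg : 0 ≤ C
  skew : ∀ u v w, b u v w = -b u w v
  bound : ∀ u v w, b u v w ^ 2 ≤ C * (‖ι u‖ * ‖u‖) * ‖v‖ ^ 2 * (‖ι w‖ * ‖w‖)
  bound_smooth : ∀ u g w,
    b u (adjoint ι g) w ^ 2 ≤ C * (‖ι u‖ * ‖u‖) * (‖adjoint ι g‖ * ‖g‖) * ‖ι w‖ ^ 2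

/-- The regularized nonlinearity: `⟪B_l(u), h⟫ = b(J u, J u, J h)` with `J = (1 + l Λ)⁻¹`. -/
def regB (ι : V →L[ℝ] H) (b : V →L[ℝ] V →L[ℝ] V →L[ℝ] ℝ) (l : ℝ) (u : H) : H :=
  (InnerProductSpace.toDual ℝ H).symm
    ((b (smoother ι l u) (smoother ι l u)) ∘L smoother ι l)

/-- Solutions of the regularized equation
`u' = -ν Λ_l u - a u - β B_l(u) + g` on `[τ, T]`. -/
structure IsRegSol (ι : V →L[ℝ] H) (b : V →L[ℝ] V →L[ℝ] V →L[ℝ] ℝ) (ν : ℝ) (a β : ℝ → ℝ)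
    (l : ℝ) (g : ℝ → H) (τ T : ℝ) (u : ℝ → H) : Prop where
  continuousOn : ContinuousOn u (Icc τ T)
  hasDerivAt : ∀ t ∈ Ioo τ T, HasDerivAt u
    (-(ν • yosida ι l (u t)) - a t • u t - β t • regB ι b l (u t) + g t) t

section Reg

variable {ι : V →L[ℝ] H} {b : V →L[ℝ] V →L[ℝ] V →L[ℝ] ℝ} {C : ℝ}

lemma inner_regB (l : ℝ) (u h : H) : ⟪regB ι b l u, h⟫
    = b (smoother ι l u) (smoother ι l u) (smoother ι l h) := by
  simp [regB]

lemma IsNSETriple.self_eq_zero (D : IsNSETriple ι b C) (u v : V) : b u v v = 0 := by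
  have := D.skew u v v
  linarith

lemma IsNSETriple.norm_adjoint_le (D : IsNSETriple ι b C) (g : H) : ‖adjoint ι g‖ ≤ ‖g‖ := by
  by_contra! h
  have h1 : ‖adjoint ι g‖ ^ 2 ≤ ‖g‖ * ‖adjoint ι g‖ := by
    rw [← real_inner_self_eq_norm_sq, ContinuousLinearMap.adjoint_inner_left]
    exact (real_inner_le_norm _ _).trans
      (mul_le_mul_of_nonneg_left (D.norm_le _) (norm_nonneg _))
  nlinarith [norm_nonneg g]

lemma IsNSETriple.abs_le (D : IsNSETriple ι b C) (u v w : V) :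
    |b u v w| ≤ √C * ‖u‖ * ‖v‖ * ‖w‖ := by
  have hC := D.const_nonneg
  refine abs_le_of_sq_le_sq ?_ (by positivity)
  refine (D.bound u v w).trans ?_
  rw [mul_pow, mul_pow, mul_pow, Real.sq_sqrt D.const_nonneg, sq ‖u‖, sq ‖w‖]
  have h1 := D.norm_le u
  have h2 := D.norm_le w
  gcongr

lemma IsNSETriple.norm_apply_le (D : IsNSETriple ι b C) (u v : V) :
    ‖b u v‖ ≤ √C * ‖u‖ * ‖v‖ :=
  ContinuousLinearMap.opNorm_le_bound _ (by positivity) fun w => D.abs_le u v w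

/-- For fixed `l` the resolvent maps `H` boundedly into `V`, so the regularized nonlinearity is a
bounded quadratic map. The constant depends on `l` and is used only to solve the ODE. -/
lemma IsNSETriple.norm_regB_sub_le (D : IsNSETriple ι b C) (l : ℝ) (u v : H) :
    ‖regB ι b l u - regB ι b l v‖
      ≤ √C * ‖smoother ι l‖ ^ 3 * (‖u‖ + ‖v‖) * ‖u - v‖ := by
  set J := smoother ι l
  have e : regB ι b l u - regB ι b l v = (InnerProductSpace.toDual ℝ H).symm
      ((b (J (u - v)) (J u)) ∘L J + (b (J v) (J (u - v))) ∘L J) := by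
    rw [regB, regB, ← map_sub]
    congr 1
    ext h
    simp only [map_sub, ContinuousLinearMap.comp_apply, sub_apply,
      add_apply, J]
    ring
  rw [e, LinearIsometryEquiv.norm_map]
  have hb : ∀ x y : H, ‖(b (J x) (J y)) ∘L J‖ ≤ √C * ‖J‖ ^ 3 * ‖x‖ * ‖y‖ := by
    intro x y
    calc ‖(b (J x) (J y)) ∘L J‖ ≤ ‖b (J x) (J y)‖ * ‖J‖ := ContinuousLinearMap.opNorm_comp_le _ _
      _ ≤ (√C * (‖J‖ * ‖x‖) * (‖J‖ * ‖y‖)) * ‖J‖ := by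
          refine mul_le_mul_of_nonneg_right ?_ (norm_nonneg _)
          refine (D.norm_apply_le (J x) (J y)).trans ?_
          gcongr <;> exact ContinuousLinearMap.le_opNorm _ _
      _ = _ := by ring
  refine (norm_add_le _ _).trans ((add_le_add (hb _ _) (hb _ _)).trans (le_of_eq ?_))
  ring

/-- In the pairing with `x` the nonlinear term vanishes by skew-symmetry and the Yosida term has a
sign, so only the damping and the force contribute to growth and no blow-up occurs. -/
lemma IsNSETriple.exists_regSol (D : IsNSETriple ι b C) {ν : ℝ} (hν : 0 ≤ ν) {a β : ℝ → ℝ}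
    (ha : Continuous a) (hβ : Continuous β) {g : ℝ → H} (hg : Continuous g) {l : ℝ} (hl : 0 < l)
    {τ T : ℝ} (hτT : τ ≤ T) (x₀ : H) :
    ∃ u, u τ = x₀ ∧ IsRegSol ι b ν a β l g τ T u := by
  obtain ⟨A, hA⟩ := isCompact_Icc.exists_bound_of_continuousOn (ha.continuousOn (s := Icc τ T))
  obtain ⟨B, hB⟩ := isCompact_Icc.exists_bound_of_continuousOn (hβ.continuousOn (s := Icc τ T))
  obtain ⟨G, hG⟩ := isCompact_Icc.exists_bound_of_continuousOn (hg.continuousOn (s := Icc τ T))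
  refine Exists.imp (fun u hu => ⟨hu.1, hu.2.1, hu.2.2⟩) (exists_global_solution hτT
    (fun t x => -(ν • yosida ι l x) - a t • x - β t • regB ι b l x + g t)
    (A := |A|) (G := |G|) (fun x => by fun_prop) ?_ (abs_nonneg _) (abs_nonneg _) ?_ x₀)
  · intro ρ hρ
    refine ⟨ν * ‖yosida ι l‖ + |A| + |B| * (√C * ‖smoother ι l‖ ^ 3 * (ρ + ρ)),
      fun t ht x y hx hy => ?_⟩
    have e : -(ν • yosida ι l x) - a t • x - β t • regB ι b l x + g t -
        (-(ν • yosida ι l y) - a t • y - β t • regB ι b l y + g t)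
        = -(ν • yosida ι l (x - y)) - a t • (x - y) - β t • (regB ι b l x - regB ι b l y) := by
      rw [map_sub]; module
    rw [e]
    have n1 : ‖ν • yosida ι l (x - y)‖ ≤ ν * ‖yosida ι l‖ * ‖x - y‖ := by
      rw [norm_smul, Real.norm_of_nonneg hν, mul_assoc]
      exact mul_le_mul_of_nonneg_left (ContinuousLinearMap.le_opNorm _ _) hν
    have n2 : ‖a t • (x - y)‖ ≤ |A| * ‖x - y‖ := by
      rw [norm_smul]
      exact mul_le_mul_of_nonneg_right ((hA t ht).trans (le_abs_self _)) (norm_nonneg _)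
    have n3 : ‖β t • (regB ι b l x - regB ι b l y)‖
        ≤ |B| * (√C * ‖smoother ι l‖ ^ 3 * (ρ + ρ)) * ‖x - y‖ := by
      rw [norm_smul, mul_assoc]
      refine mul_le_mul ((hB t ht).trans (le_abs_self _)) ?_ (norm_nonneg _) (abs_nonneg _)
      refine (D.norm_regB_sub_le l x y).trans ?_
      gcongr
    have n4 := norm_sub_le (-(ν • yosida ι l (x - y)) - a t • (x - y))
      (β t • (regB ι b l x - regB ι b l y))
    have n5 := norm_sub_le (-(ν • yosida ι l (x - y))) (a t • (x - y))
    rw [norm_neg] at n5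
    linarith
  · intro t ht x
    rw [inner_add_left, inner_sub_left, inner_sub_left, inner_neg_left, real_inner_smul_left,
      real_inner_smul_left, real_inner_smul_left, inner_regB, D.self_eq_zero, mul_zero, sub_zero,
      real_inner_self_eq_norm_sq]
    have n1 : 0 ≤ ν * ⟪yosida ι l x, x⟫ :=
      mul_nonneg hν ((sq_nonneg _).trans (sq_norm_smoother_le_inner ι hl x))
    have n2 : -(a t * ‖x‖ ^ 2) ≤ |A| * ‖x‖ ^ 2 := by
      rw [← neg_mul]
      refine mul_le_mul_of_nonneg_right ?_ (sq_nonneg _)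
      exact (neg_le_abs _).trans ((hA t ht).trans (le_abs_self _))
    have n3 : ⟪g t, x⟫ ≤ |G| * ‖x‖ := (real_inner_le_norm _ _).trans
      (mul_le_mul_of_nonneg_right ((hG t ht).trans (le_abs_self _)) (norm_nonneg _))
    linarith

/-! ### Estimates for the regularized equation -/

/-- Young's inequality for the nonlinear terms of quadratic type. -/
lemma young_quadratic {x c m p ε : ℝ} (hε : 0 < ε) (hm : 0 ≤ m) (hx : x ^ 2 ≤ m * p ^ 2) :
    c * x ≤ ε * p ^ 2 + c ^ 2 * m / (4 * ε) := by
  have h1 : |x| ≤ √m * |p| := by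
    refine abs_le_of_sq_le_sq' ?_ (by positivity) |>.2
    rwa [mul_pow, Real.sq_sqrt hm, sq_abs, sq_abs]
  have h2 : c * x ≤ |c| * (√m * |p|) :=
    (le_abs_self _).trans (by rw [abs_mul]; exact mul_le_mul_of_nonneg_left h1 (abs_nonneg _))
  have h3 : ε * p ^ 2 + c ^ 2 * m / (4 * ε) - |c| * (√m * |p|)
      = (2 * ε * |p| - |c| * √m) ^ 2 / (4 * ε) := by
    field_simp
    ring_nf
    rw [Real.sq_sqrt hm, sq_abs, sq_abs]
  have h4 : 0 ≤ (2 * ε * |p| - |c| * √m) ^ 2 / (4 * ε) := by positivity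
  linarith

/-- Young's inequality for the nonlinear terms of cubic type. -/
lemma young_cubic {x c m p ε : ℝ} (hε : 0 < ε) (hm : 0 ≤ m) (hp : 0 ≤ p)
    (hx : x ^ 2 ≤ m * p ^ 3) :
    c * x ≤ ε * p ^ 2 + c ^ 4 * m ^ 2 / (8 * ε ^ 3) := by
  -- The cubic bound is read as a quadratic one with `m * p` in place of `m`. The resulting term,
  -- linear in `p`, is absorbed by the other half of `ε p²`.
  have h1 := young_quadratic (c := c) (half_pos hε) (mul_nonneg hm hp)
    (hx.trans (le_of_eq (by ring : m * p ^ 3 = m * p * p ^ 2)))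
  have h2 : ε / 2 * p ^ 2 + c ^ 4 * m ^ 2 / (8 * ε ^ 3) - c ^ 2 * (m * p) / (4 * (ε / 2))
      = (2 * ε ^ 2 * p - c ^ 2 * m) ^ 2 / (8 * ε ^ 3) := by
    field_simp
    ring
  have h3 : 0 ≤ (2 * ε ^ 2 * p - c ^ 2 * m) ^ 2 / (8 * ε ^ 3) := by positivity
  linarith

end Reg

end

section

variable {H V : Type*} [NormedAddCommGroup H] [InnerProductSpace ℝ H] [CompleteSpace H]
  [NormedAddCommGroup V] [InnerProductSpace ℝ V] [CompleteSpace V]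

section Estimates

variable {ι : V →L[ℝ] H} {b : V →L[ℝ] V →L[ℝ] V →L[ℝ] ℝ} {C : ℝ}
  {ν A B : ℝ} {a β : ℝ → ℝ} {τ T l : ℝ} {g h u v : ℝ → H}

/-- The comparison solution: a priori bounds for a single solution are the difference estimates
taken against zero. -/
lemma isRegSol_zero : IsRegSol ι b ν a β l 0 τ T 0 := by
  refine ⟨continuousOn_const, fun t _ => ?_⟩
  have : regB ι b l (0 : H) = 0 := by simp [regB]
  simp [this, hasDerivAt_zero]

/-- Continuous dependence in `H` for the regularized equation. -/
lemma IsNSETriple.regSol_sub_le (D : IsNSETriple ι b C) (hν : 0 < ν) (hτT : τ ≤ T)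
    (hA : ∀ t ∈ Icc τ T, |a t| ≤ A) (hB : ∀ t ∈ Icc τ T, |β t| ≤ B) (hl : 0 < l)
    (hg : Continuous g) (hh : Continuous h) (hu : IsRegSol ι b ν a β l g τ T u)
    (hv : IsRegSol ι b ν a β l h τ T v) {t : ℝ} (ht : t ∈ Icc τ T) :
    ‖u t - v t‖ ^ 2 + ∫ s in τ..t, ν * ‖smoother ι l (u s - v s)‖ ^ 2
      ≤ Real.exp (∫ s in τ..T, (2 * A + 1 + B ^ 2 * C / ν * ‖smoother ι l (v s)‖ ^ 2))
        * (‖u τ - v τ‖ ^ 2 + ∫ s in τ..T, ‖g s - h s‖ ^ 2) := by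
  have hA0 : 0 ≤ A := (abs_nonneg _).trans (hA τ (left_mem_Icc.2 hτT))
  have hC := D.const_nonneg
  have huc := hu.continuousOn
  have hvc := hv.continuousOn
  refine gronwall_dissipative hτT (x := fun t => ‖u t - v t‖ ^ 2)
    (y := fun s => ν * ‖smoother ι l (u s - v s)‖ ^ 2)
    (k := fun s => 2 * A + 1 + B ^ 2 * C / ν * ‖smoother ι l (v s)‖ ^ 2)
    (h := fun s => ‖g s - h s‖ ^ 2) ((huc.sub hvc).norm.pow 2)
    (fun t ht => ((hu.hasDerivAt t ht).sub (hv.hasDerivAt t ht)).norm_sq)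
    (by fun_prop) (by fun_prop) (by fun_prop) (by positivity) (fun _ _ => by positivity)
    (fun _ _ => by positivity) (fun _ _ => by positivity) ?_ ht
  intro t ht
  have ht' := Ioo_subset_Icc_self ht
  set d := u t - v t with hd
  set J := smoother ι l
  have e : 2 * ⟪d, -(ν • yosida ι l (u t)) - a t • u t - β t • regB ι b l (u t) + g t -
      (-(ν • yosida ι l (v t)) - a t • v t - β t • regB ι b l (v t) + h t)⟫
      = -2 * ν * ⟪yosida ι l d, d⟫ - 2 * a t * ‖d‖ ^ 2
        + (-2 * β t) * b (J d) (J (v t)) (J d) + 2 * ⟪g t - h t, d⟫ := by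
    have e1 : -(ν • yosida ι l (u t)) - a t • u t - β t • regB ι b l (u t) + g t -
      (-(ν • yosida ι l (v t)) - a t • v t - β t • regB ι b l (v t) + h t)
      = -(ν • yosida ι l d) - a t • d - β t • (regB ι b l (u t) - regB ι b l (v t))
        + (g t - h t) := by
      rw [hd, map_sub]; module
    -- After substituting `u = v + d`, skew-symmetry removes every term whose last two arguments are
    -- both `J d`.
    have e2 : ⟪regB ι b l (u t) - regB ι b l (v t), d⟫ = b (J d) (J (v t)) (J d) := by
      rw [inner_sub_left, inner_regB, inner_regB]
      have e3 : u t = v t + d := by rw [hd]; abel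
      have e4 := D.self_eq_zero (J (v t)) (J d)
      have e5 := D.self_eq_zero (J d) (J d)
      rw [e3]
      simp only [map_add, add_apply, J] at e4 e5 ⊢
      linarith
    rw [e1, real_inner_comm, inner_add_left, inner_sub_left, inner_sub_left, inner_neg_left,
      real_inner_smul_left, real_inner_smul_left, real_inner_smul_left, e2,
      real_inner_self_eq_norm_sq]
    ring
  refine (add_le_add_left (le_of_eq e) _).trans ?_
  have h1 := sq_norm_smoother_le_inner ι hl d
  have h2 : -2 * a t * ‖d‖ ^ 2 ≤ 2 * A * ‖d‖ ^ 2 := by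
    refine mul_le_mul_of_nonneg_right ?_ (sq_nonneg _)
    linarith [neg_le_abs (a t), hA t ht']
  have h3 : 2 * ⟪g t - h t, d⟫ ≤ ‖g t - h t‖ ^ 2 + ‖d‖ ^ 2 := by
    have := real_inner_le_norm (g t - h t) d
    nlinarith [sq_nonneg (‖g t - h t‖ - ‖d‖)]
  -- Half of the dissipation `2 ν ‖J d‖²` pays for the nonlinear term; the other half stays on the
  -- left as the integrated `V` norm.
  have h4 : (-2 * β t) * b (J d) (J (v t)) (J d) ≤ ν * ‖J d‖ ^ 2
      + (-2 * β t) ^ 2 * (C * ‖d‖ ^ 2 * ‖J (v t)‖ ^ 2) / (4 * ν) := by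
    refine young_quadratic hν (by positivity) ?_
    refine (D.bound _ _ _).trans ?_
    have := norm_smoother_le ι hl d
    calc C * (‖ι (J d)‖ * ‖J d‖) * ‖J (v t)‖ ^ 2 * (‖ι (J d)‖ * ‖J d‖)
        = C * ‖ι (J d)‖ ^ 2 * ‖J (v t)‖ ^ 2 * ‖J d‖ ^ 2 := by ring
      _ ≤ C * ‖d‖ ^ 2 * ‖J (v t)‖ ^ 2 * ‖J d‖ ^ 2 := by gcongr
  have h5 : (-2 * β t) ^ 2 * (C * ‖d‖ ^ 2 * ‖J (v t)‖ ^ 2) / (4 * ν)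
      ≤ B ^ 2 * C / ν * ‖J (v t)‖ ^ 2 * ‖d‖ ^ 2 := by
    have hβ : β t ^ 2 ≤ B ^ 2 := sq_le_sq' (by linarith [neg_le_abs (β t), hB t ht'])
      ((le_abs_self _).trans (hB t ht'))
    calc (-2 * β t) ^ 2 * (C * ‖d‖ ^ 2 * ‖J (v t)‖ ^ 2) / (4 * ν)
        = β t ^ 2 * C / ν * ‖J (v t)‖ ^ 2 * ‖d‖ ^ 2 := by field_simp; ring
      _ ≤ _ := by gcongr
  have h6 : ν * ‖J d‖ ^ 2 ≤ ν * ⟪yosida ι l d, d⟫ := mul_le_mul_of_nonneg_left h1 hν.le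
  linarith

/-- Continuous dependence in `V` for the regularized equation. -/
lemma IsNSETriple.regSol_sub_le_V (D : IsNSETriple ι b C) (hν : 0 < ν) (hτT : τ ≤ T)
    (hA : ∀ t ∈ Icc τ T, |a t| ≤ A) (hB : ∀ t ∈ Icc τ T, |β t| ≤ B) (hl : 0 < l)
    (hg : Continuous g) (hh : Continuous h) (hu : IsRegSol ι b ν a β l g τ T u)
    (hv : IsRegSol ι b ν a β l h τ T v) {t : ℝ} (ht : t ∈ Icc τ T) :
    ⟪yosida ι l (u t - v t), u t - v t⟫ + ∫ s in τ..t, ν * ‖yosida ι l (u s - v s)‖ ^ 2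
      ≤ Real.exp (∫ s in τ..T, (2 * A + 4 * B ^ 2 * C / ν * ‖yosida ι l (v s)‖ ^ 2
          + 128 * B ^ 4 * C ^ 2 / ν ^ 3 * (‖u s‖ ^ 2 * ‖smoother ι l (u s)‖ ^ 2)))
        * (⟪yosida ι l (u τ - v τ), u τ - v τ⟫ + ∫ s in τ..T, 2 / ν * ‖g s - h s‖ ^ 2) := by
  have hA0 : 0 ≤ A := (abs_nonneg _).trans (hA τ (left_mem_Icc.2 hτT))
  have hB0 : 0 ≤ B := (abs_nonneg _).trans (hB τ (left_mem_Icc.2 hτT))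
  have hC := D.const_nonneg
  have huc := hu.continuousOn
  have hvc := hv.continuousOn
  refine gronwall_dissipative hτT (x := fun t => ⟪yosida ι l (u t - v t), u t - v t⟫)
    (y := fun s => ν * ‖yosida ι l (u s - v s)‖ ^ 2)
    (k := fun s => 2 * A + 4 * B ^ 2 * C / ν * ‖yosida ι l (v s)‖ ^ 2
          + 128 * B ^ 4 * C ^ 2 / ν ^ 3 * (‖u s‖ ^ 2 * ‖smoother ι l (u s)‖ ^ 2))
    (h := fun s => 2 / ν * ‖g s - h s‖ ^ 2) (by fun_prop)
    (fun t ht => ((yosida ι l).hasFDerivAt.comp_hasDerivAt t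
      ((hu.hasDerivAt t ht).sub (hv.hasDerivAt t ht))).inner ℝ
      ((hu.hasDerivAt t ht).sub (hv.hasDerivAt t ht)))
    (by fun_prop) (by fun_prop) (by fun_prop)
    ((sq_nonneg _).trans (sq_norm_smoother_le_inner ι hl _)) (fun _ _ => by positivity)
    (fun _ _ => by positivity) (fun _ _ => by positivity) ?_ ht
  intro t ht
  have ht' := Ioo_subset_Icc_self ht
  set d := u t - v t with hd
  set J := smoother ι l
  set P := yosida ι l
  have e1 : -(ν • P (u t)) - a t • u t - β t • regB ι b l (u t) + g t -
      (-(ν • P (v t)) - a t • v t - β t • regB ι b l (v t) + h t)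
      = -(ν • P d) - a t • d - β t • (regB ι b l (u t) - regB ι b l (v t))
        + (g t - h t) := by
    rw [hd, map_sub]; module
  have e : ⟪P d, -(ν • P (u t)) - a t • u t - β t • regB ι b l (u t) + g t -
      (-(ν • P (v t)) - a t • v t - β t • regB ι b l (v t) + h t)⟫
      + ⟪P (-(ν • P (u t)) - a t • u t - β t • regB ι b l (u t) + g t -
      (-(ν • P (v t)) - a t • v t - β t • regB ι b l (v t) + h t)), d⟫
      = -2 * ν * ‖P d‖ ^ 2 - 2 * a t * ⟪P d, d⟫
        + (-2 * β t) * b (J d) (J (v t)) (J (P d))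
        + (-2 * β t) * b (J (u t)) (J d) (J (P d)) + 2 * ⟪g t - h t, P d⟫ := by
    -- Tested with `P d` instead of `d`, neither part of the nonlinear difference cancels. Both have
    -- a middle argument in the domain of `Λ`, since `J = ι† P`, so `bound_smooth` applies.
    have e2 : ⟪regB ι b l (u t) - regB ι b l (v t), P d⟫
        = b (J d) (J (v t)) (J (P d)) + b (J (u t)) (J d) (J (P d)) := by
      rw [inner_sub_left, inner_regB, inner_regB]
      have e3 : u t = v t + d := by rw [hd]; abel
      rw [e3]
      simp only [map_add, add_apply, J]
      ring
    rw [e1]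
    set X := -(ν • P d) - a t • d - β t • (regB ι b l (u t) - regB ι b l (v t))
        + (g t - h t) with hX
    have e3 : ⟪P X, d⟫ = ⟪X, P d⟫ := inner_yosida_symm ι hl _ _
    rw [e3, real_inner_comm X (P d), hX, inner_add_left, inner_sub_left,
      inner_sub_left, inner_neg_left,
      real_inner_smul_left, real_inner_smul_left, real_inner_smul_left, e2,
      real_inner_self_eq_norm_sq, real_inner_comm (P d) d]
    ring
  refine (add_le_add_left (le_of_eq e) _).trans ?_
  have hβ : β t ^ 2 ≤ B ^ 2 := sq_le_sq' (by linarith [neg_le_abs (β t), hB t ht'])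
      ((le_abs_self _).trans (hB t ht'))
  have hβ4 : β t ^ 4 ≤ B ^ 4 := by
    calc β t ^ 4 = (β t ^ 2) ^ 2 := by ring
      _ ≤ (B ^ 2) ^ 2 := by gcongr
      _ = _ := by ring
  set E := ⟪P d, d⟫ with hE
  have h1 : ‖J d‖ ^ 2 ≤ E := sq_norm_smoother_le_inner ι hl d
  have hE0 : 0 ≤ E := (sq_nonneg _).trans h1
  have hJP : ‖ι (J (P d))‖ ≤ ‖P d‖ := norm_smoother_le ι hl _
  have hJd : ‖ι (J d)‖ ≤ ‖J d‖ := D.norm_le _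
  have h2 : -2 * a t * E ≤ 2 * A * E := by
    refine mul_le_mul_of_nonneg_right ?_ hE0
    linarith [neg_le_abs (a t), hA t ht']
  -- Budget for the dissipation `2 ν ‖P d‖²`: `ν` remains on the left, `ν / 2` absorbs the force,
  -- and `ν / 4` goes to each nonlinear term.
  have h3 : 2 * ⟪g t - h t, P d⟫ ≤ 2 / ν * ‖g t - h t‖ ^ 2 + ν / 2 * ‖P d‖ ^ 2 := by
    have h31 := real_inner_le_norm (g t - h t) (P d)
    have h32 : 2 / ν * ‖g t - h t‖ ^ 2 + ν / 2 * ‖P d‖ ^ 2 - 2 * (‖g t - h t‖ * ‖P d‖)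
        = (2 * ‖g t - h t‖ - ν * ‖P d‖) ^ 2 / (2 * ν) := by field_simp; ring
    have h33 : 0 ≤ (2 * ‖g t - h t‖ - ν * ‖P d‖) ^ 2 / (2 * ν) := by positivity
    linarith
  have h4 : (-2 * β t) * b (J d) (J (v t)) (J (P d)) ≤ ν / 4 * ‖P d‖ ^ 2
      + (-2 * β t) ^ 2 * (C * E * ‖P (v t)‖ ^ 2) / (4 * (ν / 4)) := by
    refine young_quadratic (by positivity) (by positivity) ?_
    refine (D.bound_smooth _ (P (v t)) _).trans ?_
    have hJv : ‖adjoint ι (P (v t))‖ ≤ ‖P (v t)‖ := D.norm_adjoint_le _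
    calc C * (‖ι (J d)‖ * ‖J d‖) * (‖adjoint ι (P (v t))‖ * ‖P (v t)‖) * ‖ι (J (P d))‖ ^ 2
        ≤ C * (‖J d‖ * ‖J d‖) * (‖P (v t)‖ * ‖P (v t)‖) * ‖P d‖ ^ 2 := by gcongr
      _ = C * ‖J d‖ ^ 2 * ‖P (v t)‖ ^ 2 * ‖P d‖ ^ 2 := by ring
      _ ≤ C * E * ‖P (v t)‖ ^ 2 * ‖P d‖ ^ 2 := by gcongr
  have h5 : (-2 * β t) ^ 2 * (C * E * ‖P (v t)‖ ^ 2) / (4 * (ν / 4))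
      ≤ 4 * B ^ 2 * C / ν * ‖P (v t)‖ ^ 2 * E := by
    calc (-2 * β t) ^ 2 * (C * E * ‖P (v t)‖ ^ 2) / (4 * (ν / 4))
        = 4 * β t ^ 2 * C / ν * ‖P (v t)‖ ^ 2 * E := by field_simp; ring
      _ ≤ _ := by gcongr
  -- Here `P d` enters the squared bound three times, once through the middle argument `ι† (P d)`
  -- and twice through the test field. Hence the cubic inequality and the fourth powers.
  have h6 : (-2 * β t) * b (J (u t)) (J d) (J (P d)) ≤ ν / 4 * ‖P d‖ ^ 2
      + (-2 * β t) ^ 4 * (C * (‖u t‖ * ‖J (u t)‖) * ‖J d‖) ^ 2 / (8 * (ν / 4) ^ 3) := by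
    refine young_cubic (by positivity) (by positivity) (norm_nonneg _) ?_
    refine (D.bound_smooth _ (P d) _).trans ?_
    have hJu : ‖ι (J (u t))‖ ≤ ‖u t‖ := norm_smoother_le ι hl _
    calc C * (‖ι (J (u t))‖ * ‖J (u t)‖) * (‖J d‖ * ‖P d‖) * ‖ι (J (P d))‖ ^ 2
        ≤ C * (‖u t‖ * ‖J (u t)‖) * (‖J d‖ * ‖P d‖) * ‖P d‖ ^ 2 := by gcongr
      _ = C * (‖u t‖ * ‖J (u t)‖) * ‖J d‖ * ‖P d‖ ^ 3 := by ring
  have h7 : (-2 * β t) ^ 4 * (C * (‖u t‖ * ‖J (u t)‖) * ‖J d‖) ^ 2 / (8 * (ν / 4) ^ 3)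
      ≤ 128 * B ^ 4 * C ^ 2 / ν ^ 3 * (‖u t‖ ^ 2 * ‖J (u t)‖ ^ 2) * E := by
    calc (-2 * β t) ^ 4 * (C * (‖u t‖ * ‖J (u t)‖) * ‖J d‖) ^ 2 / (8 * (ν / 4) ^ 3)
        = 128 * β t ^ 4 * C ^ 2 / ν ^ 3 * (‖u t‖ ^ 2 * ‖J (u t)‖ ^ 2) * ‖J d‖ ^ 2 := by
          field_simp; ring
      _ ≤ _ := by gcongr
  linarith

end Estimates

end

/-! ### Bounds uniform in the regularization parameter, and the Cauchy property -/

section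

variable {H V : Type*} [NormedAddCommGroup H] [InnerProductSpace ℝ H] [CompleteSpace H]
  [NormedAddCommGroup V] [InnerProductSpace ℝ V] [CompleteSpace V]

section Uniform

variable {ι : V →L[ℝ] H} {b : V →L[ℝ] V →L[ℝ] V →L[ℝ] ℝ} {C : ℝ}
  {ν A B : ℝ} {a β : ℝ → ℝ} {τ T : ℝ}

/-- Energy bounds for the regularized equation, uniform in the regularization parameter and the
initial time. -/
lemma IsNSETriple.regSol_energy_bound (D : IsNSETriple ι b C) (hν : 0 < ν)
    (hA : ∀ t ∈ Icc τ T, |a t| ≤ A) (hB : ∀ t ∈ Icc τ T, |β t| ≤ B) (M : ℝ) :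
    ∃ M' : ℝ, 0 ≤ M' ∧ ∀ s ∈ Icc τ T, ∀ l > 0, ∀ g u : ℝ → H, Continuous g →
      IsRegSol ι b ν a β l g s T u → ‖u s‖ ^ 2 ≤ M → (∫ r in s..T, ‖g r‖ ^ 2) ≤ M →
      (∀ t ∈ Icc s T, ‖u t‖ ^ 2 ≤ M') ∧ (∫ r in s..T, ‖smoother ι l (u r)‖ ^ 2) ≤ M' := by
  set N : ℝ := Real.exp ((2 * |A| + 1) * |T - τ|) * (|M| + |M|) with hN
  have hN0 : 0 ≤ N := by positivity
  refine ⟨N + N / ν, by positivity, fun s hs l hl g u hg hu hus hgM => ?_⟩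
  have hsT := hs.2
  have hsub : Icc s T ⊆ Icc τ T := Icc_subset_Icc_left hs.1
  have key : ∀ t ∈ Icc s T,
      ‖u t‖ ^ 2 + ∫ r in s..t, ν * ‖smoother ι l (u r)‖ ^ 2 ≤ N := by
    intro t ht
    -- Against the zero solution the nonlinear part of the Gronwall exponent disappears. Bounding `T
    -- - s` by `T - τ` then makes the constant independent of the starting time `s`.
    have h1 := D.regSol_sub_le hν hsT (fun t ht => hA t (hsub ht)) (fun t ht => hB t (hsub ht))
      hl hg (continuous_const (y := (0 : H))) hu isRegSol_zero ht
    simp only [Pi.zero_apply, sub_zero, map_zero, norm_zero, ne_eq, OfNat.ofNat_ne_zero,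
      not_false_eq_true, zero_pow, mul_zero, add_zero, intervalIntegral.integral_const,
      smul_eq_mul] at h1
    refine h1.trans (mul_le_mul (Real.exp_le_exp.2 ?_) ?_ ?_ (Real.exp_pos _).le)
    · rw [mul_comm]
      refine mul_le_mul ?_ ?_ (sub_nonneg.2 hsT) (by positivity)
      · linarith [le_abs_self A]
      · exact (by linarith [hs.1] : T - s ≤ T - τ).trans (le_abs_self _)
    · linarith [le_abs_self M]
    · have : 0 ≤ ∫ r in s..T, ‖g r‖ ^ 2 :=
        intervalIntegral.integral_nonneg hsT fun _ _ => by positivity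
      positivity
  refine ⟨fun t ht => ?_, ?_⟩
  · have h1 := key t ht
    have h2 : 0 ≤ ∫ r in s..t, ν * ‖smoother ι l (u r)‖ ^ 2 :=
      intervalIntegral.integral_nonneg ht.1 fun _ _ => by positivity
    have h3 : 0 ≤ N / ν := by positivity
    linarith
  · have h1 := key T (right_mem_Icc.2 hsT)
    rw [intervalIntegral.integral_const_mul] at h1
    have h2 : (∫ r in s..T, ‖smoother ι l (u r)‖ ^ 2) ≤ N / ν := by
      rw [le_div_iff₀ hν]
      nlinarith [sq_nonneg ‖u T‖]
    linarith

/-- Bounds in `V` for the regularized equation. -/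
lemma IsNSETriple.regSol_enstrophy_bound (D : IsNSETriple ι b C) (hν : 0 < ν)
    (hA : ∀ t ∈ Icc τ T, |a t| ≤ A) (hB : ∀ t ∈ Icc τ T, |β t| ≤ B) (M : ℝ) :
    ∃ M' : ℝ, 0 ≤ M' ∧ ∀ s ∈ Icc τ T, ∀ l > 0, ∀ g u : ℝ → H, Continuous g →
      IsRegSol ι b ν a β l g s T u → ‖u s‖ ^ 2 ≤ M → (∫ r in s..T, ‖g r‖ ^ 2) ≤ M →
      ⟪yosida ι l (u s), u s⟫ ≤ M →
      (∀ t ∈ Icc s T, ‖u t‖ ^ 2 ≤ M') ∧ (∫ r in s..T, ‖smoother ι l (u r)‖ ^ 2) ≤ M' ∧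
      (∀ t ∈ Icc s T, ‖smoother ι l (u t)‖ ^ 2 ≤ M') ∧
      (∫ r in s..T, ‖yosida ι l (u r)‖ ^ 2) ≤ M' := by
  obtain ⟨M₁, hM₁, hbd⟩ := D.regSol_energy_bound hν hA hB M
  set N : ℝ := Real.exp (2 * |A| * |T - τ| + 128 * B ^ 4 * C ^ 2 / ν ^ 3 * (M₁ * M₁))
    * (|M| + 2 / ν * |M|) with hN
  have hN0 : 0 ≤ N := by positivity
  refine ⟨M₁ + (N + N / ν), by positivity, fun s hs l hl g u hg hu hus hgM hPu => ?_⟩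
  obtain ⟨hb1, hb2⟩ := hbd s hs l hl g u hg hu hus hgM
  have hsT := hs.2
  have hsub : Icc s T ⊆ Icc τ T := Icc_subset_Icc_left hs.1
  have huc := hu.continuousOn
  have key : ∀ t ∈ Icc s T,
      ⟪yosida ι l (u t), u t⟫ + ∫ r in s..t, ν * ‖yosida ι l (u r)‖ ^ 2 ≤ N := by
    intro t ht
    -- With the second solution zero, the exponent no longer contains the Yosida term that is being
    -- estimated. What remains, `∫ ‖u‖² ‖J u‖²`, is controlled by the energy bounds.
    have h1 := D.regSol_sub_le_V hν hsT (fun t ht => hA t (hsub ht)) (fun t ht => hB t (hsub ht))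
      hl hg (continuous_const (y := (0 : H))) hu isRegSol_zero ht
    simp only [Pi.zero_apply, sub_zero, map_zero, norm_zero, ne_eq, OfNat.ofNat_ne_zero,
      not_false_eq_true, zero_pow, mul_zero, add_zero] at h1
    refine h1.trans (mul_le_mul (Real.exp_le_exp.2 ?_) ?_ ?_ (Real.exp_pos _).le)
    · have hc : ContinuousOn (fun r => ‖smoother ι l (u r)‖ ^ 2) (Icc s T) := by fun_prop
      have hc2 : ContinuousOn (fun r => ‖u r‖ ^ 2 * ‖smoother ι l (u r)‖ ^ 2) (Icc s T) := by
        fun_prop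
      rw [intervalIntegral.integral_add (by simp)
        ((hc2.intervalIntegrable_of_Icc hsT).const_mul _), intervalIntegral.integral_const,
        intervalIntegral.integral_const_mul, smul_eq_mul]
      refine add_le_add ?_ (mul_le_mul_of_nonneg_left ?_ (by positivity))
      · rw [mul_comm]
        refine mul_le_mul ?_ ?_ (sub_nonneg.2 hsT) (by positivity)
        · linarith [le_abs_self A]
        · exact (by linarith [hs.1] : T - s ≤ T - τ).trans (le_abs_self _)
      · calc (∫ r in s..T, ‖u r‖ ^ 2 * ‖smoother ι l (u r)‖ ^ 2)
            ≤ ∫ r in s..T, M₁ * ‖smoother ι l (u r)‖ ^ 2 :=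
              intervalIntegral.integral_mono_on hsT (hc2.intervalIntegrable_of_Icc hsT)
                ((hc.intervalIntegrable_of_Icc hsT).const_mul _)
                fun r hr => mul_le_mul_of_nonneg_right (hb1 r hr) (sq_nonneg _)
          _ ≤ M₁ * M₁ := by
              rw [intervalIntegral.integral_const_mul]
              exact mul_le_mul_of_nonneg_left hb2 hM₁
    · rw [intervalIntegral.integral_const_mul]
      have : 2 / ν * (∫ r in s..T, ‖g r‖ ^ 2) ≤ 2 / ν * |M| :=
        mul_le_mul_of_nonneg_left (hgM.trans (le_abs_self M)) (by positivity)
      linarith [le_abs_self M]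
    · have h2 : 0 ≤ ∫ r in s..T, 2 / ν * ‖g r‖ ^ 2 :=
        intervalIntegral.integral_nonneg hsT fun _ _ => by positivity
      have h3 := (sq_nonneg _).trans (sq_norm_smoother_le_inner ι hl (u s))
      positivity
  have hNν : 0 ≤ N / ν := by positivity
  refine ⟨fun t ht => by linarith [hb1 t ht], by linarith, fun t ht => ?_, ?_⟩
  · have h1 := key t ht
    have h2 : 0 ≤ ∫ r in s..t, ν * ‖yosida ι l (u r)‖ ^ 2 :=
      intervalIntegral.integral_nonneg ht.1 fun _ _ => by positivity
    have h3 := sq_norm_smoother_le_inner ι hl (u t)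
    linarith
  · have h1 := key T (right_mem_Icc.2 hsT)
    rw [intervalIntegral.integral_const_mul] at h1
    have h3 := (sq_nonneg _).trans (sq_norm_smoother_le_inner ι hl (u T))
    have h2 : (∫ r in s..T, ‖yosida ι l (u r)‖ ^ 2) ≤ N / ν := by
      rw [le_div_iff₀ hν]
      nlinarith
    linarith

/-- Lipschitz dependence on the data in `H`, uniformly in the regularization parameter. -/
lemma IsNSETriple.regSol_lipschitz_H (D : IsNSETriple ι b C) (hν : 0 < ν)
    (hA : ∀ t ∈ Icc τ T, |a t| ≤ A) (hB : ∀ t ∈ Icc τ T, |β t| ≤ B) (M : ℝ) :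
    ∃ L : ℝ, 0 ≤ L ∧ ∀ s ∈ Icc τ T, ∀ l > 0, ∀ g h u v : ℝ → H, Continuous g → Continuous h →
      IsRegSol ι b ν a β l g s T u → IsRegSol ι b ν a β l h s T v →
      ‖v s‖ ^ 2 ≤ M → (∫ r in s..T, ‖h r‖ ^ 2) ≤ M → ∀ t ∈ Icc s T,
      ‖u t - v t‖ ^ 2 + ∫ r in s..t, ν * ‖smoother ι l (u r - v r)‖ ^ 2
        ≤ L * (‖u s - v s‖ ^ 2 + ∫ r in s..T, ‖g r - h r‖ ^ 2) := by
  obtain ⟨M₁, hM₁, hbd⟩ := D.regSol_energy_bound hν hA hB M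
  refine ⟨Real.exp ((2 * |A| + 1) * |T - τ| + B ^ 2 * C / ν * M₁), (Real.exp_pos _).le,
    fun s hs l hl g h u v hg hh hu hv hvs hhM t ht => ?_⟩
  obtain ⟨hb1, hb2⟩ := hbd s hs l hl h v hh hv hvs hhM
  have hsT := hs.2
  have hC := D.const_nonneg
  have hsub : Icc s T ⊆ Icc τ T := Icc_subset_Icc_left hs.1
  have hvc := hv.continuousOn
  have h1 := D.regSol_sub_le hν hsT (fun t ht => hA t (hsub ht)) (fun t ht => hB t (hsub ht))
      hl hg hh hu hv ht
  refine h1.trans (mul_le_mul_of_nonneg_right (Real.exp_le_exp.2 ?_) ?_)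
  · have hc : ContinuousOn (fun r => ‖smoother ι l (v r)‖ ^ 2) (Icc s T) := by fun_prop
    rw [intervalIntegral.integral_add (by simp)
      ((hc.intervalIntegrable_of_Icc hsT).const_mul _), intervalIntegral.integral_const,
      intervalIntegral.integral_const_mul, smul_eq_mul]
    refine add_le_add ?_ (mul_le_mul_of_nonneg_left hb2 (by positivity))
    rw [mul_comm]
    refine mul_le_mul ?_ ?_ (sub_nonneg.2 hsT) (by positivity)
    · linarith [le_abs_self A]
    · exact (by linarith [hs.1] : T - s ≤ T - τ).trans (le_abs_self _)
  · have : 0 ≤ ∫ r in s..T, ‖g r - h r‖ ^ 2 :=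
      intervalIntegral.integral_nonneg hsT fun _ _ => by positivity
    positivity

/-- Lipschitz dependence on the initial value in `V`, uniformly in the regularization
parameter. -/
lemma IsNSETriple.regSol_lipschitz_V (D : IsNSETriple ι b C) (hν : 0 < ν)
    (hA : ∀ t ∈ Icc τ T, |a t| ≤ A) (hB : ∀ t ∈ Icc τ T, |β t| ≤ B) (M : ℝ) :
    ∃ L : ℝ, 0 ≤ L ∧ ∀ s ∈ Icc τ T, ∀ l > 0, ∀ g u v : ℝ → H, Continuous g →
      IsRegSol ι b ν a β l g s T u → IsRegSol ι b ν a β l g s T v →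
      ‖u s‖ ^ 2 ≤ M → ⟪yosida ι l (u s), u s⟫ ≤ M →
      ‖v s‖ ^ 2 ≤ M → ⟪yosida ι l (v s), v s⟫ ≤ M → (∫ r in s..T, ‖g r‖ ^ 2) ≤ M →
      ∀ t ∈ Icc s T,
      ‖smoother ι l (u t - v t)‖ ^ 2 ≤ L * ⟪yosida ι l (u s - v s), u s - v s⟫ := by
  obtain ⟨M₁, hM₁, hbd⟩ := D.regSol_enstrophy_bound hν hA hB M
  refine ⟨Real.exp (2 * |A| * |T - τ| + 4 * B ^ 2 * C / ν * M₁
    + 128 * B ^ 4 * C ^ 2 / ν ^ 3 * (M₁ * M₁)), (Real.exp_pos _).le,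
    fun s hs l hl g u v hg hu hv hus hPu hvs hPv hgM t ht => ?_⟩
  -- The exponent needs only energy quantities of `u`, but the integrated Yosida norm of `v`; the
  -- latter comes from the `V` bound.
  obtain ⟨hu1, hu2, -, -⟩ := hbd s hs l hl g u hg hu hus hgM hPu
  obtain ⟨-, -, -, hv4⟩ := hbd s hs l hl g v hg hv hvs hgM hPv
  have hsT := hs.2
  have hC := D.const_nonneg
  have hsub : Icc s T ⊆ Icc τ T := Icc_subset_Icc_left hs.1
  have hvc := hv.continuousOn
  have huc := hu.continuousOn
  have h1 := D.regSol_sub_le_V hν hsT (fun t ht => hA t (hsub ht)) (fun t ht => hB t (hsub ht))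
      hl hg hg hu hv ht
  simp only [sub_self, norm_zero, ne_eq, OfNat.ofNat_ne_zero, not_false_eq_true, zero_pow,
    mul_zero, intervalIntegral.integral_zero, add_zero] at h1
  have h2 : 0 ≤ ∫ r in s..t, ν * ‖yosida ι l (u r - v r)‖ ^ 2 :=
      intervalIntegral.integral_nonneg ht.1 fun _ _ => by positivity
  have h3 := sq_norm_smoother_le_inner ι hl (u t - v t)
  refine (h3.trans (le_add_of_nonneg_right h2)).trans (h1.trans ?_)
  refine mul_le_mul_of_nonneg_right (Real.exp_le_exp.2 ?_)
    ((sq_nonneg _).trans (sq_norm_smoother_le_inner ι hl _))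
  have hc : ContinuousOn (fun r => ‖smoother ι l (u r)‖ ^ 2) (Icc s T) := by fun_prop
  have hc2 : ContinuousOn (fun r => ‖u r‖ ^ 2 * ‖smoother ι l (u r)‖ ^ 2) (Icc s T) := by
    fun_prop
  have hc3 : ContinuousOn (fun r => ‖yosida ι l (v r)‖ ^ 2) (Icc s T) := by fun_prop
  have i3 := (hc3.intervalIntegrable_of_Icc (μ := volume) hsT).const_mul (4 * B ^ 2 * C / ν)
  rw [intervalIntegral.integral_add (IntervalIntegrable.add (by simp) i3)
    ((hc2.intervalIntegrable_of_Icc hsT).const_mul _),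
    intervalIntegral.integral_add (by simp) i3, intervalIntegral.integral_const,
    intervalIntegral.integral_const_mul, intervalIntegral.integral_const_mul, smul_eq_mul]
  refine add_le_add (add_le_add ?_ (mul_le_mul_of_nonneg_left hv4 (by positivity)))
    (mul_le_mul_of_nonneg_left ?_ (by positivity))
  · rw [mul_comm]
    refine mul_le_mul ?_ ?_ (sub_nonneg.2 hsT) (by positivity)
    · linarith [le_abs_self A]
    · exact (by linarith [hs.1] : T - s ≤ T - τ).trans (le_abs_self _)
  · calc (∫ r in s..T, ‖u r‖ ^ 2 * ‖smoother ι l (u r)‖ ^ 2)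
        ≤ ∫ r in s..T, M₁ * ‖smoother ι l (u r)‖ ^ 2 :=
          intervalIntegral.integral_mono_on hsT (hc2.intervalIntegrable_of_Icc hsT)
            ((hc.intervalIntegrable_of_Icc hsT).const_mul _)
            fun r hr => mul_le_mul_of_nonneg_right (hu1 r hr) (sq_nonneg _)
      _ ≤ M₁ * M₁ := by
          rw [intervalIntegral.integral_const_mul]
          exact mul_le_mul_of_nonneg_left hu2 hM₁

/-- With `q = P_m v` one has `v = Λ⁻¹ q + m q` and `J_m v = Λ⁻¹ q`. The difference is therefore `(1
- J_l) Λ⁻¹ q - m J_l q`, and the two terms are of size `l ‖q‖` and `m ‖q‖`. -/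
lemma norm_smoother_sub_smoother_le {l m : ℝ} (hl : 0 < l) (hm : 0 < m) (v : H) :
    ‖ι (smoother ι m v) - ι (smoother ι l v)‖ ≤ (l + m) * ‖yosida ι m v‖ := by
  set q := yosida ι m v
  have e : ι (smoother ι m v) - ι (smoother ι l v)
      = (ι (adjoint ι q) - ι (smoother ι l (ι (adjoint ι q)))) - m • ι (smoother ι l q) := by
    have h1 : v = ι (adjoint ι q) + m • q := (shifted_yosida ι hm v).symm
    have h2 : ι (smoother ι l v) = ι (smoother ι l (ι (adjoint ι q))) + m • ι (smoother ι l q) := by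
      conv_lhs => rw [h1]
      simp only [map_add, map_smul]
    rw [h2]
    change ι (adjoint ι q) - _ = _
    abel
  rw [e]
  refine (norm_sub_le _ _).trans ?_
  have h1 := norm_smoother_sub_le ι hl q
  have h2 : ‖m • ι (smoother ι l q)‖ ≤ m * ‖q‖ := by
    rw [norm_smul, Real.norm_of_nonneg hm.le]
    exact mul_le_mul_of_nonneg_left (norm_smoother_le ι hl q) hm.le
  linarith

/-- The nonlinear term of a smoothed field tested against a field that is small in `H`. -/
lemma IsNSETriple.abs_le_of_smooth (D : IsNSETriple ι b C) {M' δ : ℝ} {p q : H} {r : V}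
    (hδ : 0 ≤ δ) (hM : ‖adjoint ι p‖ ^ 2 ≤ M') (hr : ‖ι r‖ ≤ δ * ‖q‖) :
    |b (adjoint ι p) (adjoint ι p) r| ≤ √(C * M') * δ * (‖p‖ ^ 2 + ‖q‖ ^ 2) := by
  have hC := D.const_nonneg
  have hM' : 0 ≤ M' := (sq_nonneg _).trans hM
  have h1 : |b (adjoint ι p) (adjoint ι p) r| ≤ √(C * M') * (‖p‖ * (δ * ‖q‖)) := by
    refine abs_le_of_sq_le_sq ?_ (by positivity)
    refine (D.bound_smooth _ p _).trans ?_
    rw [mul_pow, Real.sq_sqrt (by positivity)]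
    have h2 := D.norm_le (adjoint ι p)
    have h3 := D.norm_adjoint_le p
    calc C * (‖ι (adjoint ι p)‖ * ‖adjoint ι p‖) * (‖adjoint ι p‖ * ‖p‖) * ‖ι r‖ ^ 2
        ≤ C * (‖adjoint ι p‖ * ‖adjoint ι p‖) * (‖p‖ * ‖p‖) * (δ * ‖q‖) ^ 2 := by gcongr
      _ = C * ‖adjoint ι p‖ ^ 2 * (‖p‖ * (δ * ‖q‖)) ^ 2 := by ring
      _ ≤ _ := by gcongr
  refine h1.trans ?_
  rw [mul_assoc]
  refine mul_le_mul_of_nonneg_left ?_ (Real.sqrt_nonneg _)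
  have : ‖p‖ * ‖q‖ ≤ ‖p‖ ^ 2 + ‖q‖ ^ 2 := by nlinarith [sq_nonneg (‖p‖ - ‖q‖), sq_nonneg (‖p‖ + ‖q‖)]
  calc ‖p‖ * (δ * ‖q‖) = δ * (‖p‖ * ‖q‖) := by ring
    _ ≤ _ := mul_le_mul_of_nonneg_left this hδ

set_option maxHeartbeats 800000 in
/-- The pointwise inequality behind the Cauchy property of the regularized solutions. -/
lemma IsNSETriple.regSol_cauchy_pointwise (D : IsNSETriple ι b C) (hν : 0 < ν) {l m : ℝ}
    (hl : 0 < l) (hl1 : l ≤ 1) (hm : 0 < m) (hm1 : m ≤ 1) {x y G : H} {α γ M : ℝ}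
    (hα : |α| ≤ A) (hγ : |γ| ≤ B) (hx : ‖smoother ι l x‖ ^ 2 ≤ M)
    (hy : ‖smoother ι m y‖ ^ 2 ≤ M) :
    2 * ⟪x - y, -(ν • yosida ι l x) - α • x - γ • regB ι b l x + G -
        (-(ν • yosida ι m y) - α • y - γ • regB ι b m y + G)⟫
      + ν * ‖smoother ι l x - smoother ι m y‖ ^ 2
      ≤ (2 * A + 2 * B ^ 2 * C * M / ν) * ‖x - y‖ ^ 2
        + (2 * ν + 4 * B ^ 2 * C * M / ν + 4 * B * √(C * M)) * (l + m)
          * (‖yosida ι l x‖ ^ 2 + ‖yosida ι m y‖ ^ 2) := by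
  have hA0 : 0 ≤ A := (abs_nonneg _).trans hα
  have hB0 : 0 ≤ B := (abs_nonneg _).trans hγ
  have hC := D.const_nonneg
  have hM : 0 ≤ M := (sq_nonneg _).trans hx
  set d := x - y with hd
  set p := yosida ι l x with hp
  set q := yosida ι m y with hq
  set U := smoother ι l x with hUdef
  set W := smoother ι m y with hWdef
  set e := U - W with he
  set S := ‖p‖ ^ 2 + ‖q‖ ^ 2 with hS
  have hS0 : 0 ≤ S := by positivity
  -- The two nonlinearities are tested with different smoothings of `d`. Replacing both by the
  -- common field `e` leaves the errors `r₁ = J_m y - J_l y` and `r₂ = J_m x - J_l x`, which are of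
  -- order `l + m` in `H`.
  set r₁ := smoother ι l d - e with hr₁
  set r₂ := smoother ι m d - e with hr₂
  have eq1 : 2 * ⟪d, -(ν • p) - α • x - γ • regB ι b l x + G -
      (-(ν • q) - α • y - γ • regB ι b m y + G)⟫
      = -2 * ν * ⟪p - q, d⟫ - 2 * α * ‖d‖ ^ 2
        + (-2 * γ) * b e U e + (-2 * γ) * b U U r₁ + (2 * γ) * b W W r₂ := by
    have e1 : -(ν • p) - α • x - γ • regB ι b l x + G -
        (-(ν • q) - α • y - γ • regB ι b m y + G)
        = -(ν • (p - q)) - α • d - γ • (regB ι b l x - regB ι b m y) := by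
      rw [hd]; module
    have e2 : ⟪regB ι b l x - regB ι b m y, d⟫ = b e U e + b U U r₁ - b W W r₂ := by
      rw [inner_sub_left, inner_regB, inner_regB, ← hUdef, ← hWdef]
      have e3 : smoother ι l d = r₁ + e := by rw [hr₁]; abel
      have e4 : smoother ι m d = r₂ + e := by rw [hr₂]; abel
      have e5 : U = W + e := by rw [he]; abel
      have e6 := D.self_eq_zero W e
      have e7 : b U U e - b W W e = b e U e := by
        rw [e5]
        simp only [map_add, add_apply]
        linarith
      rw [e3, e4, map_add, map_add]
      linarith
    rw [e1, real_inner_comm, inner_sub_left, inner_sub_left, inner_neg_left,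
      real_inner_smul_left, real_inner_smul_left, real_inner_smul_left, e2,
      real_inner_self_eq_norm_sq]
    ring
  rw [eq1]
  have hu' : x = ι U + l • p := (smoother_add ι hl x).symm
  have hv' : y = ι W + m • q := (smoother_add ι hm y).symm
  have hd' : d = ι e + (l • p - m • q) := by
    rw [hd, hu', hv', he, map_sub]; abel
  have hpq : ⟪p, q⟫ ≤ S := by
    have := real_inner_le_norm p q
    nlinarith [sq_nonneg (‖p‖ - ‖q‖), sq_nonneg (‖p‖ + ‖q‖)]
  -- The monotonicity identity of Yosida theory: `d = ι e + (l p - m q)` and `ι† (p - q) = e`, so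
  -- the only indefinite contribution is `(l + m) ⟪p, q⟫`.
  have h1 : ‖e‖ ^ 2 - (l + m) * S ≤ ⟪p - q, d⟫ := by
    have e1 : ⟪p - q, ι e⟫ = ‖e‖ ^ 2 := by
      rw [← ContinuousLinearMap.adjoint_inner_left, map_sub, ← real_inner_self_eq_norm_sq]
      rfl
    have e2 : ⟪p - q, l • p - m • q⟫ = l * ‖p‖ ^ 2 + m * ‖q‖ ^ 2 - (l + m) * ⟪p, q⟫ := by
      simp only [inner_sub_left, inner_sub_right, real_inner_smul_right,
        real_inner_self_eq_norm_sq]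
      rw [real_inner_comm p q]; ring
    rw [hd', inner_add_right, e1, e2]
    have e3 := mul_le_mul_of_nonneg_left hpq (by positivity : 0 ≤ l + m)
    have e4 : 0 ≤ l * ‖p‖ ^ 2 + m * ‖q‖ ^ 2 := by positivity
    linarith
  have h2 : -2 * α * ‖d‖ ^ 2 ≤ 2 * A * ‖d‖ ^ 2 := by
    refine mul_le_mul_of_nonneg_right ?_ (sq_nonneg _)
    linarith [neg_le_abs (α), hα]
  have hβ : γ ^ 2 ≤ B ^ 2 := sq_le_sq' (by linarith [neg_le_abs (γ), hγ])
    ((le_abs_self _).trans hγ)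
  have h3 : ‖ι e‖ ^ 2 ≤ 2 * ‖d‖ ^ 2 + 4 * ((l + m) * S) := by
    have e1 : ι e = d - (l • p - m • q) := by rw [hd']; abel
    have e2 : ‖ι e‖ ≤ ‖d‖ + (l * ‖p‖ + m * ‖q‖) := by
      rw [e1]
      refine (norm_sub_le _ _).trans (add_le_add le_rfl ((norm_sub_le _ _).trans (le_of_eq ?_)))
      rw [norm_smul, norm_smul, Real.norm_of_nonneg hl.le, Real.norm_of_nonneg hm.le]
    have e3 : ‖ι e‖ ^ 2 ≤ (‖d‖ + (l * ‖p‖ + m * ‖q‖)) ^ 2 :=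
      pow_le_pow_left₀ (norm_nonneg _) e2 2
    have e4 : (‖d‖ + (l * ‖p‖ + m * ‖q‖)) ^ 2
        ≤ 2 * ‖d‖ ^ 2 + 2 * (l * ‖p‖ + m * ‖q‖) ^ 2 := by
      nlinarith [sq_nonneg (‖d‖ - (l * ‖p‖ + m * ‖q‖))]
    have e5 : (l * ‖p‖ + m * ‖q‖) ^ 2 ≤ 2 * (l ^ 2 * ‖p‖ ^ 2 + m ^ 2 * ‖q‖ ^ 2) := by
      nlinarith [sq_nonneg (l * ‖p‖ - m * ‖q‖)]
    have e6 : l ^ 2 * ‖p‖ ^ 2 ≤ (l + m) * ‖p‖ ^ 2 :=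
      mul_le_mul_of_nonneg_right (by nlinarith) (sq_nonneg _)
    have e7 : m ^ 2 * ‖q‖ ^ 2 ≤ (l + m) * ‖q‖ ^ 2 :=
      mul_le_mul_of_nonneg_right (by nlinarith) (sq_nonneg _)
    have e8 : (l + m) * S = (l + m) * ‖p‖ ^ 2 + (l + m) * ‖q‖ ^ 2 := by rw [hS]; ring
    linarith
  -- The dissipation `2 ν ‖e‖²` is used up exactly: `ν` for this term and `ν` for the term on the
  -- left of the claim.
  have h4 : (-2 * γ) * b e U e ≤ ν * ‖e‖ ^ 2
      + (-2 * γ) ^ 2 * (C * ‖ι e‖ ^ 2 * M) / (4 * ν) := by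
    refine young_quadratic hν (by positivity) ((D.bound _ _ _).trans ?_)
    have := hx
    calc C * (‖ι e‖ * ‖e‖) * ‖U‖ ^ 2 * (‖ι e‖ * ‖e‖) = C * ‖ι e‖ ^ 2 * ‖U‖ ^ 2 * ‖e‖ ^ 2 := by
          ring
      _ ≤ C * ‖ι e‖ ^ 2 * M * ‖e‖ ^ 2 := by gcongr
  have h5 : (-2 * γ) ^ 2 * (C * ‖ι e‖ ^ 2 * M) / (4 * ν)
      ≤ 2 * B ^ 2 * C * M / ν * ‖d‖ ^ 2 + 4 * B ^ 2 * C * M / ν * ((l + m) * S) := by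
    calc (-2 * γ) ^ 2 * (C * ‖ι e‖ ^ 2 * M) / (4 * ν)
        = γ ^ 2 * C * M / ν * ‖ι e‖ ^ 2 := by field_simp; ring
      _ ≤ B ^ 2 * C * M / ν * (2 * ‖d‖ ^ 2 + 4 * ((l + m) * S)) := by gcongr
      _ = _ := by ring
  have hr₁' : ‖ι r₁‖ ≤ (l + m) * ‖q‖ := by
    have e1 : ι r₁ = ι (smoother ι m y) - ι (smoother ι l y) := by
      rw [hr₁, he, hd, hUdef, hWdef]; simp only [map_sub]; abel
    rw [e1]
    exact norm_smoother_sub_smoother_le hl hm y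
  have hr₂' : ‖ι r₂‖ ≤ (l + m) * ‖p‖ := by
    have e1 : ι r₂ = -(ι (smoother ι l x) - ι (smoother ι m x)) := by
      rw [hr₂, he, hd, hUdef, hWdef]; simp only [map_sub]; abel
    rw [e1, norm_neg, add_comm]
    exact norm_smoother_sub_smoother_le hm hl x
  have h6 : |b U U r₁| ≤ √(C * M) * (l + m) * S :=
    D.abs_le_of_smooth (by positivity) hx hr₁'
  have h7 : |b W W r₂| ≤ √(C * M) * (l + m) * S := by
    rw [hS, add_comm (‖p‖ ^ 2)]
    exact D.abs_le_of_smooth (by positivity) hy hr₂'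
  have h8 : ∀ z, |z| ≤ √(C * M) * (l + m) * S → ∀ w, |w| ≤ B →
      2 * w * z ≤ 2 * B * √(C * M) * ((l + m) * S) := by
    intro z hz w hw
    have : |w| * |z| ≤ B * (√(C * M) * (l + m) * S) := mul_le_mul hw hz (abs_nonneg _) hB0
    have e1 := le_abs_self (w * z)
    rw [abs_mul] at e1
    linarith
  have h9 := h8 _ h6 (-γ) (by rw [abs_neg]; exact hγ)
  have h10 := h8 _ h7 (γ) hγ
  have h11 := mul_le_mul_of_nonneg_left h1 (by positivity : 0 ≤ 2 * ν)
  -- The three constants come from the monotonicity identity, from replacing `ι e` by `d` in the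
  -- quadratic term, and from the two remainders `r₁`, `r₂`.
  have h12 : (2 * ν + 4 * B ^ 2 * C * M / ν + 4 * B * √(C * M)) * (l + m) * S = 2 * ν * ((l + m) * S) + 4 * B ^ 2 * C * M / ν * ((l + m) * S)
      + 4 * B * √(C * M) * ((l + m) * S) := by ring
  rw [h12]
  linarith

/-- The regularized solutions form a Cauchy family as the regularization is removed. -/
lemma IsNSETriple.regSol_cauchy (D : IsNSETriple ι b C) (hν : 0 < ν) (hτT : τ ≤ T)
    (hA : ∀ t ∈ Icc τ T, |a t| ≤ A) (hB : ∀ t ∈ Icc τ T, |β t| ≤ B)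
    {g : ℝ → H} (hg : Continuous g) (v₀ : V) :
    ∃ L : ℝ, 0 ≤ L ∧ ∀ l m : ℝ, 0 < l → l ≤ 1 → 0 < m → m ≤ 1 → ∀ u v : ℝ → H,
      IsRegSol ι b ν a β l g τ T u → IsRegSol ι b ν a β m g τ T v →
      u τ = ι v₀ → v τ = ι v₀ → ∀ t ∈ Icc τ T,
      ‖u t - v t‖ ^ 2 + ∫ r in τ..t, ν * ‖smoother ι l (u r) - smoother ι m (v r)‖ ^ 2
        ≤ L * (l + m) := by
  have hA0 : 0 ≤ A := (abs_nonneg _).trans (hA τ (left_mem_Icc.2 hτT))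
  have hB0 : 0 ≤ B := (abs_nonneg _).trans (hB τ (left_mem_Icc.2 hτT))
  have hC := D.const_nonneg
  -- The initial value must lie in `V` here: the consistency error is `l + m` times the integrated
  -- squared Yosida norms, which only the `V` estimate bounds.
  obtain ⟨M, hM, hbd⟩ := D.regSol_enstrophy_bound hν hA hB
    (max (‖v₀‖ ^ 2) (∫ r in τ..T, ‖g r‖ ^ 2))
  have hτ := left_mem_Icc.2 hτT
  have hbd' : ∀ l > 0, ∀ u : ℝ → H, IsRegSol ι b ν a β l g τ T u → u τ = ι v₀ →
      (∀ t ∈ Icc τ T, ‖smoother ι l (u t)‖ ^ 2 ≤ M) ∧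
      (∫ r in τ..T, ‖yosida ι l (u r)‖ ^ 2) ≤ M := by
    intro l hl u hu hu0
    refine (hbd τ hτ l hl g u hg hu ?_ (le_max_right _ _) ?_).2.2
    · rw [hu0]
      exact (pow_le_pow_left₀ (norm_nonneg _) (D.norm_le v₀) 2).trans (le_max_left _ _)
    · rw [hu0]
      exact (inner_yosida_le ι hl v₀).trans (le_max_left _ _)
  set c : ℝ := 2 * ν + 4 * B ^ 2 * C * M / ν + 4 * B * √(C * M) with hc
  have hc0 : 0 ≤ c := by positivity
  refine ⟨Real.exp (∫ _ in τ..T, (2 * A + 2 * B ^ 2 * C * M / ν)) * (c * (2 * M)),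
    by positivity, fun l m hl hl1 hm hm1 u v hu hv hu0 hv0 t ht => ?_⟩
  obtain ⟨hU, hPu⟩ := hbd' l hl u hu hu0
  obtain ⟨-, hPv⟩ := hbd' m hm v hv hv0
  have hW := (hbd' m hm v hv hv0).1
  have huc := hu.continuousOn
  have hvc := hv.continuousOn
  have hcu : ContinuousOn (fun r => ‖yosida ι l (u r)‖ ^ 2) (Icc τ T) := by fun_prop
  have hcv : ContinuousOn (fun r => ‖yosida ι m (v r)‖ ^ 2) (Icc τ T) := by fun_prop
  have key := gronwall_dissipative hτT (x := fun t => ‖u t - v t‖ ^ 2)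
    (y := fun r => ν * ‖smoother ι l (u r) - smoother ι m (v r)‖ ^ 2)
    (k := fun _ => 2 * A + 2 * B ^ 2 * C * M / ν)
    (h := fun r => c * (l + m) * (‖yosida ι l (u r)‖ ^ 2 + ‖yosida ι m (v r)‖ ^ 2))
    ((huc.sub hvc).norm.pow 2)
    (fun t ht => ((hu.hasDerivAt t ht).sub (hv.hasDerivAt t ht)).norm_sq)
    (by fun_prop) (by fun_prop) (by fun_prop) (by positivity) (fun _ _ => by positivity)
    (fun _ _ => by positivity) (fun _ _ => by positivity) ?_ ht
  · refine key.trans ?_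
    refine (mul_le_mul_of_nonneg_left ?_ (Real.exp_pos _).le).trans_eq (mul_assoc _ _ _).symm
    rw [hu0, hv0, sub_self, norm_zero, intervalIntegral.integral_const_mul,
      intervalIntegral.integral_add (hcu.intervalIntegrable_of_Icc hτT)
      (hcv.intervalIntegrable_of_Icc hτT)]
    have h1 := mul_le_mul_of_nonneg_left (add_le_add hPu hPv)
      (by positivity : 0 ≤ c * (l + m))
    linarith
  · intro t ht
    have ht' := Ioo_subset_Icc_self ht
    exact D.regSol_cauchy_pointwise hν hl hl1 hm hm1 (hA t ht') (hB t ht') (hU t ht') (hW t ht')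

end Uniform

end

section

/-! ### Convergence in `L²` -/

section LTwo

variable {X E F : Type*} [MeasurableSpace X] {μ : Measure X}
  [NormedAddCommGroup E] [NormedAddCommGroup F]

lemma sq_eLpNorm_two {f : X → E} (hf : MemLp f 2 μ) :
    eLpNorm f 2 μ ^ 2 = ENNReal.ofReal (∫ x, ‖f x‖ ^ 2 ∂μ) := by
  have h := eLpNorm_nnreal_pow_eq_lintegral (μ := μ) (f := f) (p := 2) (by norm_num)
  have hi : Integrable (fun x => ‖f x‖ ^ 2) μ := hf.integrable_norm_pow (by norm_num)
  rw [ofReal_integral_eq_lintegral_ofReal hi (ae_of_all _ fun _ => by positivity)]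
  simp only [ENNReal.coe_ofNat, NNReal.coe_ofNat, ENNReal.rpow_ofNat] at h
  rw [h]
  refine lintegral_congr fun x => ?_
  rw [ENNReal.ofReal_pow (norm_nonneg _), ofReal_norm]

lemma eLpNorm_two_le {f : X → E} (hf : MemLp f 2 μ) {c : ℝ} (hc : 0 ≤ c)
    (h : ∫ x, ‖f x‖ ^ 2 ∂μ ≤ c ^ 2) : eLpNorm f 2 μ ≤ ENNReal.ofReal c := by
  have h1 := sq_eLpNorm_two hf
  have h2 : eLpNorm f 2 μ ^ 2 ≤ ENNReal.ofReal c ^ 2 := by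
    rw [h1, ← ENNReal.ofReal_pow hc]
    exact ENNReal.ofReal_le_ofReal h
  exact (ENNReal.pow_le_pow_left_iff two_ne_zero).1 h2

lemma tendsto_eLpNorm_two {f : ℕ → X → E} (hf : ∀ n, MemLp (f n) 2 μ)
    (h : Tendsto (fun n => ∫ x, ‖f n x‖ ^ 2 ∂μ) atTop (𝓝 0)) :
    Tendsto (fun n => eLpNorm (f n) 2 μ) atTop (𝓝 0) := by
  have h1 : Tendsto (fun n => ENNReal.ofReal (√(∫ x, ‖f n x‖ ^ 2 ∂μ))) atTop (𝓝 0) := by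
    have := ENNReal.tendsto_ofReal (h.sqrt)
    simpa using this
  refine tendsto_of_tendsto_of_tendsto_of_le_of_le tendsto_const_nhds h1 (fun _ => zero_le)
    fun n => eLpNorm_two_le (hf n) (Real.sqrt_nonneg _) (le_of_eq ?_)
  rw [Real.sq_sqrt]
  exact integral_nonneg fun _ => by positivity

/-- Convergence of the integrals of a bounded bilinear expression under `L²` convergence. -/
lemma tendsto_integral_bilinear [NormedSpace ℝ E] [NormedSpace ℝ F]
    (B : E →L[ℝ] F →L[ℝ] ℝ) {f : ℕ → X → E} {f' : X → E} {h : ℕ → X → F} {h' : X → F}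
    (hf : ∀ n, MemLp (f n) 2 μ) (hf' : MemLp f' 2 μ) (hh : ∀ n, MemLp (h n) 2 μ)
    (hh' : MemLp h' 2 μ) (hff : Tendsto (fun n => eLpNorm (f n - f') 2 μ) atTop (𝓝 0))
    (hhh : Tendsto (fun n => eLpNorm (h n - h') 2 μ) atTop (𝓝 0)) :
    Tendsto (fun n => ∫ x, B (f n x) (h n x) ∂μ) atTop (𝓝 (∫ x, B (f' x) (h' x) ∂μ)) := by
  have hbound : ∀ (p : X → E) (q : X → F), MemLp p 2 μ → MemLp q 2 μ →
      eLpNorm (fun x => B (p x) (q x)) 1 μ ≤ ‖B‖₊ * eLpNorm p 2 μ * eLpNorm q 2 μ := by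
    intro p q hp hq
    refine eLpNorm_le_eLpNorm_mul_eLpNorm_of_nnnorm hp.1 hq.1 (fun x y => B x y) ‖B‖₊
      (ae_of_all _ fun x => ?_)
    exact B.le_opNorm₂ (p x) (q x)
  have hint : ∀ (p : X → E) (q : X → F), MemLp p 2 μ → MemLp q 2 μ →
      Integrable (fun x => B (p x) (q x)) μ := by
    intro p q hp hq
    rw [← memLp_one_iff_integrable]
    refine ⟨B.aestronglyMeasurable_comp₂ hp.1 hq.1, (hbound p q hp hq).trans_lt ?_⟩
    exact ENNReal.mul_lt_top (ENNReal.mul_lt_top ENNReal.coe_lt_top hp.2) hq.2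
  refine tendsto_integral_of_L1' _ (hint f' h' hf' hh').1
    (Eventually.of_forall fun n => hint _ _ (hf n) (hh n)) ?_
  have hle : ∀ n, eLpNorm ((fun x => B (f n x) (h n x)) - fun x => B (f' x) (h' x)) 1 μ
      ≤ ‖B‖₊ * eLpNorm (f n - f') 2 μ * (eLpNorm (h n - h') 2 μ + eLpNorm h' 2 μ)
        + ‖B‖₊ * eLpNorm f' 2 μ * eLpNorm (h n - h') 2 μ := by
    intro n
    have e : ((fun x => B (f n x) (h n x)) - fun x => B (f' x) (h' x))
        = (fun x => B ((f n - f') x) (h n x)) + fun x => B (f' x) ((h n - h') x) := by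
      funext x
      simp [map_sub]
    rw [e]
    refine (eLpNorm_add_le (hint _ _ ((hf n).sub hf') (hh n)).1
      (hint _ _ hf' ((hh n).sub hh')).1 le_rfl).trans (add_le_add ?_ ?_)
    · refine (hbound _ _ ((hf n).sub hf') (hh n)).trans ?_
      gcongr
      have := eLpNorm_add_le ((hh n).sub hh').1 hh'.1 (p := 2) (by norm_num)
      simpa using this
    · exact hbound _ _ hf' ((hh n).sub hh')
  refine tendsto_of_tendsto_of_tendsto_of_le_of_le tendsto_const_nhds ?_ (fun _ => zero_le) hle
  have t1 : Tendsto (fun n => (‖B‖₊ : ℝ≥0∞) * eLpNorm (f n - f') 2 μ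
      * (eLpNorm (h n - h') 2 μ + eLpNorm h' 2 μ)) atTop
      (𝓝 ((‖B‖₊ : ℝ≥0∞) * 0 * (0 + eLpNorm h' 2 μ))) := by
    refine ENNReal.Tendsto.mul (ENNReal.Tendsto.const_mul hff (Or.inr ENNReal.coe_ne_top)) ?_
      (hhh.add tendsto_const_nhds) ?_
    · exact Or.inr (by simpa using hh'.2.ne)
    · exact Or.inr (by simp)
  have t2 : Tendsto (fun n => (‖B‖₊ : ℝ≥0∞) * eLpNorm f' 2 μ * eLpNorm (h n - h') 2 μ) atTop
      (𝓝 ((‖B‖₊ : ℝ≥0∞) * eLpNorm f' 2 μ * 0)) :=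
    ENNReal.Tendsto.const_mul hhh (Or.inr (ENNReal.mul_ne_top ENNReal.coe_ne_top hf'.2.ne))
  simpa using t1.add t2

/-- The version of `tendsto_integral_bilinear` on subintervals, with a continuous weight. -/
lemma tendsto_intervalIntegral_bilinear [NormedSpace ℝ E] [NormedSpace ℝ F]
    (B : E →L[ℝ] F →L[ℝ] ℝ) {c : ℝ → ℝ} (hc : Continuous c) {τ T t : ℝ} (ht : t ∈ Icc τ T)
    {f : ℕ → ℝ → E} {f' : ℝ → E} {h : ℕ → ℝ → F} {h' : ℝ → F}
    (hf : ∀ n, MemLp (f n) 2 (volume.restrict (Icc τ T)))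
    (hf' : MemLp f' 2 (volume.restrict (Icc τ T)))
    (hh : ∀ n, MemLp (h n) 2 (volume.restrict (Icc τ T)))
    (hh' : MemLp h' 2 (volume.restrict (Icc τ T)))
    (hff : Tendsto (fun n => eLpNorm (f n - f') 2 (volume.restrict (Icc τ T))) atTop (𝓝 0))
    (hhh : Tendsto (fun n => eLpNorm (h n - h') 2 (volume.restrict (Icc τ T))) atTop (𝓝 0)) :
    Tendsto (fun n => ∫ s in τ..t, c s * B (f n s) (h n s)) atTop
      (𝓝 (∫ s in τ..t, c s * B (f' s) (h' s))) := by
  have hle : volume.restrict (Ioc τ t) ≤ volume.restrict (Icc τ T) :=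
    Measure.restrict_mono (fun _ (hs : _ ∈ Ioc τ t) => (⟨hs.1.le, hs.2.trans ht.2⟩ : _ ∈ Icc τ T))
      le_rfl
  have hcb : MemLp c ∞ (volume.restrict (Icc τ T)) := by
    obtain ⟨K, hK⟩ := isCompact_Icc.exists_bound_of_continuousOn (hc.continuousOn (s := Icc τ T))
    refine memLp_top_of_bound hc.aestronglyMeasurable K ?_
    exact (ae_restrict_iff' measurableSet_Icc).2 (ae_of_all _ hK)
  -- The bounded weight is absorbed into the first argument, reducing to the unweighted statement.
  have hcf : ∀ p : ℝ → E, MemLp p 2 (volume.restrict (Icc τ T)) →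
      MemLp (fun s => c s • p s) 2 (volume.restrict (Icc τ T)) := fun p hp => hp.smul hcb
  have key := tendsto_integral_bilinear (μ := volume.restrict (Ioc τ t)) B
    (f := fun n s => c s • f n s) (f' := fun s => c s • f' s) (h := h) (h' := h')
    (fun n => (hcf _ (hf n)).mono_measure hle) ((hcf _ hf').mono_measure hle)
    (fun n => (hh n).mono_measure hle) (hh'.mono_measure hle) ?_ ?_
  · simp only [intervalIntegral.integral_of_le ht.1]
    simpa only [map_smul, smul_apply, smul_eq_mul] using key
  · have h1 : Tendsto (fun n => eLpNorm c ∞ (volume.restrict (Icc τ T))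
        * eLpNorm (f n - f') 2 (volume.restrict (Icc τ T))) atTop (𝓝 0) := by
      simpa using ENNReal.Tendsto.const_mul hff (Or.inr hcb.2.ne)
    refine tendsto_of_tendsto_of_tendsto_of_le_of_le tendsto_const_nhds h1 (fun _ => zero_le)
      fun n => ?_
    have e : ((fun s => c s • f n s) - fun s => c s • f' s) = c • (f n - f') := by
      funext s; simp [smul_sub]
    change eLpNorm ((fun s => c s • f n s) - fun s => c s • f' s) 2 _ ≤ _
    rw [e]
    exact (eLpNorm_mono_measure _ hle).trans
      (eLpNorm_smul_le_eLpNorm_top_mul_eLpNorm 2 ((hf n).sub hf').1 c)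
  · exact tendsto_of_tendsto_of_tendsto_of_le_of_le tendsto_const_nhds hhh (fun _ => zero_le)
      fun n => eLpNorm_mono_measure _ hle

lemma tendsto_intervalIntegral_inner {E : Type*} [NormedAddCommGroup E] [InnerProductSpace ℝ E]
    {c : ℝ → ℝ} (hc : Continuous c) {τ T t : ℝ} (ht : t ∈ Icc τ T)
    {f : ℕ → ℝ → E} {f' : ℝ → E} (hf : ∀ n, MemLp (f n) 2 (volume.restrict (Icc τ T)))
    (hf' : MemLp f' 2 (volume.restrict (Icc τ T)))
    (hff : Tendsto (fun n => eLpNorm (f n - f') 2 (volume.restrict (Icc τ T))) atTop (𝓝 0))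
    (ψ : E) :
    Tendsto (fun n => ∫ s in τ..t, c s * ⟪f n s, ψ⟫) atTop
      (𝓝 (∫ s in τ..t, c s * ⟪f' s, ψ⟫)) :=
  tendsto_intervalIntegral_bilinear (innerSL ℝ) hc ht hf hf' (h := fun _ _ => ψ)
    (fun _ => memLp_const ψ) (memLp_const ψ) hff (by simp)

end LTwo

/-- Uniform Cauchy sequences in `C([τ, T]; E)` and Cauchy sequences in `L²(τ, T; F)` converge. -/
lemma exists_limit_of_cauchy {E F : Type*} [NormedAddCommGroup E] [CompleteSpace E]
    [NormedAddCommGroup F] [CompleteSpace F] {τ T : ℝ} {un : ℕ → ℝ → E} {wn : ℕ → ℝ → F}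
    (hwn : ∀ n, MemLp (wn n) 2 (volume.restrict (Icc τ T))) {ρ : ℕ → ℝ} (hρ0 : ∀ n, 0 ≤ ρ n)
    (hρ : Tendsto ρ atTop (𝓝 0))
    (hu : ∀ N m n, N ≤ m → N ≤ n → ∀ t ∈ Icc τ T, dist (un m t) (un n t) ≤ ρ N)
    (hw : ∀ N m n, N ≤ m → N ≤ n →
      eLpNorm (wn m - wn n) 2 (volume.restrict (Icc τ T)) ≤ ENNReal.ofReal (ρ N)) :
    ∃ (u : ℝ → E) (w : ℝ → F), TendstoUniformlyOn un u atTop (Icc τ T) ∧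
      MemLp w 2 (volume.restrict (Icc τ T)) ∧
      Tendsto (fun n => eLpNorm (wn n - w) 2 (volume.restrict (Icc τ T))) atTop (𝓝 0) := by
  -- Outside the interval the limit takes an arbitrary value.
  have hex : ∀ t, ∃ y, t ∈ Icc τ T → Tendsto (fun n => un n t) atTop (𝓝 y) := by
    intro t
    by_cases ht : t ∈ Icc τ T
    · obtain ⟨y, hy⟩ := cauchySeq_tendsto_of_complete
        (cauchySeq_of_le_tendsto_0 _ (fun n m N hn hm => hu N n m hn hm t ht) hρ)
      exact ⟨y, fun _ => hy⟩
    · exact ⟨un 0 t, fun h => absurd h ht⟩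
  choose u hu' using hex
  have hWc : CauchySeq (fun n => (hwn n).toLp (wn n)) := by
    refine cauchySeq_of_le_tendsto_0 ρ ?_ hρ
    intro n m N hn hm
    rw [dist_edist, Lp.edist_toLp_toLp]
    exact ENNReal.toReal_le_of_le_ofReal (hρ0 N) (hw N n m hn hm)
  obtain ⟨W, hW⟩ := cauchySeq_tendsto_of_complete hWc
  refine ⟨u, W, ?_, Lp.memLp W, ?_⟩
  · refine UniformCauchySeqOn.tendstoUniformlyOn_of_tendsto ?_ fun t ht => hu' t ht
    rw [Metric.uniformCauchySeqOn_iff]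
    intro ε hε
    obtain ⟨N, hN⟩ := (hρ.eventually (gt_mem_nhds hε)).exists
    exact ⟨N, fun m hm n hn t ht => (hu N m n hm hn t ht).trans_lt hN⟩
  · have := (Lp.tendsto_Lp_iff_tendsto_eLpNorm' _ _).1 hW
    refine this.congr fun n => eLpNorm_congr_ae ?_
    exact ((hwn n).coeFn_toLp).sub (ae_eq_refl _)

/-! ### Weak solutions -/

variable {H V : Type*} [NormedAddCommGroup H] [InnerProductSpace ℝ H] [CompleteSpace H]
  [NormedAddCommGroup V] [InnerProductSpace ℝ V] [CompleteSpace V]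

/-- Weak solutions on `[τ, T]` of `u' + ν Λ u + a u + β B(u) = g`; here `w` is `u` regarded as a
`V`-valued function. -/
structure IsSol (ι : V →L[ℝ] H) (b : V →L[ℝ] V →L[ℝ] V →L[ℝ] ℝ) (ν : ℝ) (a β : ℝ → ℝ)
    (g : ℝ → H) (τ T : ℝ) (u : ℝ → H) (w : ℝ → V) : Prop where
  continuousOn : ContinuousOn u (Icc τ T)
  memLp : MemLp w 2 (volume.restrict (Icc τ T))
  ae_eq : ∀ᵐ s ∂(volume.restrict (Icc τ T)), ι (w s) = u s
  equation : ∀ ψ : V, ∀ t ∈ Icc τ T, ⟪u t, ι ψ⟫ + ν * (∫ s in τ..t, ⟪w s, ψ⟫)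
    + (∫ s in τ..t, a s * ⟪u s, ι ψ⟫) + (∫ s in τ..t, β s * b (w s) (w s) ψ)
    = ⟪u τ, ι ψ⟫ + ∫ s in τ..t, ⟪g s, ι ψ⟫

lemma memLp_of_continuousOn {E : Type*} [NormedAddCommGroup E] {τ T : ℝ} {f : ℝ → E}
    (hf : ContinuousOn f (Icc τ T)) {p : ℝ≥0∞} : MemLp f p (volume.restrict (Icc τ T)) := by
  obtain ⟨K, hK⟩ := isCompact_Icc.exists_bound_of_continuousOn hf
  exact MemLp.of_bound (hf.aestronglyMeasurable_of_isCompact isCompact_Icc measurableSet_Icc) K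
    ((ae_restrict_iff' measurableSet_Icc).2 (ae_of_all _ hK))

lemma tendsto_eLpNorm_of_tendstoUniformlyOn {E : Type*} [NormedAddCommGroup E] {τ T : ℝ}
    {f : ℕ → ℝ → E} {f' : ℝ → E} (hf : TendstoUniformlyOn f f' atTop (Icc τ T)) :
    Tendsto (fun n => eLpNorm (f n - f') 2 (volume.restrict (Icc τ T))) atTop (𝓝 0) := by
  rw [ENNReal.tendsto_nhds_zero]
  intro ε hε
  set K := volume.restrict (Icc τ T) univ ^ ((2 : ℝ≥0∞).toReal⁻¹) with hK
  have hKtop : K ≠ ∞ := ENNReal.rpow_ne_top_of_nonneg (by positivity) (measure_ne_top _ _)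
  obtain ⟨δ, hδ, hδε⟩ : ∃ δ : ℝ, 0 < δ ∧ K * ENNReal.ofReal δ ≤ ε := by
    have h1 : Tendsto (fun δ : ℝ => K * ENNReal.ofReal δ) (𝓝[>] 0) (𝓝 (K * ENNReal.ofReal 0)) :=
      ENNReal.Tendsto.const_mul
        ((ENNReal.continuous_ofReal.tendsto 0).mono_left nhdsWithin_le_nhds) (Or.inr hKtop)
    rw [ENNReal.ofReal_zero, mul_zero] at h1
    obtain ⟨δ, hδ1, hδ2⟩ := ((h1.eventually (ge_mem_nhds hε)).and self_mem_nhdsWithin).exists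
    exact ⟨δ, hδ2, hδ1⟩
  filter_upwards [Metric.tendstoUniformlyOn_iff.1 hf δ hδ] with n hn
  refine (eLpNorm_le_of_ae_bound (C := δ) ?_).trans ?_
  · refine (ae_restrict_iff' measurableSet_Icc).2 (ae_of_all _ fun s hs => ?_)
    have := hn s hs
    rw [dist_comm, dist_eq_norm] at this
    exact this.le
  · exact hδε

/-- `(u, v) ↦ b(u, v, ψ)` as a bounded bilinear form. -/
def evalThird (b : V →L[ℝ] V →L[ℝ] V →L[ℝ] ℝ) (ψ : V) : V →L[ℝ] V →L[ℝ] ℝ :=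
  (ContinuousLinearMap.compL ℝ V (V →L[ℝ] ℝ) ℝ (ContinuousLinearMap.apply ℝ ℝ ψ)) ∘L b

/-- Limits of approximate weak solutions are weak solutions. -/
lemma isSol_of_tendsto {ι : V →L[ℝ] H} {b : V →L[ℝ] V →L[ℝ] V →L[ℝ] ℝ} {ν : ℝ} {a β : ℝ → ℝ}
    (ha : Continuous a) (hβ : Continuous β) {τ T : ℝ} {g u : ℝ → H} {w : ℝ → V}
    {gn un : ℕ → ℝ → H} {wn : ℕ → ℝ → V}
    (hgn : ∀ n, MemLp (gn n) 2 (volume.restrict (Icc τ T)))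
    (hg : MemLp g 2 (volume.restrict (Icc τ T)))
    (hgg : Tendsto (fun n => eLpNorm (gn n - g) 2 (volume.restrict (Icc τ T))) atTop (𝓝 0))
    (hun : ∀ n, ContinuousOn (un n) (Icc τ T)) (huu : TendstoUniformlyOn un u atTop (Icc τ T))
    (hwn : ∀ n, MemLp (wn n) 2 (volume.restrict (Icc τ T)))
    (hw : MemLp w 2 (volume.restrict (Icc τ T)))
    (hww : Tendsto (fun n => eLpNorm (wn n - w) 2 (volume.restrict (Icc τ T))) atTop (𝓝 0))
    (hwu : Tendsto (fun n => eLpNorm ((fun s => ι (wn n s)) - un n) 2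
      (volume.restrict (Icc τ T))) atTop (𝓝 0))
    (hres : ∀ ψ : V, ∀ t ∈ Icc τ T, Tendsto (fun n => ⟪un n t, ι ψ⟫
      + ν * (∫ s in τ..t, ⟪wn n s, ψ⟫) + (∫ s in τ..t, a s * ⟪un n s, ι ψ⟫)
      + (∫ s in τ..t, β s * b (wn n s) (wn n s) ψ)
      - (⟪un n τ, ι ψ⟫ + ∫ s in τ..t, ⟪gn n s, ι ψ⟫)) atTop (𝓝 0)) :
    IsSol ι b ν a β g τ T u w := by
  have huc : ContinuousOn u (Icc τ T) := huu.continuousOn (Frequently.of_forall hun)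
  have hum : MemLp u 2 (volume.restrict (Icc τ T)) := memLp_of_continuousOn huc
  have hunm : ∀ n, MemLp (un n) 2 (volume.restrict (Icc τ T)) := fun n =>
    memLp_of_continuousOn (hun n)
  have huu2 := tendsto_eLpNorm_of_tendstoUniformlyOn huu
  have hιwn : ∀ n, MemLp (fun s => ι (wn n s)) 2 (volume.restrict (Icc τ T)) := fun n =>
    ι.comp_memLp' (hwn n)
  have hιw : MemLp (fun s => ι (w s)) 2 (volume.restrict (Icc τ T)) := ι.comp_memLp' hw
  refine ⟨huc, hw, ?_, fun ψ t ht => ?_⟩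
  · have h0 : eLpNorm ((fun s => ι (w s)) - u) 2 (volume.restrict (Icc τ T)) = 0 := by
      have hle : ∀ n, eLpNorm ((fun s => ι (w s)) - u) 2 (volume.restrict (Icc τ T))
          ≤ ‖ι‖₊ * eLpNorm (wn n - w) 2 (volume.restrict (Icc τ T))
            + (eLpNorm ((fun s => ι (wn n s)) - un n) 2 (volume.restrict (Icc τ T))
            + eLpNorm (un n - u) 2 (volume.restrict (Icc τ T))) := by
        intro n
        have e : (fun s => ι (w s)) - u = -((fun s => ι ((wn n - w) s)))
            + (((fun s => ι (wn n s)) - un n) + (un n - u)) := by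
          funext s; simp
        rw [e]
        refine (eLpNorm_add_le (ι.comp_memLp' ((hwn n).sub hw)).1.neg
          (((hιwn n).sub (hunm n)).add ((hunm n).sub hum)).1 (by norm_num)).trans
          (add_le_add ?_ (eLpNorm_add_le ((hιwn n).sub (hunm n)).1 ((hunm n).sub hum).1
            (by norm_num)))
        rw [eLpNorm_neg]
        exact eLpNorm_le_nnreal_smul_eLpNorm_of_ae_le_mul
          (ae_of_all _ fun s => ι.le_opNNNorm _) 2
      have ht : Tendsto (fun n => (‖ι‖₊ : ℝ≥0∞) * eLpNorm (wn n - w) 2 (volume.restrict (Icc τ T))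
            + (eLpNorm ((fun s => ι (wn n s)) - un n) 2 (volume.restrict (Icc τ T))
            + eLpNorm (un n - u) 2 (volume.restrict (Icc τ T)))) atTop (𝓝 0) := by
        simpa using (ENNReal.Tendsto.const_mul hww (Or.inr (ENNReal.coe_ne_top (r := ‖ι‖₊)))).add
          (hwu.add huu2)
      exact le_antisymm (ge_of_tendsto' ht hle) (zero_le)
    have h1 := (eLpNorm_eq_zero_iff (hιw.sub hum).1 (by norm_num)).1 h0
    filter_upwards [h1] with s hs
    simpa [sub_eq_zero] using hs
  · have hτ : τ ∈ Icc τ T := ⟨le_rfl, ht.1.trans ht.2⟩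
    have l1 : Tendsto (fun n => ⟪un n t, ι ψ⟫) atTop (𝓝 ⟪u t, ι ψ⟫) :=
      (huu.tendsto_at ht).inner tendsto_const_nhds
    have l0 : Tendsto (fun n => ⟪un n τ, ι ψ⟫) atTop (𝓝 ⟪u τ, ι ψ⟫) :=
      (huu.tendsto_at hτ).inner tendsto_const_nhds
    have l2 : Tendsto (fun n => ∫ s in τ..t, ⟪wn n s, ψ⟫) atTop (𝓝 (∫ s in τ..t, ⟪w s, ψ⟫)) := by
      simpa using tendsto_intervalIntegral_inner (c := fun _ => 1) continuous_const ht hwn hw hww ψ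
    have l3 : Tendsto (fun n => ∫ s in τ..t, a s * ⟪un n s, ι ψ⟫) atTop
        (𝓝 (∫ s in τ..t, a s * ⟪u s, ι ψ⟫)) :=
      tendsto_intervalIntegral_inner ha ht hunm hum huu2 (ι ψ)
    have l4 : Tendsto (fun n => ∫ s in τ..t, β s * b (wn n s) (wn n s) ψ) atTop
        (𝓝 (∫ s in τ..t, β s * b (w s) (w s) ψ)) :=
      tendsto_intervalIntegral_bilinear (evalThird b ψ) hβ ht hwn hw hwn hw hww hww
    have l5 : Tendsto (fun n => ∫ s in τ..t, ⟪gn n s, ι ψ⟫) atTop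
        (𝓝 (∫ s in τ..t, ⟪g s, ι ψ⟫)) := by
      simpa using tendsto_intervalIntegral_inner (c := fun _ => 1) continuous_const ht hgn hg hgg
        (ι ψ)
    have := tendsto_nhds_unique (hres ψ t ht)
      ((((l1.add (l2.const_mul ν)).add l3).add l4).sub (l0.add l5))
    linarith

end

section

variable {H V : Type*} [NormedAddCommGroup H] [InnerProductSpace ℝ H] [CompleteSpace H]
  [NormedAddCommGroup V] [InnerProductSpace ℝ V] [CompleteSpace V]

/-! ### Solutions with smooth data -/

/-- The sequence of regularization parameters. -/
def regParam (n : ℕ) : ℝ := 1 / ((n : ℝ) + 1)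

lemma regParam_pos (n : ℕ) : 0 < regParam n := by unfold regParam; positivity

lemma regParam_le_one (n : ℕ) : regParam n ≤ 1 := by
  unfold regParam
  rw [div_le_one (by positivity)]
  linarith [(Nat.cast_nonneg n : (0 : ℝ) ≤ n)]

lemma regParam_anti {m n : ℕ} (h : m ≤ n) : regParam n ≤ regParam m := by
  unfold regParam
  have : (m : ℝ) ≤ n := by exact_mod_cast h
  gcongr

lemma tendsto_regParam : Tendsto regParam atTop (𝓝 0) := tendsto_one_div_add_atTop_nhds_zero_nat

lemma tendsto_regParam_right : Tendsto regParam atTop (𝓝[>] 0) :=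
  tendsto_nhdsWithin_iff.2 ⟨tendsto_regParam, Eventually.of_forall regParam_pos⟩

/-- Weak solutions obtained as limits of the regularized equation. -/
structure IsRegLimit (ι : V →L[ℝ] H) (b : V →L[ℝ] V →L[ℝ] V →L[ℝ] ℝ) (ν : ℝ) (a β : ℝ → ℝ)
    (g : ℝ → H) (τ T : ℝ) (v₀ : V) (un : ℕ → ℝ → H) (u : ℝ → H) (w : ℝ → V) : Prop where
  isSol : IsSol ι b ν a β g τ T u w
  regSol : ∀ n, IsRegSol ι b ν a β (regParam n) g τ T (un n)
  initial : ∀ n, un n τ = ι v₀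
  tendsto : TendstoUniformlyOn un u atTop (Icc τ T)
  tendsto_V : Tendsto (fun n => eLpNorm ((fun s => smoother ι (regParam n) (un n s)) - w) 2
    (volume.restrict (Icc τ T))) atTop (𝓝 0)

lemma integral_restrict_Icc {τ T : ℝ} (hτT : τ ≤ T) (f : ℝ → ℝ) :
    ∫ s, f s ∂(volume.restrict (Icc τ T)) = ∫ s in τ..T, f s := by
  rw [intervalIntegral.integral_of_le hτT, integral_Icc_eq_integral_Ioc]

section

variable {ι : V →L[ℝ] H} {b : V →L[ℝ] V →L[ℝ] V →L[ℝ] ℝ} {C : ℝ}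
  {ν : ℝ} {a β : ℝ → ℝ} {τ T : ℝ}

/-- The weak form of the regularized equation. -/
lemma IsRegSol.weak_form {l : ℝ} {g u : ℝ → H} (ha : Continuous a) (hβ : Continuous β)
    (hg : Continuous g) (hu : IsRegSol ι b ν a β l g τ T u) (ψ : V) {t : ℝ} (ht : t ∈ Icc τ T) :
    ⟪u t, ι ψ⟫ + ν * (∫ s in τ..t, ⟪smoother ι l (u s), ψ⟫)
      + (∫ s in τ..t, a s * ⟪u s, ι ψ⟫)
      + (∫ s in τ..t, β s * b (smoother ι l (u s)) (smoother ι l (u s)) ψ)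
      - (⟪u τ, ι ψ⟫ + ∫ s in τ..t, ⟪g s, ι ψ⟫)
    = ∫ s in τ..t, β s * b (smoother ι l (u s)) (smoother ι l (u s))
        (ψ - smoother ι l (ι ψ)) := by
  have huc : ContinuousOn u (Icc τ t) := hu.continuousOn.mono (Icc_subset_Icc_right ht.2)
  have hftc := intervalIntegral.integral_eq_sub_of_hasDerivAt_of_le ht.1
    (f := fun s => ⟪u s, ι ψ⟫) (f' := fun s => -(ν * ⟪smoother ι l (u s), ψ⟫)
      - a s * ⟪u s, ι ψ⟫
      - β s * b (smoother ι l (u s)) (smoother ι l (u s)) (smoother ι l (ι ψ)) + ⟪g s, ι ψ⟫)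
    (by fun_prop) (fun s hs => ?_) ?_
  · have i1 : IntervalIntegrable (fun s => -(ν * ⟪smoother ι l (u s), ψ⟫)) volume τ t :=
      ContinuousOn.intervalIntegrable_of_Icc ht.1 (by fun_prop)
    have i2 : IntervalIntegrable (fun s => a s * ⟪u s, ι ψ⟫) volume τ t :=
      ContinuousOn.intervalIntegrable_of_Icc ht.1 (by fun_prop)
    have i3 : ∀ φ, IntervalIntegrable (fun s => β s * b (smoother ι l (u s)) (smoother ι l (u s))
        φ) volume τ t := fun φ =>
      ContinuousOn.intervalIntegrable_of_Icc ht.1 (by fun_prop)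
    have i4 : IntervalIntegrable (fun s => ⟪g s, ι ψ⟫) volume τ t :=
      ContinuousOn.intervalIntegrable_of_Icc ht.1 (by fun_prop)
    rw [intervalIntegral.integral_add ((i1.sub i2).sub (i3 _)) i4,
      intervalIntegral.integral_sub (i1.sub i2) (i3 _),
      intervalIntegral.integral_sub i1 i2, intervalIntegral.integral_neg,
      intervalIntegral.integral_const_mul] at hftc
    simp only [map_sub, mul_sub]
    rw [intervalIntegral.integral_sub (i3 _) (i3 _)]
    linarith
  · have h1 := (hu.hasDerivAt s ⟨hs.1, hs.2.trans_le ht.2⟩).inner ℝ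
      (hasDerivAt_const s (ι ψ))
    refine h1.congr_deriv ?_
    rw [inner_zero_right, zero_add, inner_add_left, inner_sub_left, inner_sub_left,
      inner_neg_left, real_inner_smul_left, real_inner_smul_left, real_inner_smul_left,
      inner_regB, ← ContinuousLinearMap.adjoint_inner_left]
    rfl
  · exact ContinuousOn.intervalIntegrable_of_Icc ht.1 (by fun_prop)

/-- The Cauchy estimate yields convergence in `C([τ, T]; H)` and, for the smoothed functions, in
`L²(τ, T; V)`. This strong convergence suffices to pass to the limit in the quadratic term. -/
lemma IsNSETriple.exists_regLimit (D : IsNSETriple ι b C) (hν : 0 < ν) (ha : Continuous a)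
    (hβ : Continuous β) (hτT : τ ≤ T) {g : ℝ → H} (hg : Continuous g) (v₀ : V) :
    ∃ un u w, IsRegLimit ι b ν a β g τ T v₀ un u w := by
  obtain ⟨A, hA⟩ := isCompact_Icc.exists_bound_of_continuousOn (ha.continuousOn (s := Icc τ T))
  obtain ⟨B, hB⟩ := isCompact_Icc.exists_bound_of_continuousOn (hβ.continuousOn (s := Icc τ T))
  have hτ : τ ∈ Icc τ T := left_mem_Icc.2 hτT
  have hT : T ∈ Icc τ T := right_mem_Icc.2 hτT
  have hB0 : 0 ≤ B := (norm_nonneg _).trans (hB τ hτ)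
  obtain ⟨L, hL, hcau⟩ := D.regSol_cauchy hν hτT hA hB hg v₀
  have hex : ∀ n, ∃ u, u τ = ι v₀ ∧ IsRegSol ι b ν a β (regParam n) g τ T u := fun n =>
    D.exists_regSol hν.le ha hβ hg (regParam_pos n) hτT (ι v₀)
  choose un hun0 hun using hex
  obtain ⟨M, hM, hbd⟩ := D.regSol_enstrophy_bound hν hA hB
    (max (‖v₀‖ ^ 2) (∫ r in τ..T, ‖g r‖ ^ 2))
  have hbd' : ∀ n, (∫ r in τ..T, ‖smoother ι (regParam n) (un n r)‖ ^ 2) ≤ M ∧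
      (∫ r in τ..T, ‖yosida ι (regParam n) (un n r)‖ ^ 2) ≤ M := by
    intro n
    have := hbd τ hτ _ (regParam_pos n) g (un n) hg (hun n) ?_ (le_max_right _ _) ?_
    · exact ⟨this.2.1, this.2.2.2⟩
    · rw [hun0]
      exact (pow_le_pow_left₀ (norm_nonneg _) (D.norm_le v₀) 2).trans (le_max_left _ _)
    · rw [hun0]
      exact (inner_yosida_le ι (regParam_pos n) v₀).trans (le_max_left _ _)
  have hunc : ∀ n, ContinuousOn (un n) (Icc τ T) := fun n => (hun n).continuousOn
  set wn : ℕ → ℝ → V := fun n s => smoother ι (regParam n) (un n s) with hwn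
  have hwnc : ∀ n, ContinuousOn (wn n) (Icc τ T) := fun n => by
    have := hunc n
    simp only [hwn]
    fun_prop
  have hwnm : ∀ n, MemLp (wn n) 2 (volume.restrict (Icc τ T)) := fun n =>
    memLp_of_continuousOn (hwnc n)
  have hc : ∀ N m n, N ≤ m → N ≤ n → ∀ t ∈ Icc τ T, ‖un m t - un n t‖ ^ 2
      + ∫ r in τ..t, ν * ‖wn m r - wn n r‖ ^ 2 ≤ 2 * L * regParam N := by
    intro N m n hm hn t ht
    refine (hcau _ _ (regParam_pos m) (regParam_le_one m) (regParam_pos n) (regParam_le_one n)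
      _ _ (hun m) (hun n) (hun0 m) (hun0 n) t ht).trans ?_
    have := mul_le_mul_of_nonneg_left (add_le_add (regParam_anti hm) (regParam_anti hn)) hL
    linarith
  have hc1 : ∀ N m n, N ≤ m → N ≤ n → ∀ t ∈ Icc τ T,
      dist (un m t) (un n t) ≤ √(2 * L * regParam N) := by
    intro N m n hm hn t ht
    refine Real.le_sqrt_of_sq_le ?_
    rw [dist_eq_norm]
    have h1 := hc N m n hm hn t ht
    have h2 : 0 ≤ ∫ r in τ..t, ν * ‖wn m r - wn n r‖ ^ 2 :=
      intervalIntegral.integral_nonneg ht.1 fun _ _ => by positivity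
    linarith
  have hc2 : ∀ N m n, N ≤ m → N ≤ n →
      eLpNorm (wn m - wn n) 2 (volume.restrict (Icc τ T))
        ≤ ENNReal.ofReal (√(2 * L / ν * regParam N)) := by
    intro N m n hm hn
    refine eLpNorm_two_le ((hwnm m).sub (hwnm n)) (Real.sqrt_nonneg _) ?_
    have hp := regParam_pos N
    rw [Real.sq_sqrt (by positivity), integral_restrict_Icc hτT]
    have h1 := hc N m n hm hn T hT
    rw [intervalIntegral.integral_const_mul] at h1
    rw [div_mul_eq_mul_div, le_div_iff₀ hν]
    change (∫ r in τ..T, ‖wn m r - wn n r‖ ^ 2) * ν ≤ _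
    linarith [sq_nonneg ‖un m T - un n T‖]
  have hlim0 : ∀ c : ℝ, Tendsto (fun N => √(c * regParam N)) atTop (𝓝 0) := by
    intro c
    simpa using (tendsto_regParam.const_mul c).sqrt
  set ρ : ℕ → ℝ := fun N => √(2 * L * regParam N) + √(2 * L / ν * regParam N) with hρ
  obtain ⟨u, w, huu, hw, hww⟩ := exists_limit_of_cauchy (un := un) (ρ := ρ) hwnm
    (fun N => by positivity) (by simpa using (hlim0 (2 * L)).add (hlim0 (2 * L / ν)))
    (fun N m n hm hn t ht => (hc1 N m n hm hn t ht).trans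
      (le_add_of_nonneg_right (Real.sqrt_nonneg _)))
    (fun N m n hm hn => (hc2 N m n hm hn).trans
      (ENNReal.ofReal_le_ofReal (le_add_of_nonneg_left (Real.sqrt_nonneg _))))
  refine ⟨un, u, w, ?_, hun, hun0, huu, hww⟩
  refine isSol_of_tendsto ha hβ (gn := fun _ => g) (fun _ => memLp_of_continuousOn hg.continuousOn)
    (memLp_of_continuousOn hg.continuousOn) (by simp) hunc huu hwnm hw hww ?_ ?_
  · refine tendsto_eLpNorm_two (fun n =>
      (ι.comp_memLp' (hwnm n)).sub (memLp_of_continuousOn (hunc n))) ?_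
    -- By `smoother_add` the gap between the smoothed and the unsmoothed solution is `l Λ_l u`,
    -- whose Yosida factor is bounded in `L²(τ, T; H)`.
    have hb : ∀ n, (∫ s, ‖((fun s => ι (wn n s)) - un n) s‖ ^ 2 ∂(volume.restrict (Icc τ T)))
        ≤ regParam n * M := by
      intro n
      have hp := regParam_pos n
      have e : ∀ s, ‖((fun s => ι (wn n s)) - un n) s‖ ^ 2
          = regParam n ^ 2 * ‖yosida ι (regParam n) (un n s)‖ ^ 2 := by
        intro s
        have h1 := smoother_add ι hp (un n s)
        have h2 : ((fun s => ι (wn n s)) - un n) s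
            = -(regParam n • yosida ι (regParam n) (un n s)) := by
          change ι (wn n s) - un n s = _
          rw [eq_neg_iff_add_eq_zero, sub_add_eq_add_sub, sub_eq_zero]
          exact h1
        rw [h2, norm_neg, norm_smul, mul_pow, Real.norm_eq_abs, sq_abs]
      simp_rw [e]
      rw [integral_restrict_Icc hτT, intervalIntegral.integral_const_mul]
      have h3 : regParam n ^ 2 ≤ regParam n := by nlinarith [regParam_le_one n]
      exact mul_le_mul h3 (hbd' n).2
        (intervalIntegral.integral_nonneg hτT fun _ _ => by positivity) hp.le
    have h0 : Tendsto (fun n => regParam n * M) atTop (𝓝 0) := by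
      simpa using tendsto_regParam.mul_const M
    exact tendsto_of_tendsto_of_tendsto_of_le_of_le tendsto_const_nhds h0
      (fun n => integral_nonneg fun _ => by positivity) hb
  · intro ψ t ht
    -- The residual of the weak form is the nonlinear term tested against `ψ - J ψ`. It vanishes
    -- because the resolvents converge strongly on `V`.
    have h1 : Tendsto (fun n => (B * √C * M) * ‖ψ - smoother ι (regParam n) (ι ψ)‖) atTop
        (𝓝 0) := by
      have h2 := ((tendsto_smoother ι D.injective ψ).comp tendsto_regParam_right)
      have h3 := ((tendsto_const_nhds (x := ψ)).sub h2).norm.const_mul (B * √C * M)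
      simpa using h3
    refine squeeze_zero_norm (fun n => ?_) h1
    rw [(hun n).weak_form ha hβ hg ψ ht]
    set φ := ψ - smoother ι (regParam n) (ι ψ)
    have hcw : ContinuousOn (fun s => ‖wn n s‖ ^ 2) (Icc τ T) := (hwnc n).norm.pow 2
    have h2 : ‖∫ s in τ..t, β s * b (wn n s) (wn n s) φ‖
        ≤ ∫ s in τ..t, (B * √C * ‖φ‖) * ‖wn n s‖ ^ 2 := by
      refine intervalIntegral.norm_integral_le_of_norm_le ht.1 (ae_of_all _ fun s hs => ?_) ?_
      · rw [norm_mul]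
        have h3 := hB s ⟨hs.1.le, hs.2.trans ht.2⟩
        have h4 : ‖b (wn n s) (wn n s) φ‖ ≤ √C * ‖wn n s‖ * ‖wn n s‖ * ‖φ‖ := D.abs_le _ _ _
        refine (mul_le_mul h3 h4 (norm_nonneg _) hB0).trans (le_of_eq (by ring))
      · exact ((hcw.mono (Icc_subset_Icc_right ht.2)).intervalIntegrable_of_Icc ht.1).const_mul _
    refine h2.trans ?_
    rw [intervalIntegral.integral_const_mul]
    have h5 : (∫ s in τ..t, ‖wn n s‖ ^ 2) ≤ ∫ s in τ..T, ‖wn n s‖ ^ 2 :=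
      intervalIntegral.integral_mono_interval le_rfl ht.1 ht.2
        (ae_of_all _ fun _ => by positivity) (hcw.intervalIntegrable_of_Icc hτT)
    have h6 := mul_le_mul_of_nonneg_left (h5.trans (hbd' n).1)
      (by positivity : 0 ≤ B * √C * ‖φ‖)
    linarith

end

end

section

variable {H V : Type*} [NormedAddCommGroup H] [InnerProductSpace ℝ H] [CompleteSpace H]
  [NormedAddCommGroup V] [InnerProductSpace ℝ V] [CompleteSpace V]

/-! ### The energy identity and uniqueness of weak solutions -/

lemma absolutelyContinuousOnInterval_of_dist_le {f φ : ℝ → ℝ} {p q K : ℝ}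
    (hφ : AbsolutelyContinuousOnInterval φ p q)
    (h : ∀ r ∈ uIcc p q, ∀ s ∈ uIcc p q, dist (f r) (f s) ≤ K * dist (φ r) (φ s)) :
    AbsolutelyContinuousOnInterval f p q := by
  unfold AbsolutelyContinuousOnInterval at hφ ⊢
  refine squeeze_zero' (Eventually.of_forall fun _ => Finset.sum_nonneg fun i hi => dist_nonneg)
    ?_ (by simpa using hφ.const_mul K)
  rw [eventually_inf_principal]
  filter_upwards with E hE
  rw [Finset.mul_sum]
  exact Finset.sum_le_sum fun i hi => h _ (hE.left i hi).1 _ (hE.left i hi).2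

/-- The chain rule for a bounded quadratic form along an indefinite integral. -/
lemma quadratic_integral_eq (S : V →L[ℝ] V) (hS : ∀ v w, ⟪S v, w⟫ = ⟪v, S w⟫) {τ T : ℝ}
    {F y : ℝ → V} (hF : IntegrableOn F (Icc τ T))
    (hy : ∀ t ∈ Icc τ T, y t = y τ + ∫ s in τ..t, F s) {t : ℝ} (ht : t ∈ Icc τ T) :
    ⟪S (y t), y t⟫ = ⟪S (y τ), y τ⟫ + 2 * ∫ s in τ..t, ⟪S (y s), F s⟫ := by
  set Y : ℝ → V := fun t => y τ + ∫ s in τ..t, F s with hY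
  have hFi : ∀ r ∈ Icc τ t, ∀ s ∈ Icc τ t, IntervalIntegrable F volume r s := fun r hr s hs =>
    IntegrableOn.intervalIntegrable (hF.mono_set ((uIcc_subset_Icc hr hs).trans
      (Icc_subset_Icc_right ht.2)))
  have hτt : τ ∈ Icc τ t := left_mem_Icc.2 ht.1
  have htt : t ∈ Icc τ t := right_mem_Icc.2 ht.1
  have hYc : ContinuousOn Y (uIcc τ t) :=
    continuousOn_const.add (intervalIntegral.continuousOn_primitive_interval'
      (hFi τ hτt t htt) left_mem_uIcc)
  obtain ⟨K, hK⟩ := isCompact_uIcc.exists_bound_of_continuousOn hYc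
  have hK0 : 0 ≤ K := (norm_nonneg _).trans (hK τ left_mem_uIcc)
  set Q : ℝ → ℝ := fun t => ⟪S (Y t), Y t⟫ with hQ
  have hsub : ∀ r ∈ Icc τ t, ∀ s ∈ Icc τ t, Y r - Y s = ∫ q in s..r, F q := by
    intro r hr s hs
    simp only [hY, add_sub_add_left_eq_sub]
    exact intervalIntegral.integral_interval_sub_left (hFi τ hτt r hr) (hFi τ hτt s hs)
  -- Increments of `Q` are at most `2 ‖S‖ K` times those of the primitive of `‖F‖`. Absolute
  -- continuity then reduces the identity to the almost everywhere derivative.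
  have hac : AbsolutelyContinuousOnInterval Q τ t := by
    have h1 := (hFi τ hτt t htt).norm.absolutelyContinuousOnInterval_intervalIntegral
      (c := τ) left_mem_uIcc
    refine absolutelyContinuousOnInterval_of_dist_le (K := 2 * ‖S‖ * K) h1 ?_
    intro r hr s hs
    have hr' := hr
    have hs' := hs
    rw [uIcc_of_le ht.1] at hr' hs'
    have e : Q r - Q s = ⟪Y r - Y s, S (Y r)⟫ + ⟪Y r - Y s, S (Y s)⟫ := by
      simp only [hQ, inner_sub_left, hS]
      rw [← hS (Y r) (Y s), real_inner_comm (Y s) (S (Y r))]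
      ring
    have hd : ‖Y r - Y s‖ ≤ dist (∫ q in τ..r, ‖F q‖) (∫ q in τ..s, ‖F q‖) := by
      rw [hsub r hr' s hs', Real.dist_eq,
        intervalIntegral.integral_interval_sub_left (hFi τ hτt r hr').norm
          (hFi τ hτt s hs').norm]
      exact intervalIntegral.norm_integral_le_abs_integral_norm
    have hb : ∀ x ∈ uIcc τ t, |⟪Y r - Y s, S (Y x)⟫| ≤ ‖Y r - Y s‖ * (‖S‖ * K) := fun x hx =>
      (abs_real_inner_le_norm _ _).trans (mul_le_mul_of_nonneg_left
        ((S.le_opNorm _).trans (mul_le_mul_of_nonneg_left (hK x hx) (norm_nonneg _)))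
        (norm_nonneg _))
    rw [Real.dist_eq, e]
    refine (abs_add_le _ _).trans ?_
    have h3 := mul_le_mul_of_nonneg_right hd (by positivity : 0 ≤ ‖S‖ * K)
    linarith [hb r hr, hb s hs]
  have hder : ∀ᵐ x, x ∈ uIcc τ t → HasDerivAt Q (2 * ⟪S (Y x), F x⟫) x := by
    filter_upwards [(hFi τ hτt t htt).ae_hasDerivAt_integral] with x hx hxt
    have h1 : HasDerivAt Y (F x) x := (hx hxt τ left_mem_uIcc).const_add (y τ)
    refine ((S.hasFDerivAt.comp_hasDerivAt x h1).inner ℝ h1).congr_deriv ?_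
    rw [hS (F x), real_inner_comm (S (Y x)) (F x)]
    change ⟪S (Y x), F x⟫ + _ = _
    ring
  have hftc := hac.integral_deriv_eq_sub
  have hcongr : (∫ x in τ..t, deriv Q x) = ∫ x in τ..t, 2 * ⟪S (y x), F x⟫ := by
    refine intervalIntegral.integral_congr_ae ?_
    filter_upwards [hder] with x hx hxt
    have hxt' : x ∈ Icc τ t := by
      have := uIoc_subset_uIcc hxt
      rwa [uIcc_of_le ht.1] at this
    rw [(hx (uIoc_subset_uIcc hxt)).deriv, hy x ⟨hxt'.1, hxt'.2.trans ht.2⟩]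
  rw [hcongr, intervalIntegral.integral_const_mul] at hftc
  have e1 : Q t = ⟪S (y t), y t⟫ := by rw [hy t ht]
  have e2 : Q τ = ⟪S (y τ), y τ⟫ := by simp [hQ, hY]
  rw [e1, e2] at hftc
  linarith

section

variable {ι : V →L[ℝ] H}

lemma adjoint_injective (hι : DenseRange ι) : Function.Injective (adjoint ι) := by
  rw [injective_iff_map_eq_zero]
  intro h hh
  refine hι.eq_zero_of_inner_left (𝕜 := ℝ) ?_
  rintro v
  rw [← ContinuousLinearMap.adjoint_inner_left, hh, inner_zero_left]

/-- The resolvents converge strongly to the identity on `H`. -/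
lemma tendsto_smoother_H (hι : DenseRange ι) (h : H) :
    Tendsto (fun l : ℝ => ι (smoother ι l h)) (𝓝[>] 0) (𝓝 h) := by
  have := tendsto_smoother (adjoint ι) (adjoint_injective hι) h
  refine this.congr' ?_
  filter_upwards [self_mem_nhdsWithin] with l hl
  rw [smoother, ContinuousLinearMap.adjoint_adjoint]
  change ι (yosida (adjoint ι) l (adjoint ι h)) = _
  rw [yosida_adjoint ι hl]

/-- The energy identity. -/
lemma energy_identity (hinj : Function.Injective ι) (hdense : DenseRange ι) {τ T : ℝ}
    {d : ℝ → H} {w F : ℝ → V} (hw : MemLp w 2 (volume.restrict (Icc τ T)))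
    (hF : MemLp F 2 (volume.restrict (Icc τ T)))
    (hwd : ∀ᵐ s ∂(volume.restrict (Icc τ T)), ι (w s) = d s)
    (heq : ∀ ψ : V, ∀ t ∈ Icc τ T, ⟪d t, ι ψ⟫ = ⟪d τ, ι ψ⟫ + ∫ s in τ..t, ⟪F s, ψ⟫)
    {t : ℝ} (ht : t ∈ Icc τ T) :
    ‖d t‖ ^ 2 = ‖d τ‖ ^ 2 + 2 * ∫ s in τ..t, ⟪w s, F s⟫ := by
  have hFint : IntegrableOn F (Icc τ T) := hF.integrable (by norm_num)
  -- Applying `ι†` turns the weak equation into a genuine `V`-valued integral equation with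
  -- integrand `F`, so the chain rule for bounded quadratic forms becomes available.
  have hy : ∀ t ∈ Icc τ T, adjoint ι (d t) = adjoint ι (d τ) + ∫ s in τ..t, F s := by
    intro t ht
    refine ext_inner_right ℝ fun ψ => ?_
    have hi : IntervalIntegrable F volume τ t :=
      IntegrableOn.intervalIntegrable (hFint.mono_set (by
        rw [uIcc_of_le ht.1]; exact Icc_subset_Icc_right ht.2))
    have h1 : ∫ s in τ..t, ⟪F s, ψ⟫ = ⟪∫ s in τ..t, F s, ψ⟫ := by
      have := (innerSL ℝ ψ).intervalIntegral_comp_comm hi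
      simp only [real_inner_comm ψ]
      exact this
    rw [ContinuousLinearMap.adjoint_inner_left, heq ψ t ht, inner_add_left,
      ContinuousLinearMap.adjoint_inner_left, h1]
  -- The bounded form is the Yosida approximation of `adjoint ι`. Since it sends `ι† d` to `J d`,
  -- its value at `ι† d` is `⟪ι J d, d⟫`, which tends to `‖d‖²`.
  have hq : ∀ n, ⟪ι (smoother ι (regParam n) (d t)), d t⟫
      = ⟪ι (smoother ι (regParam n) (d τ)), d τ⟫
        + 2 * ∫ s in τ..t, ⟪smoother ι (regParam n) (d s), F s⟫ := by
    intro n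
    have := quadratic_integral_eq (yosida (adjoint ι) (regParam n))
      (inner_yosida_symm (adjoint ι) (regParam_pos n)) hFint hy ht
    simpa only [yosida_adjoint ι (regParam_pos n),
      ContinuousLinearMap.adjoint_inner_right] using this
  have hl : ∀ r, Tendsto (fun n => ⟪ι (smoother ι (regParam n) (d r)), d r⟫) atTop
      (𝓝 (‖d r‖ ^ 2)) := by
    intro r
    rw [← real_inner_self_eq_norm_sq]
    exact ((tendsto_smoother_H hdense (d r)).comp tendsto_regParam_right).inner
      tendsto_const_nhds
  have hae : ∀ᵐ s, s ∈ uIoc τ t → ι (w s) = d s := by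
    have := (ae_restrict_iff' measurableSet_Icc).1 hwd
    filter_upwards [this] with s hs hst
    rw [uIoc_of_le ht.1] at hst
    exact hs ⟨hst.1.le, hst.2.trans ht.2⟩
  have hle : volume.restrict (Ioc τ t) ≤ volume.restrict (Icc τ T) :=
    Measure.restrict_mono (fun _ (hs : _ ∈ Ioc τ t) => (⟨hs.1.le, hs.2.trans ht.2⟩ : _ ∈ Icc τ T))
      le_rfl
  have hint : Tendsto (fun n => ∫ s in τ..t, ⟪smoother ι (regParam n) (d s), F s⟫) atTop
      (𝓝 (∫ s in τ..t, ⟪w s, F s⟫)) := by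
    -- Almost everywhere `d = ι w`, so the smoothed functions converge to `w` in `V` and are
    -- dominated by `‖w‖`.
    have e : ∀ n, (∫ s in τ..t, ⟪smoother ι (regParam n) (d s), F s⟫)
        = ∫ s in τ..t, ⟪smoother ι (regParam n) (ι (w s)), F s⟫ := by
      intro n
      refine intervalIntegral.integral_congr_ae ?_
      filter_upwards [hae] with s hs hst
      rw [hs hst]
    simp_rw [e]
    refine intervalIntegral.tendsto_integral_filter_of_dominated_convergence
      (fun s => ‖w s‖ * ‖F s‖) (Eventually.of_forall fun n => ?_)
      (Eventually.of_forall fun n => ae_of_all _ fun s _ => ?_) ?_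
      (ae_of_all _ fun s _ => ?_)
    · rw [uIoc_of_le ht.1]
      exact ((smoother ι (regParam n) ∘L ι).continuous.comp_aestronglyMeasurable
        (hw.mono_measure hle).1).inner (hF.mono_measure hle).1
    · exact (norm_inner_le_norm _ _).trans (mul_le_mul_of_nonneg_right
        (norm_smoother_comp_le ι (regParam_pos n) _) (norm_nonneg _))
    · rw [intervalIntegrable_iff_integrableOn_Ioc_of_le ht.1]
      exact ((hw.norm.mono_measure hle).integrable_mul (hF.norm.mono_measure hle))
    · exact ((tendsto_smoother ι hinj (w s)).comp tendsto_regParam_right).inner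
        tendsto_const_nhds
  have h1 := (hl τ).add (hint.const_mul 2)
  exact tendsto_nhds_unique ((hl t).congr hq) h1

end

section

variable {ι : V →L[ℝ] H} {b : V →L[ℝ] V →L[ℝ] V →L[ℝ] ℝ} {C : ℝ}
  {ν : ℝ} {a β : ℝ → ℝ} {τ T : ℝ}

/-- Skew-symmetry moves the derivative onto the test field, leaving two undifferentiated factors
`u`. Boundedness in `H` and square integrability in `V` then place `B(u)` in `L²(V*)`, exactly what
the energy identity needs. -/
lemma IsNSETriple.norm_apply_self_le (D : IsNSETriple ι b C) (u : V) :
    ‖b u u‖ ≤ √C * (‖ι u‖ * ‖u‖) := by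
  refine ContinuousLinearMap.opNorm_le_bound _ (by positivity) fun ψ => ?_
  rw [D.skew u u ψ, norm_neg]
  refine abs_le_of_sq_le_sq ?_ (by positivity)
  refine (D.bound u ψ u).trans (le_of_eq ?_)
  rw [mul_pow, mul_pow, Real.sq_sqrt D.const_nonneg]
  ring

/-- The nonlinear term as an element of `V`, by the Riesz representation. -/
def rieszB (b : V →L[ℝ] V →L[ℝ] V →L[ℝ] ℝ) (u : V) : V :=
  (InnerProductSpace.toDual ℝ V).symm (b u u)

lemma inner_rieszB (u ψ : V) : ⟪rieszB b u, ψ⟫ = b u u ψ := by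
  simp [rieszB]

lemma IsSol.memLp_rieszB (D : IsNSETriple ι b C) {g u : ℝ → H} {w : ℝ → V}
    (hu : IsSol ι b ν a β g τ T u w) :
    MemLp (fun s => rieszB b (w s)) 2 (volume.restrict (Icc τ T)) := by
  obtain ⟨K, hK⟩ := isCompact_Icc.exists_bound_of_continuousOn hu.continuousOn
  have hcont : Continuous (rieszB b) := by unfold rieszB; fun_prop
  refine hu.memLp.of_le_mul (c := √C * K) (hcont.comp_aestronglyMeasurable hu.memLp.1) ?_
  filter_upwards [hu.ae_eq, ae_restrict_mem measurableSet_Icc] with s hs hsI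
  rw [rieszB, LinearIsometryEquiv.norm_map, mul_assoc]
  refine (D.norm_apply_self_le (w s)).trans (mul_le_mul_of_nonneg_left ?_ (Real.sqrt_nonneg _))
  refine mul_le_mul_of_nonneg_right ?_ (norm_nonneg _)
  rw [hs]
  exact hK s hsI

lemma MemLp_weight {E : Type*} [NormedAddCommGroup E] [NormedSpace ℝ E] {c : ℝ → ℝ}
    (hc : Continuous c) {f : ℝ → E} (hf : MemLp f 2 (volume.restrict (Icc τ T))) :
    MemLp (fun s => c s • f s) 2 (volume.restrict (Icc τ T)) :=
  hf.smul (memLp_of_continuousOn hc.continuousOn (p := ∞))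

lemma intervalIntegrable_inner_const {E : Type*} [NormedAddCommGroup E] [InnerProductSpace ℝ E]
    {f : ℝ → E} (hf : MemLp f 2 (volume.restrict (Icc τ T))) (ψ : E) {r t : ℝ}
    (hr : r ∈ Icc τ T) (ht : t ∈ Icc τ T) :
    IntervalIntegrable (fun s => ⟪f s, ψ⟫) volume r t := by
  have h1 : IntegrableOn f (Icc τ T) := hf.integrable (by norm_num)
  have h2 : IntegrableOn (fun s => ⟪f s, ψ⟫) (Icc τ T) := h1.inner_const ψ
  exact IntegrableOn.intervalIntegrable (h2.mono_set (uIcc_subset_Icc hr ht))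

/-- A weak solution satisfies an equation with values in `V` after the Riesz isomorphism. -/
lemma IsSol.equation_riesz (D : IsNSETriple ι b C) (ha : Continuous a) (hβ : Continuous β)
    {g u : ℝ → H} {w : ℝ → V} (hg : MemLp g 2 (volume.restrict (Icc τ T)))
    (hu : IsSol ι b ν a β g τ T u w) (ψ : V) {t : ℝ} (ht : t ∈ Icc τ T) :
    ⟪u t, ι ψ⟫ = ⟪u τ, ι ψ⟫ + ∫ s in τ..t,
      ⟪adjoint ι (g s) - ν • w s - a s • adjoint ι (u s) - β s • rieszB b (w s), ψ⟫ := by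
  have hτ : τ ∈ Icc τ T := ⟨le_rfl, ht.1.trans ht.2⟩
  have hum : MemLp u 2 (volume.restrict (Icc τ T)) := memLp_of_continuousOn hu.continuousOn
  have i1 : IntervalIntegrable (fun s => ⟪adjoint ι (g s), ψ⟫) volume τ t :=
    intervalIntegrable_inner_const ((adjoint ι).comp_memLp' hg) ψ hτ ht
  have i2 : IntervalIntegrable (fun s => ⟪ν • w s, ψ⟫) volume τ t :=
    intervalIntegrable_inner_const (hu.memLp.const_smul ν) ψ hτ ht
  have i3 : IntervalIntegrable (fun s => ⟪a s • adjoint ι (u s), ψ⟫) volume τ t :=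
    intervalIntegrable_inner_const (MemLp_weight ha ((adjoint ι).comp_memLp' hum)) ψ hτ ht
  have i4 : IntervalIntegrable (fun s => ⟪β s • rieszB b (w s), ψ⟫) volume τ t :=
    intervalIntegrable_inner_const (MemLp_weight hβ (hu.memLp_rieszB D)) ψ hτ ht
  have h := hu.equation ψ t ht
  simp only [inner_sub_left]
  rw [intervalIntegral.integral_sub ((i1.sub i2).sub i3) i4,
    intervalIntegral.integral_sub (i1.sub i2) i3, intervalIntegral.integral_sub i1 i2]
  simp only [real_inner_smul_left, inner_rieszB,
    ContinuousLinearMap.adjoint_inner_left, intervalIntegral.integral_const_mul]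
  linarith

/-- Uniqueness of weak solutions. -/
theorem IsNSETriple.isSol_unique (D : IsNSETriple ι b C) (hν : 0 < ν) (ha : Continuous a)
    (hβ : Continuous β) {g u₁ u₂ : ℝ → H} {w₁ w₂ : ℝ → V}
    (hg : MemLp g 2 (volume.restrict (Icc τ T)))
    (h₁ : IsSol ι b ν a β g τ T u₁ w₁) (h₂ : IsSol ι b ν a β g τ T u₂ w₂)
    (h0 : u₁ τ = u₂ τ) : EqOn u₁ u₂ (Icc τ T) := by
  obtain ⟨A, hA⟩ := isCompact_Icc.exists_bound_of_continuousOn (ha.continuousOn (s := Icc τ T))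
  obtain ⟨B, hB⟩ := isCompact_Icc.exists_bound_of_continuousOn (hβ.continuousOn (s := Icc τ T))
  have hC := D.const_nonneg
  set d : ℝ → H := fun s => u₁ s - u₂ s with hd
  set w : ℝ → V := fun s => w₁ s - w₂ s with hw
  set F : ℝ → V := fun s => -(ν • w s) - a s • adjoint ι (d s)
    - β s • (rieszB b (w₁ s) - rieszB b (w₂ s)) with hF
  have hdc : ContinuousOn d (Icc τ T) := h₁.continuousOn.sub h₂.continuousOn
  have hdm : MemLp d 2 (volume.restrict (Icc τ T)) := memLp_of_continuousOn hdc
  have hwm : MemLp w 2 (volume.restrict (Icc τ T)) := h₁.memLp.sub h₂.memLp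
  have hFm : MemLp F 2 (volume.restrict (Icc τ T)) :=
    (((hwm.const_smul ν).neg.sub (MemLp_weight ha ((adjoint ι).comp_memLp' hdm))).sub
      (MemLp_weight hβ ((h₁.memLp_rieszB D).sub (h₂.memLp_rieszB D))))
  have hwd : ∀ᵐ s ∂(volume.restrict (Icc τ T)), ι (w s) = d s := by
    filter_upwards [h₁.ae_eq, h₂.ae_eq] with s h1 h2
    simp only [hw, hd, map_sub, h1, h2]
  have heq : ∀ ψ : V, ∀ t ∈ Icc τ T, ⟪d t, ι ψ⟫ = ⟪d τ, ι ψ⟫ + ∫ s in τ..t, ⟪F s, ψ⟫ := by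
    intro ψ t ht
    have hτ : τ ∈ Icc τ T := ⟨le_rfl, ht.1.trans ht.2⟩
    have hG : ∀ {u w}, IsSol ι b ν a β g τ T u w → IntervalIntegrable (fun s =>
        ⟪adjoint ι (g s) - ν • w s - a s • adjoint ι (u s) - β s • rieszB b (w s), ψ⟫)
        volume τ t := by
      intro u w h
      have hum : MemLp u 2 (volume.restrict (Icc τ T)) := memLp_of_continuousOn h.continuousOn
      exact intervalIntegrable_inner_const (((((adjoint ι).comp_memLp' hg).sub
        (h.memLp.const_smul ν)).sub (MemLp_weight ha ((adjoint ι).comp_memLp' hum))).sub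
        (MemLp_weight hβ (h.memLp_rieszB D))) ψ hτ ht
    have e1 := h₁.equation_riesz D ha hβ hg ψ ht
    have e2 := h₂.equation_riesz D ha hβ hg ψ ht
    have e3 := intervalIntegral.integral_sub (hG h₁) (hG h₂)
    have e4 : ∀ s, ⟪F s, ψ⟫
        = ⟪adjoint ι (g s) - ν • w₁ s - a s • adjoint ι (u₁ s) - β s • rieszB b (w₁ s), ψ⟫
        - ⟪adjoint ι (g s) - ν • w₂ s - a s • adjoint ι (u₂ s) - β s • rieszB b (w₂ s), ψ⟫ := by
      intro s
      rw [← inner_sub_left]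
      congr 1
      simp only [hF, hw, hd, map_sub]
      module
    simp_rw [e4]
    rw [e3]
    have e5 : ∀ r, ⟪d r, ι ψ⟫ = ⟪u₁ r, ι ψ⟫ - ⟪u₂ r, ι ψ⟫ := fun r => inner_sub_left _ _ _
    rw [e5, e5]
    linarith
  have hen : ∀ t ∈ Icc τ T, ‖d t‖ ^ 2 = 2 * ∫ s in τ..t, ⟪w s, F s⟫ := by
    intro t ht
    have := energy_identity D.injective D.denseRange hwm hFm hwd heq ht
    have h0' : d τ = 0 := by simp [hd, h0]
    rw [this, h0']
    simp
  -- A weak solution gives only integrability of `‖w₁‖²`, so this coefficient need not be continuous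
  -- and the integral form of Gronwall's lemma is required.
  set k : ℝ → ℝ := fun s => 2 * |A| + B ^ 2 * C / ν * ‖w₁ s‖ ^ 2 with hk
  have hki : IntegrableOn k (Icc τ T) := by
    have h1 : Integrable (fun s => ‖w₁ s‖ ^ 2) (volume.restrict (Icc τ T)) :=
      h₁.memLp.integrable_norm_pow (by norm_num)
    exact (integrable_const _).add (h1.const_mul _)
  have hpt : ∀ᵐ s ∂(volume.restrict (Icc τ T)), 2 * ⟪w s, F s⟫ ≤ k s * ‖d s‖ ^ 2 := by
    filter_upwards [hwd, ae_restrict_mem measurableSet_Icc] with s hs hsI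
    have e1 : ⟪w s, F s⟫ = -(ν * ‖w s‖ ^ 2) - a s * ‖d s‖ ^ 2
        - β s * b (w s) (w₁ s) (w s) := by
      have e2 : ⟪w s, adjoint ι (d s)⟫ = ‖d s‖ ^ 2 := by
        rw [ContinuousLinearMap.adjoint_inner_right, hs, real_inner_self_eq_norm_sq]
      have e3 : ⟪w s, rieszB b (w₁ s) - rieszB b (w₂ s)⟫ = b (w s) (w₁ s) (w s) := by
        rw [real_inner_comm, inner_sub_left, inner_rieszB, inner_rieszB]
        have e4 : w₁ s = w₂ s + w s := by simp [hw]
        have e5 := D.self_eq_zero (w₂ s) (w s)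
        have e6 := D.self_eq_zero (w s) (w s)
        rw [e4]
        simp only [map_add, add_apply]
        linarith
      simp only [hF]
      rw [inner_sub_right, inner_sub_right, inner_neg_right, real_inner_smul_right,
        real_inner_smul_right, real_inner_smul_right, e2, e3, real_inner_self_eq_norm_sq]
    have e7 : (-2 * β s) * b (w s) (w₁ s) (w s) ≤ ν * ‖w s‖ ^ 2
        + (-2 * β s) ^ 2 * (C * ‖d s‖ ^ 2 * ‖w₁ s‖ ^ 2) / (4 * ν) := by
      refine young_quadratic hν (by positivity) ((D.bound _ _ _).trans (le_of_eq ?_))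
      rw [hs]; ring
    have hβs : β s ^ 2 ≤ B ^ 2 := by
      rw [← sq_abs (β s)]
      exact pow_le_pow_left₀ (abs_nonneg _) (hB s hsI) 2
    have e8 : (-2 * β s) ^ 2 * (C * ‖d s‖ ^ 2 * ‖w₁ s‖ ^ 2) / (4 * ν)
        ≤ B ^ 2 * C / ν * ‖w₁ s‖ ^ 2 * ‖d s‖ ^ 2 := by
      calc (-2 * β s) ^ 2 * (C * ‖d s‖ ^ 2 * ‖w₁ s‖ ^ 2) / (4 * ν)
          = β s ^ 2 * C / ν * ‖w₁ s‖ ^ 2 * ‖d s‖ ^ 2 := by field_simp; ring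
        _ ≤ _ := by gcongr
    have e9 : -2 * a s * ‖d s‖ ^ 2 ≤ 2 * |A| * ‖d s‖ ^ 2 := by
      refine mul_le_mul_of_nonneg_right ?_ (sq_nonneg _)
      have := hA s hsI
      rw [Real.norm_eq_abs] at this
      linarith [neg_le_abs (a s), le_abs_self A]
    have e10 : 0 ≤ ν * ‖w s‖ ^ 2 := by positivity
    rw [e1]
    simp only [hk]
    linarith
  have hzero := eq_zero_of_le_integral_mul (x := fun s => ‖d s‖ ^ 2) (k := k) (hdc.norm.pow 2)
    (fun _ _ => by positivity) hki (fun _ _ => by positivity) ?_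
  · intro t ht
    have h1 := hzero t ht
    have h2 : d t = 0 := by simpa using h1
    exact sub_eq_zero.1 h2
  · intro t ht
    rw [hen t ht, ← intervalIntegral.integral_const_mul]
    have hle : volume.restrict (Ioc τ t) ≤ volume.restrict (Icc τ T) :=
      Measure.restrict_mono
        (fun _ (hs : _ ∈ Ioc τ t) => (⟨hs.1.le, hs.2.trans ht.2⟩ : _ ∈ Icc τ T)) le_rfl
    rw [intervalIntegral.integral_of_le ht.1, intervalIntegral.integral_of_le ht.1]
    refine integral_mono_ae ?_ ?_ (hle.absolutelyContinuous.ae_le hpt)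
    · have h1 : Integrable (fun s => ⟪w s, F s⟫) (volume.restrict (Icc τ T)) := by
        refine (hwm.norm.integrable_mul hFm.norm).mono' (hwm.1.inner hFm.1)
          (ae_of_all _ fun s => norm_inner_le_norm _ _)
      exact (h1.const_mul 2).mono_measure hle
    · exact Integrable.mono_measure (hki.mul_continuousOn (hdc.norm.pow 2) isCompact_Icc) hle

end

end

section

/-! ### Solutions with rough data -/

lemma integral_sq_le_of_tendsto {X E : Type*} [MeasurableSpace X] {μ : Measure X}
    [NormedAddCommGroup E] {f : ℕ → X → E} {f' : X → E} (hf : ∀ n, MemLp (f n) 2 μ)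
    (hf' : MemLp f' 2 μ) (hff : Tendsto (fun n => eLpNorm (f n - f') 2 μ) atTop (𝓝 0)) {c : ℝ}
    (hc : ∀ n, ∫ x, ‖f n x‖ ^ 2 ∂μ ≤ c) : ∫ x, ‖f' x‖ ^ 2 ∂μ ≤ c := by
  have hc0 : 0 ≤ c := (integral_nonneg fun _ => by positivity).trans (hc 0)
  have h1 : ∀ n, eLpNorm f' 2 μ ≤ eLpNorm (f n - f') 2 μ + ENNReal.ofReal (√c) := by
    intro n
    have e : f' = -(f n - f') + f n := by simp
    conv_lhs => rw [e]
    refine (eLpNorm_add_le ((hf n).sub hf').1.neg (hf n).1 (by norm_num)).trans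
      (add_le_add (by rw [eLpNorm_neg]) ?_)
    exact eLpNorm_two_le (hf n) (Real.sqrt_nonneg _) (by rw [Real.sq_sqrt hc0]; exact hc n)
  have h2 : eLpNorm f' 2 μ ≤ ENNReal.ofReal (√c) := by
    have h4 : Tendsto (fun n => eLpNorm (f n - f') 2 μ + ENNReal.ofReal (√c)) atTop
        (𝓝 (ENNReal.ofReal (√c))) := by
      simpa using hff.add tendsto_const_nhds
    exact ge_of_tendsto' h4 h1
  have h3 := pow_le_pow_left' h2 2
  rw [sq_eLpNorm_two hf', ← ENNReal.ofReal_pow (Real.sqrt_nonneg _), Real.sq_sqrt hc0] at h3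
  exact (ENNReal.ofReal_le_ofReal_iff hc0).1 h3

lemma integral_sq_le_of_eLpNorm {X E : Type*} [MeasurableSpace X] {μ : Measure X}
    [NormedAddCommGroup E] {f : X → E} (hf : MemLp f 2 μ) {c : ℝ} (hc : 0 ≤ c)
    (h : eLpNorm f 2 μ ≤ ENNReal.ofReal c) : ∫ x, ‖f x‖ ^ 2 ∂μ ≤ c ^ 2 := by
  have h3 := pow_le_pow_left' h 2
  rw [sq_eLpNorm_two hf, ← ENNReal.ofReal_pow hc] at h3
  exact (ENNReal.ofReal_le_ofReal_iff (by positivity)).1 h3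

variable {H V : Type*} [NormedAddCommGroup H] [InnerProductSpace ℝ H] [CompleteSpace H]
  [NormedAddCommGroup V] [InnerProductSpace ℝ V] [CompleteSpace V]
  {ι : V →L[ℝ] H} {b : V →L[ℝ] V →L[ℝ] V →L[ℝ] ℝ} {C : ℝ}
  {ν : ℝ} {a β : ℝ → ℝ} {τ T A B : ℝ}

lemma IsRegLimit.memLp_smoother {g : ℝ → H} {v₀ : V} {un : ℕ → ℝ → H} {u : ℝ → H} {w : ℝ → V}
    (h : IsRegLimit ι b ν a β g τ T v₀ un u w) (n : ℕ) :
    MemLp (fun s => smoother ι (regParam n) (un n s)) 2 (volume.restrict (Icc τ T)) :=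
  (smoother ι (regParam n)).comp_memLp' (memLp_of_continuousOn (h.regSol n).continuousOn)

lemma IsRegLimit.initial_eq {g : ℝ → H} {v₀ : V} {un : ℕ → ℝ → H} {u : ℝ → H} {w : ℝ → V}
    (h : IsRegLimit ι b ν a β g τ T v₀ un u w) (hτT : τ ≤ T) : u τ = ι v₀ := by
  have h1 := h.tendsto.tendsto_at (left_mem_Icc.2 hτT)
  simp only [h.initial] at h1
  exact tendsto_nhds_unique h1 tendsto_const_nhds

/-- For each `n` both approximations use the same parameter `regParam n`, so the uniform estimate
applies to the pair and passes to the limit, pointwise in `H` and in `L²(τ, T; V)`. -/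
lemma IsNSETriple.regLimit_lipschitz_H (D : IsNSETriple ι b C) (hν : 0 < ν)
    (hτT : τ ≤ T) (hA : ∀ t ∈ Icc τ T, |a t| ≤ A) (hB : ∀ t ∈ Icc τ T, |β t| ≤ B) (M : ℝ) :
    ∃ L : ℝ, 0 ≤ L ∧ ∀ (g h : ℝ → H) (v₀ v₁ : V) un u w vn v x, Continuous g → Continuous h →
      IsRegLimit ι b ν a β g τ T v₀ un u w → IsRegLimit ι b ν a β h τ T v₁ vn v x →
      ‖ι v₁‖ ^ 2 ≤ M → (∫ r in τ..T, ‖h r‖ ^ 2) ≤ M →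
      (∀ t ∈ Icc τ T, ‖u t - v t‖ ^ 2
        ≤ L * (‖ι v₀ - ι v₁‖ ^ 2 + ∫ r in τ..T, ‖g r - h r‖ ^ 2)) ∧
      ν * (∫ r in τ..T, ‖w r - x r‖ ^ 2)
        ≤ L * (‖ι v₀ - ι v₁‖ ^ 2 + ∫ r in τ..T, ‖g r - h r‖ ^ 2) := by
  obtain ⟨L, hL, hlip⟩ := D.regSol_lipschitz_H hν hA hB M
  refine ⟨L, hL, fun g h v₀ v₁ un u w vn v x hg hh hu hv hvs hhM => ?_⟩
  set R := ‖ι v₀ - ι v₁‖ ^ 2 + ∫ r in τ..T, ‖g r - h r‖ ^ 2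
  have key : ∀ n, ∀ t ∈ Icc τ T, ‖un n t - vn n t‖ ^ 2
      + ∫ r in τ..t, ν * ‖smoother ι (regParam n) (un n r - vn n r)‖ ^ 2 ≤ L * R := by
    intro n t ht
    have h1 := hlip τ (left_mem_Icc.2 hτT) _ (regParam_pos n) g h (un n) (vn n) hg hh (hu.regSol n)
      (hv.regSol n) (by rw [hv.initial]; exact hvs) hhM t ht
    rwa [hu.initial, hv.initial] at h1
  refine ⟨fun t ht => ?_, ?_⟩
  · refine le_of_tendsto' (((hu.tendsto.tendsto_at ht).sub (hv.tendsto.tendsto_at ht)).norm.pow 2)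
      fun n => ?_
    have h2 : 0 ≤ ∫ r in τ..t, ν * ‖smoother ι (regParam n) (un n r - vn n r)‖ ^ 2 :=
      intervalIntegral.integral_nonneg ht.1 fun _ _ => by positivity
    linarith [key n t ht]
  · rw [mul_comm, ← le_div_iff₀ hν, ← integral_restrict_Icc hτT]
    refine integral_sq_le_of_tendsto (f := fun n s => smoother ι (regParam n) (un n s)
      - smoother ι (regParam n) (vn n s)) (fun n => (hu.memLp_smoother n).sub (hv.memLp_smoother n))
      (hu.isSol.memLp.sub hv.isSol.memLp) ?_ fun n => ?_
    · have h3 : Tendsto (fun n => eLpNorm ((fun s => smoother ι (regParam n) (un n s)) - w) 2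
          (volume.restrict (Icc τ T)) + eLpNorm ((fun s => smoother ι (regParam n) (vn n s)) - x) 2
          (volume.restrict (Icc τ T))) atTop (𝓝 0) := by
        simpa using hu.tendsto_V.add hv.tendsto_V
      refine tendsto_of_tendsto_of_tendsto_of_le_of_le tendsto_const_nhds h3 (fun _ => zero_le)
        fun n => ?_
      refine le_trans (le_of_eq ?_) (eLpNorm_sub_le ((hu.memLp_smoother n).sub hu.isSol.memLp).1
        ((hv.memLp_smoother n).sub hv.isSol.memLp).1 (by norm_num))
      congr 1
      funext s
      simp only [Pi.sub_apply]
      abel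
    · rw [integral_restrict_Icc hτT, le_div_iff₀ hν]
      have h4 := key n T (right_mem_Icc.2 hτT)
      rw [intervalIntegral.integral_const_mul] at h4
      simp only [map_sub] at h4
      linarith [sq_nonneg ‖un n T - vn n T‖]

/-- Smooth data approximating `(u₀, g)` at a fixed rate. -/
structure IsDataApprox (ι : V →L[ℝ] H) (g : ℝ → H) (τ T : ℝ) (u₀ : H) (gn : ℕ → ℝ → H)
    (vn : ℕ → V) : Prop where
  continuous : ∀ n, Continuous (gn n)
  eLpNorm_le : ∀ n, eLpNorm (gn n - g) 2 (volume.restrict (Icc τ T))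
    ≤ ENNReal.ofReal (regParam n)
  norm_le : ∀ n, ‖ι (vn n) - u₀‖ ≤ regParam n

lemma exists_continuous_approx {E : Type*} [NormedAddCommGroup E] [NormedSpace ℝ E] {g : ℝ → E}
    (hg : MemLp g 2 (volume.restrict (Icc τ T))) :
    ∃ gn : ℕ → ℝ → E, (∀ n, Continuous (gn n)) ∧
      ∀ n, eLpNorm (gn n - g) 2 (volume.restrict (Icc τ T)) ≤ ENNReal.ofReal (regParam n) := by
  have : ∀ n, ∃ h : ℝ → E, Continuous h ∧
      eLpNorm (h - g) 2 (volume.restrict (Icc τ T)) ≤ ENNReal.ofReal (regParam n) := by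
    intro n
    obtain ⟨h, h1, -⟩ := hg.exists_boundedContinuous_eLpNorm_sub_le (by norm_num)
      (ε := ENNReal.ofReal (regParam n)) (by simpa using regParam_pos n)
    exact ⟨h, h.continuous, by rwa [eLpNorm_sub_comm]⟩
  choose gn h1 h2 using this
  exact ⟨gn, h1, h2⟩

lemma exists_dense_approx (hι : DenseRange ι) (u₀ : H) :
    ∃ vn : ℕ → V, ∀ n, ‖ι (vn n) - u₀‖ ≤ regParam n := by
  have : ∀ n, ∃ v, ‖ι v - u₀‖ ≤ regParam n := by
    intro n
    obtain ⟨v, hv⟩ := hι.exists_dist_lt u₀ (regParam_pos n)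
    rw [dist_comm, dist_eq_norm] at hv
    exact ⟨v, hv.le⟩
  choose vn h using this
  exact ⟨vn, h⟩

section Approx

variable {g : ℝ → H} {u₀ : H} {gn : ℕ → ℝ → H} {vn : ℕ → V}

lemma IsDataApprox.memLp (h : IsDataApprox ι g τ T u₀ gn vn) (n : ℕ) :
    MemLp (gn n) 2 (volume.restrict (Icc τ T)) :=
  memLp_of_continuousOn (h.continuous n).continuousOn

lemma integral_sq_approx_le {g h : ℝ → H} (hh : MemLp h 2 (volume.restrict (Icc τ T)))
    (hg : MemLp g 2 (volume.restrict (Icc τ T))) (hτT : τ ≤ T) {c : ℝ} (hc : 0 ≤ c)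
    (hgh : eLpNorm (h - g) 2 (volume.restrict (Icc τ T)) ≤ ENNReal.ofReal c) :
    ∫ r in τ..T, ‖h r‖ ^ 2
      ≤ (c + (eLpNorm g 2 (volume.restrict (Icc τ T))).toReal) ^ 2 := by
  rw [← integral_restrict_Icc hτT]
  refine integral_sq_le_of_eLpNorm hh (by positivity) ?_
  rw [ENNReal.ofReal_add hc ENNReal.toReal_nonneg, ENNReal.ofReal_toReal hg.2.ne]
  have h1 := eLpNorm_add_le (hh.sub hg).1 hg.1 (p := 2) (by norm_num)
  rw [sub_add_cancel] at h1
  exact h1.trans (add_le_add hgh le_rfl)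

lemma IsDataApprox.integral_sub_sq_le (h : IsDataApprox ι g τ T u₀ gn vn)
    (hg : MemLp g 2 (volume.restrict (Icc τ T))) (hτT : τ ≤ T) {N m n : ℕ} (hm : N ≤ m)
    (hn : N ≤ n) : ∫ r in τ..T, ‖gn m r - gn n r‖ ^ 2 ≤ (2 * regParam N) ^ 2 := by
  have hp := regParam_pos N
  rw [← integral_restrict_Icc hτT]
  refine integral_sq_le_of_eLpNorm (f := gn m - gn n) ((h.memLp m).sub (h.memLp n))
    (by positivity) ?_
  have e : gn m - gn n = (gn m - g) - (gn n - g) := by abel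
  rw [e, two_mul, ENNReal.ofReal_add hp.le hp.le]
  refine (eLpNorm_sub_le ((h.memLp m).sub hg).1 ((h.memLp n).sub hg).1 (by norm_num)).trans
    (add_le_add ?_ ?_)
  · exact (h.eLpNorm_le m).trans (ENNReal.ofReal_le_ofReal (regParam_anti hm))
  · exact (h.eLpNorm_le n).trans (ENNReal.ofReal_le_ofReal (regParam_anti hn))

/-- Solutions with smooth data converge to a solution as the data converge. -/
lemma IsNSETriple.exists_isSol_of_approx (D : IsNSETriple ι b C) (hν : 0 < ν) (ha : Continuous a)
    (hβ : Continuous β) (hτT : τ ≤ T) (hg : MemLp g 2 (volume.restrict (Icc τ T)))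
    (hd : IsDataApprox ι g τ T u₀ gn vn) {unn : ℕ → ℕ → ℝ → H} {un : ℕ → ℝ → H}
    {wn : ℕ → ℝ → V} (hs : ∀ n, IsRegLimit ι b ν a β (gn n) τ T (vn n) (unn n) (un n) (wn n)) :
    ∃ u w, IsSol ι b ν a β g τ T u w ∧ u τ = u₀ ∧ TendstoUniformlyOn un u atTop (Icc τ T) ∧
      Tendsto (fun n => eLpNorm (wn n - w) 2 (volume.restrict (Icc τ T))) atTop (𝓝 0) := by
  obtain ⟨A, hA⟩ := isCompact_Icc.exists_bound_of_continuousOn (ha.continuousOn (s := Icc τ T))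
  obtain ⟨B, hB⟩ := isCompact_Icc.exists_bound_of_continuousOn (hβ.continuousOn (s := Icc τ T))
  set G := (eLpNorm g 2 (volume.restrict (Icc τ T))).toReal with hG
  have hG0 : 0 ≤ G := ENNReal.toReal_nonneg
  obtain ⟨L, hL, hlip⟩ := D.regLimit_lipschitz_H hν hτT hA hB (max ((1 + ‖u₀‖) ^ 2) ((1 + G) ^ 2))
  have hvb : ∀ n, ‖ι (vn n)‖ ^ 2 ≤ (1 + ‖u₀‖) ^ 2 := by
    intro n
    refine pow_le_pow_left₀ (norm_nonneg _) ?_ 2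
    have h1 := norm_add_le (ι (vn n) - u₀) u₀
    rw [sub_add_cancel] at h1
    linarith [hd.norm_le n, regParam_le_one n]
  have hgb : ∀ n, (∫ r in τ..T, ‖gn n r‖ ^ 2) ≤ (1 + G) ^ 2 := fun n =>
    integral_sq_approx_le (hd.memLp n) hg hτT zero_le_one ((hd.eLpNorm_le n).trans
      (ENNReal.ofReal_le_ofReal (regParam_le_one n)))
  -- Initial values and forces each differ by at most `2 * regParam N`; the two squares add up to `8
  -- * regParam N ^ 2`.
  have key : ∀ N m n, N ≤ m → N ≤ n → (∀ t ∈ Icc τ T, ‖un m t - un n t‖ ^ 2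
      ≤ L * 8 * regParam N ^ 2) ∧ ν * (∫ r in τ..T, ‖wn m r - wn n r‖ ^ 2)
      ≤ L * 8 * regParam N ^ 2 := by
    intro N m n hm hn
    have h1 := hlip _ _ _ _ _ _ _ _ _ _ (hd.continuous m) (hd.continuous n) (hs m) (hs n)
      ((hvb n).trans (le_max_left _ _)) ((hgb n).trans (le_max_right _ _))
    have h2 := hd.integral_sub_sq_le hg hτT hm hn
    have h3 : ‖ι (vn m) - ι (vn n)‖ ^ 2 ≤ (2 * regParam N) ^ 2 := by
      refine pow_le_pow_left₀ (norm_nonneg _) ?_ 2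
      have e : ι (vn m) - ι (vn n) = (ι (vn m) - u₀) - (ι (vn n) - u₀) := by abel
      rw [e]
      refine (norm_sub_le _ _).trans ?_
      linarith [hd.norm_le m, hd.norm_le n, regParam_anti hm, regParam_anti hn]
    have h4 : L * (‖ι (vn m) - ι (vn n)‖ ^ 2 + ∫ r in τ..T, ‖gn m r - gn n r‖ ^ 2)
        ≤ L * 8 * regParam N ^ 2 := by
      rw [mul_assoc]
      exact mul_le_mul_of_nonneg_left (by linarith) hL
    exact ⟨fun t ht => (h1.1 t ht).trans h4, h1.2.trans h4⟩
  set ρ : ℕ → ℝ := fun N => √(L * 8 * regParam N ^ 2) + √(L * 8 * regParam N ^ 2 / ν) with hρ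
  have hρ0 : ∀ N, 0 ≤ ρ N := fun N => by positivity
  have hρt : Tendsto ρ atTop (𝓝 0) := by
    have h1 := ((tendsto_regParam.pow 2).const_mul (L * 8))
    have h2 := h1.sqrt.add (h1.div_const ν).sqrt
    simpa using h2
  have hcu : ∀ N m n, N ≤ m → N ≤ n → ∀ t ∈ Icc τ T, dist (un m t) (un n t) ≤ ρ N := by
    intro N m n hm hn t ht
    rw [dist_eq_norm]
    have h1 := Real.le_sqrt_of_sq_le ((key N m n hm hn).1 t ht)
    exact h1.trans (le_add_of_nonneg_right (Real.sqrt_nonneg _))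
  have hcw : ∀ N m n, N ≤ m → N ≤ n →
      eLpNorm (wn m - wn n) 2 (volume.restrict (Icc τ T)) ≤ ENNReal.ofReal (ρ N) := by
    intro N m n hm hn
    refine (eLpNorm_two_le ((hs m).isSol.memLp.sub (hs n).isSol.memLp) (Real.sqrt_nonneg _)
      ?_).trans (ENNReal.ofReal_le_ofReal (le_add_of_nonneg_left (Real.sqrt_nonneg _)))
    rw [Real.sq_sqrt (by positivity), integral_restrict_Icc hτT, le_div_iff₀ hν, mul_comm]
    exact (key N m n hm hn).2
  obtain ⟨u, w, huu, hw, hww⟩ := exists_limit_of_cauchy (un := un) (wn := wn)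
    (fun n => (hs n).isSol.memLp) hρ0 hρt hcu hcw
  · have hgg : Tendsto (fun n => eLpNorm (gn n - g) 2 (volume.restrict (Icc τ T))) atTop (𝓝 0) := by
      refine tendsto_of_tendsto_of_tendsto_of_le_of_le tendsto_const_nhds ?_ (fun _ => zero_le)
        hd.eLpNorm_le
      simpa using ENNReal.tendsto_ofReal tendsto_regParam
    refine ⟨u, w, isSol_of_tendsto ha hβ hd.memLp hg hgg (fun n => (hs n).isSol.continuousOn) huu
      (fun n => (hs n).isSol.memLp) hw hww ?_ ?_, ?_, huu, hww⟩
    -- The approximating functions are exact weak solutions, so this discrepancy and the residual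
    -- below are zero for every `n`.
    · refine tendsto_const_nhds.congr fun n => Eq.symm ?_
      rw [eLpNorm_congr_ae (g := 0)]
      · simp
      · filter_upwards [(hs n).isSol.ae_eq] with s hsn
        simp [hsn]
    · intro ψ t ht
      refine tendsto_const_nhds.congr fun n => Eq.symm ?_
      rw [(hs n).isSol.equation ψ t ht, sub_self]
    · have h1 := huu.tendsto_at (left_mem_Icc.2 hτT)
      simp only [fun n => (hs n).initial_eq hτT] at h1
      refine tendsto_nhds_unique h1 ?_
      rw [tendsto_iff_norm_sub_tendsto_zero]
      exact squeeze_zero (fun _ => norm_nonneg _) hd.norm_le tendsto_regParam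

/-- Every weak solution is a limit of solutions with given approximating data. -/
lemma IsNSETriple.isSol_tendsto (D : IsNSETriple ι b C) (hν : 0 < ν) (ha : Continuous a)
    (hβ : Continuous β) (hτT : τ ≤ T) (hg : MemLp g 2 (volume.restrict (Icc τ T)))
    (hd : IsDataApprox ι g τ T u₀ gn vn) {unn : ℕ → ℕ → ℝ → H} {un : ℕ → ℝ → H}
    {wn : ℕ → ℝ → V} (hs : ∀ n, IsRegLimit ι b ν a β (gn n) τ T (vn n) (unn n) (un n) (wn n))
    {u : ℝ → H} {w : ℝ → V} (hu : IsSol ι b ν a β g τ T u w) (hu0 : u τ = u₀) :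
    (∀ t ∈ Icc τ T, Tendsto (fun n => un n t) atTop (𝓝 (u t))) ∧
      Tendsto (fun n => eLpNorm (wn n - w) 2 (volume.restrict (Icc τ T))) atTop (𝓝 0) := by
  obtain ⟨u', w', hu', hu0', h1, h2⟩ := D.exists_isSol_of_approx hν ha hβ hτT hg hd hs
  have heq := D.isSol_unique hν ha hβ hg hu' hu (hu0'.trans hu0.symm)
  have hww : w' =ᵐ[volume.restrict (Icc τ T)] w := by
    filter_upwards [hu'.ae_eq, hu.ae_eq, ae_restrict_mem measurableSet_Icc] with s e1 e2 hsI
    exact D.injective (e1.trans ((heq hsI).trans e2.symm))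
  refine ⟨fun t ht => ?_, h2.congr fun n => eLpNorm_congr_ae ((ae_eq_refl _).sub hww)⟩
  have := h1.tendsto_at ht
  rwa [heq ht] at this

/-- Existence of weak solutions. -/
theorem IsNSETriple.exists_isSol (D : IsNSETriple ι b C) (hν : 0 < ν) (ha : Continuous a)
    (hβ : Continuous β) (hτT : τ ≤ T) (hg : MemLp g 2 (volume.restrict (Icc τ T))) (u₀ : H) :
    ∃ u w, IsSol ι b ν a β g τ T u w ∧ u τ = u₀ := by
  obtain ⟨gn, h1, h2⟩ := exists_continuous_approx hg
  obtain ⟨vn, h3⟩ := exists_dense_approx D.denseRange u₀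
  choose unn un wn hs using fun n => D.exists_regLimit hν ha hβ hτT (h1 n) (vn n)
  obtain ⟨u, w, hu, hu0, -⟩ := D.exists_isSol_of_approx hν ha hβ hτT hg ⟨h1, h2, h3⟩ hs
  exact ⟨u, w, hu, hu0⟩

end Approx

end

section

/-! ### Smoothing and continuous dependence -/

variable {H V : Type*} [NormedAddCommGroup H] [InnerProductSpace ℝ H] [CompleteSpace H]
  [NormedAddCommGroup V] [InnerProductSpace ℝ V] [CompleteSpace V]
  {ι : V →L[ℝ] H} {b : V →L[ℝ] V →L[ℝ] V →L[ℝ] ℝ} {C : ℝ}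
  {ν : ℝ} {a β : ℝ → ℝ} {τ T : ℝ}

/-- A weak solution may be restarted at a later time. -/
lemma IsSol.restart (D : IsNSETriple ι b C) (ha : Continuous a) (hβ : Continuous β)
    {g u : ℝ → H} {w : ℝ → V} (hg : MemLp g 2 (volume.restrict (Icc τ T)))
    (hu : IsSol ι b ν a β g τ T u w) {s : ℝ} (hs : s ∈ Icc τ T) :
    IsSol ι b ν a β g s T u w := by
  have hsub : Icc s T ⊆ Icc τ T := Icc_subset_Icc_left hs.1
  have hle : volume.restrict (Icc s T) ≤ volume.restrict (Icc τ T) :=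
    Measure.restrict_mono hsub le_rfl
  refine ⟨hu.continuousOn.mono hsub, hu.memLp.mono_measure hle,
    hle.absolutelyContinuous.ae_le hu.ae_eq, fun ψ t ht => ?_⟩
  have htI := hsub ht
  have hτ : τ ∈ Icc τ T := ⟨le_rfl, hs.1.trans hs.2⟩
  have hum : MemLp u 2 (volume.restrict (Icc τ T)) := memLp_of_continuousOn hu.continuousOn
  have i1 : ∀ r ∈ Icc τ T, IntervalIntegrable (fun s => ⟪g s, ι ψ⟫) volume τ r := fun r hr =>
    intervalIntegrable_inner_const hg _ hτ hr
  have i2 : ∀ r ∈ Icc τ T, IntervalIntegrable (fun s => ⟪w s, ψ⟫) volume τ r := fun r hr =>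
    intervalIntegrable_inner_const hu.memLp _ hτ hr
  have i3 : ∀ r ∈ Icc τ T, IntervalIntegrable (fun s => a s * ⟪u s, ι ψ⟫) volume τ r :=
    fun r hr => by
      simpa only [real_inner_smul_left] using
        intervalIntegrable_inner_const (MemLp_weight ha hum) (ι ψ) hτ hr
  have i4 : ∀ r ∈ Icc τ T, IntervalIntegrable (fun s => β s * b (w s) (w s) ψ) volume τ r :=
    fun r hr => by
      simpa only [real_inner_smul_left, inner_rieszB] using
        intervalIntegrable_inner_const (MemLp_weight hβ (hu.memLp_rieszB D)) ψ hτ hr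
  have e1 := intervalIntegral.integral_interval_sub_left (i1 t htI) (i1 s hs)
  have e2 := intervalIntegral.integral_interval_sub_left (i2 t htI) (i2 s hs)
  have e3 := intervalIntegral.integral_interval_sub_left (i3 t htI) (i3 s hs)
  have e4 := intervalIntegral.integral_interval_sub_left (i4 t htI) (i4 s hs)
  have e5 := hu.equation ψ t htI
  have e6 := hu.equation ψ s hs
  rw [← e1, ← e2, ← e3, ← e4]
  linear_combination e5 - e6

lemma IsSol.mono_right {g u : ℝ → H} {w : ℝ → V} (hu : IsSol ι b ν a β g τ T u w) {T' : ℝ}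
    (hT : T' ≤ T) : IsSol ι b ν a β g τ T' u w := by
  have hsub : Icc τ T' ⊆ Icc τ T := Icc_subset_Icc_right hT
  have hle : volume.restrict (Icc τ T') ≤ volume.restrict (Icc τ T) :=
    Measure.restrict_mono hsub le_rfl
  exact ⟨hu.continuousOn.mono hsub, hu.memLp.mono_measure hle,
    hle.absolutelyContinuous.ae_le hu.ae_eq, fun ψ t ht => hu.equation ψ t (hsub ht)⟩

lemma tendsto_smoother_seq (hι : DenseRange ι) {x : ℕ → H} {y : H}
    (hx : Tendsto x atTop (𝓝 y)) :
    Tendsto (fun n => ι (smoother ι (regParam n) (x n))) atTop (𝓝 y) := by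
  have h1 := (tendsto_smoother_H hι y).comp tendsto_regParam_right
  have h2 : Tendsto (fun n => ι (smoother ι (regParam n) (x n - y))) atTop (𝓝 0) :=
    squeeze_zero_norm (fun n => norm_smoother_le ι (regParam_pos n) _)
      (tendsto_iff_norm_sub_tendsto_zero.1 hx)
  have h3 := h1.add h2
  rw [add_zero] at h3
  refine h3.congr fun n => ?_
  simp [map_sub]

/-- Solutions with data in `V` stay in `V` and depend on the data in a locally Lipschitz way,
uniformly in the initial time. -/
lemma IsNSETriple.isSol_lipschitz_V (D : IsNSETriple ι b C) (hν : 0 < ν) (ha : Continuous a)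
    (hβ : Continuous β) {g : ℝ → H} (hg : MemLp g 2 (volume.restrict (Icc τ T))) (M : ℝ) :
    ∃ L : ℝ, 0 ≤ L ∧ ∀ s ∈ Icc τ T, ∀ (v₁ v₂ : V) u₁ w₁ u₂ w₂,
      IsSol ι b ν a β g s T u₁ w₁ → IsSol ι b ν a β g s T u₂ w₂ → u₁ s = ι v₁ → u₂ s = ι v₂ →
      ‖v₁‖ ^ 2 ≤ M → ‖v₂‖ ^ 2 ≤ M → ∃ y₁ y₂ : V, ι y₁ = u₁ T ∧ ι y₂ = u₂ T ∧
        ‖y₁ - y₂‖ ≤ L * ‖v₁ - v₂‖ := by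
  obtain ⟨A, hA⟩ := isCompact_Icc.exists_bound_of_continuousOn (ha.continuousOn (s := Icc τ T))
  obtain ⟨B, hB⟩ := isCompact_Icc.exists_bound_of_continuousOn (hβ.continuousOn (s := Icc τ T))
  set G := (eLpNorm g 2 (volume.restrict (Icc τ T))).toReal with hG
  set M' := max M ((1 + G) ^ 2) with hM'
  obtain ⟨K, hK, hbd⟩ := D.regSol_enstrophy_bound hν hA hB M'
  obtain ⟨L, hL, hlip⟩ := D.regSol_lipschitz_V hν hA hB M'
  refine ⟨√L, Real.sqrt_nonneg _, fun s hs v₁ v₂ u₁ w₁ u₂ w₂ h₁ h₂ hi₁ hi₂ hv₁ hv₂ => ?_⟩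
  have hsub : Icc s T ⊆ Icc τ T := Icc_subset_Icc_left hs.1
  have hle : volume.restrict (Icc s T) ≤ volume.restrict (Icc τ T) :=
    Measure.restrict_mono hsub le_rfl
  have hgs : MemLp g 2 (volume.restrict (Icc s T)) := hg.mono_measure hle
  have hT : T ∈ Icc s T := right_mem_Icc.2 hs.2
  obtain ⟨gn, hgn, hgn'⟩ := exists_continuous_approx hgs
  have hgb : ∀ k, (∫ r in s..T, ‖gn k r‖ ^ 2) ≤ M' := by
    intro k
    refine (integral_sq_approx_le (memLp_of_continuousOn (hgn k).continuousOn) hgs hs.2 zero_le_one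
      ((hgn' k).trans (ENNReal.ofReal_le_ofReal (regParam_le_one k)))).trans
      (le_trans ?_ (le_max_right _ _))
    have h1 : (eLpNorm g 2 (volume.restrict (Icc s T))).toReal ≤ G :=
      ENNReal.toReal_mono hg.2.ne (eLpNorm_mono_measure _ hle)
    gcongr
  -- The initial value already lies in `V`, so only the force is approximated. Using the same forces
  -- for both solutions is what permits the `V` Lipschitz estimate.
  have hd : ∀ v : V, IsDataApprox ι g s T (ι v) gn (fun _ => v) := fun v =>
    ⟨hgn, hgn', fun n => by simpa using (regParam_pos n).le⟩
  have hιv : ∀ {v : V}, ‖v‖ ^ 2 ≤ M → ‖ι v‖ ^ 2 ≤ M' := fun hv =>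
    (pow_le_pow_left₀ (norm_nonneg _) (D.norm_le _) 2).trans (hv.trans (le_max_left _ _))
  have hPv : ∀ {v : V}, ‖v‖ ^ 2 ≤ M → ∀ n, ⟪yosida ι (regParam n) (ι v), ι v⟫ ≤ M' :=
    fun hv n => (inner_yosida_le ι (regParam_pos n) _).trans (hv.trans (le_max_left _ _))
  have hreg : ∀ (v : V) (u : ℝ → H) w, IsSol ι b ν a β g s T u w → u s = ι v →
      ∃ (unn : ℕ → ℕ → ℝ → H) (un : ℕ → ℝ → H), (∀ k, Tendsto (fun n => unn k n T) atTop
        (𝓝 (un k T))) ∧ Tendsto (fun k => un k T) atTop (𝓝 (u T)) ∧ (∀ k n, unn k n s = ι v) ∧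
        ∀ k n, IsRegSol ι b ν a β (regParam n) (gn k) s T (unn k n) := by
    intro v u w hu hi
    choose unn un wn hk using fun k => D.exists_regLimit hν ha hβ hs.2 (hgn k) v
    exact ⟨unn, un, fun k => (hk k).tendsto.tendsto_at hT,
      (D.isSol_tendsto hν ha hβ hs.2 hgs (hd v) hk hu hi).1 T hT, fun k => (hk k).initial,
      fun k => (hk k).regSol⟩
  have hlift : ∀ (v : V) (u : ℝ → H) w, IsSol ι b ν a β g s T u w → u s = ι v → ‖v‖ ^ 2 ≤ M →
      ∃ y : V, ι y = u T := by
    intro v u w hu hi hv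
    obtain ⟨unn, un, t1, t2, ini, reg⟩ := hreg v u w hu hi
    -- Bounded sequences in `V` are lifted twice: first the regularization is removed for a fixed
    -- force, then the force is allowed to converge. The bound `√K` depends on neither index.
    have h3 : ∀ k, ∃ y : V, ι y = un k T ∧ ‖y‖ ≤ √K := by
      intro k
      refine exists_lift_of_tendsto ι D.injective (x := fun n => smoother ι (regParam n)
        (unn k n T)) (fun n => ?_) (tendsto_smoother_seq D.denseRange (t1 k))
      refine Real.le_sqrt_of_sq_le ?_
      exact (hbd s hs _ (regParam_pos n) (gn k) _ (hgn k) (reg k n) (by rw [ini]; exact hιv hv)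
        (hgb k) (by rw [ini]; exact hPv hv n)).2.2.1 T hT
    choose y hy hyb using h3
    obtain ⟨y', h4, -⟩ := exists_lift_of_tendsto ι D.injective hyb (y := u T) (by simpa [hy] using t2)
    exact ⟨y', h4⟩
  obtain ⟨y₁, hy₁⟩ := hlift v₁ u₁ w₁ h₁ hi₁ hv₁
  obtain ⟨y₂, hy₂⟩ := hlift v₂ u₂ w₂ h₂ hi₂ hv₂
  obtain ⟨unn₁, un₁, t₁, t₁', ini₁, reg₁⟩ := hreg v₁ u₁ w₁ h₁ hi₁
  obtain ⟨unn₂, un₂, t₂, t₂', ini₂, reg₂⟩ := hreg v₂ u₂ w₂ h₂ hi₂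
  have h5 : ∀ k, ∃ y : V, ι y = un₁ k T - un₂ k T ∧ ‖y‖ ≤ √L * ‖v₁ - v₂‖ := by
    intro k
    refine exists_lift_of_tendsto ι D.injective (x := fun n => smoother ι (regParam n)
      (unn₁ k n T - unn₂ k n T)) (fun n => ?_)
      (tendsto_smoother_seq D.denseRange ((t₁ k).sub (t₂ k)))
    refine abs_le_of_sq_le_sq' ?_ (by positivity) |>.2
    rw [mul_pow, Real.sq_sqrt hL]
    refine (hlip s hs _ (regParam_pos n) (gn k) _ _ (hgn k) (reg₁ k n) (reg₂ k n)
      (by rw [ini₁]; exact hιv hv₁) (by rw [ini₁]; exact hPv hv₁ n) (by rw [ini₂]; exact hιv hv₂)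
      (by rw [ini₂]; exact hPv hv₂ n) (hgb k) T hT).trans ?_
    rw [ini₁, ini₂, ← map_sub]
    exact mul_le_mul_of_nonneg_left (inner_yosida_le ι (regParam_pos n) _) hL
  choose y hy hyb using h5
  obtain ⟨y', h6, h7⟩ := exists_lift_of_tendsto ι D.injective hyb (y := u₁ T - u₂ T)
    (by simpa only [hy] using t₁'.sub t₂')
  refine ⟨y₁, y₂, hy₁, hy₂, ?_⟩
  have h8 : y₁ - y₂ = y' := D.injective (by rw [map_sub, hy₁, hy₂, h6])
  rwa [h8]

/-- Lipschitz dependence of weak solutions on the initial data, measured in `L²(τ, T; V)`. -/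
lemma IsNSETriple.isSol_lipschitz_H (D : IsNSETriple ι b C) (hν : 0 < ν) (ha : Continuous a)
    (hβ : Continuous β) (hτT : τ ≤ T) {g : ℝ → H} (hg : MemLp g 2 (volume.restrict (Icc τ T)))
    (R : ℝ) : ∃ L : ℝ, 0 ≤ L ∧ ∀ u w v x, IsSol ι b ν a β g τ T u w → IsSol ι b ν a β g τ T v x →
      ‖v τ‖ ≤ R → ∫ s, ‖w s - x s‖ ^ 2 ∂(volume.restrict (Icc τ T)) ≤ L * ‖u τ - v τ‖ ^ 2 := by
  obtain ⟨A, hA⟩ := isCompact_Icc.exists_bound_of_continuousOn (ha.continuousOn (s := Icc τ T))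
  obtain ⟨B, hB⟩ := isCompact_Icc.exists_bound_of_continuousOn (hβ.continuousOn (s := Icc τ T))
  set G := (eLpNorm g 2 (volume.restrict (Icc τ T))).toReal with hG
  obtain ⟨L, hL, hlip⟩ := D.regLimit_lipschitz_H hν hτT hA hB (max ((1 + R) ^ 2) ((1 + G) ^ 2))
  refine ⟨L / ν, by positivity, fun u w v x hu hv hvR => ?_⟩
  obtain ⟨gn, hgn, hgn'⟩ := exists_continuous_approx hg
  have hgb : ∀ n, (∫ r in τ..T, ‖gn n r‖ ^ 2) ≤ (1 + G) ^ 2 := fun n =>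
    integral_sq_approx_le (memLp_of_continuousOn (hgn n).continuousOn) hg hτT zero_le_one
      ((hgn' n).trans (ENNReal.ofReal_le_ofReal (regParam_le_one n)))
  obtain ⟨p, hp⟩ := exists_dense_approx D.denseRange (u τ)
  obtain ⟨q, hq⟩ := exists_dense_approx D.denseRange (v τ)
  choose unn un wn hun using fun n => D.exists_regLimit hν ha hβ hτT (hgn n) (p n)
  choose vnn vn xn hvn using fun n => D.exists_regLimit hν ha hβ hτT (hgn n) (q n)
  have t₁ := (D.isSol_tendsto hν ha hβ hτT hg ⟨hgn, hgn', hp⟩ hun hu rfl).2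
  have t₂ := (D.isSol_tendsto hν ha hβ hτT hg ⟨hgn, hgn', hq⟩ hvn hv rfl).2
  have hqb : ∀ n, ‖ι (q n)‖ ^ 2 ≤ (1 + R) ^ 2 := by
    intro n
    refine pow_le_pow_left₀ (norm_nonneg _) ?_ 2
    have h1 := norm_add_le (ι (q n) - v τ) (v τ)
    rw [sub_add_cancel] at h1
    linarith [hq n, regParam_le_one n]
  have hpq : ∀ n, ‖ι (p n) - ι (q n)‖ ≤ ‖u τ - v τ‖ + 2 * regParam n := by
    intro n
    have e : ι (p n) - ι (q n) = (ι (p n) - u τ) - (ι (q n) - v τ) + (u τ - v τ) := by abel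
    rw [e]
    refine (norm_add_le _ _).trans ?_
    linarith [norm_sub_le (ι (p n) - u τ) (ι (q n) - v τ), hp n, hq n]
  have key : ∀ N, ∫ s, ‖w s - x s‖ ^ 2 ∂(volume.restrict (Icc τ T))
      ≤ L / ν * (‖u τ - v τ‖ + 2 * regParam N) ^ 2 := by
    intro N
    -- Starting the sequence at index `N` makes the excess in the initial distance at most `2 *
    -- regParam N`; this excess is removed at the end by letting `N` grow.
    refine integral_sq_le_of_tendsto (f := fun n s => wn (n + N) s - xn (n + N) s)
      (f' := fun s => w s - x s)
      (fun n => (hun _).isSol.memLp.sub (hvn _).isSol.memLp) (hu.memLp.sub hv.memLp) ?_ fun n => ?_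
    · have h3 := (tendsto_add_atTop_iff_nat N).2 (t₁.add t₂)
      rw [add_zero] at h3
      refine tendsto_of_tendsto_of_tendsto_of_le_of_le tendsto_const_nhds h3 (fun _ => zero_le)
        fun n => ?_
      refine le_trans (le_of_eq ?_) (eLpNorm_sub_le ((hun (n + N)).isSol.memLp.sub hu.memLp).1
        ((hvn (n + N)).isSol.memLp.sub hv.memLp).1 (by norm_num))
      congr 1
      funext s
      simp only [Pi.sub_apply]
      abel
    · have h4 := (hlip _ _ _ _ _ _ _ _ _ _ (hgn (n + N)) (hgn (n + N)) (hun (n + N)) (hvn (n + N))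
        ((hqb _).trans (le_max_left _ _)) ((hgb _).trans (le_max_right _ _))).2
      rw [integral_restrict_Icc hτT, div_mul_eq_mul_div, le_div_iff₀ hν, mul_comm]
      refine h4.trans (mul_le_mul_of_nonneg_left ?_ hL)
      simp only [sub_self, norm_zero]
      rw [zero_pow two_ne_zero, intervalIntegral.integral_zero, add_zero]
      refine pow_le_pow_left₀ (norm_nonneg _) ((hpq _).trans ?_) 2
      linarith [regParam_anti (Nat.le_add_left N n)]
  have h5 : Tendsto (fun N => L / ν * (‖u τ - v τ‖ + 2 * regParam N) ^ 2) atTop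
      (𝓝 (L / ν * ‖u τ - v τ‖ ^ 2)) := by
    simpa using (((tendsto_regParam.const_mul 2).const_add ‖u τ - v τ‖).pow 2).const_mul (L / ν)
  exact ge_of_tendsto' h5 key

/-- Locally Lipschitz dependence of `u(T) ∈ V` on `u(τ) ∈ H` for `τ < T`. -/
lemma IsNSETriple.isSol_lipschitz_HV (D : IsNSETriple ι b C) (hν : 0 < ν) (ha : Continuous a)
    (hβ : Continuous β) (hτT : τ < T) {g : ℝ → H} (hg : MemLp g 2 (volume.restrict (Icc τ T)))
    (R : ℝ) : ∃ L : ℝ, 0 ≤ L ∧ ∀ u w v x, IsSol ι b ν a β g τ T u w → IsSol ι b ν a β g τ T v x →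
      ‖u τ‖ ≤ R → ‖v τ‖ ≤ R → ∃ y₁ y₂ : V, ι y₁ = u T ∧ ι y₂ = v T ∧
        ‖y₁ - y₂‖ ≤ L * ‖u τ - v τ‖ := by
  obtain ⟨L, hL, hlip⟩ := D.isSol_lipschitz_H hν ha hβ hτT.le hg |R|
  -- A reference solution starting from zero: comparison with it bounds the `L²(τ, T; V)` norm of
  -- every solution starting in the ball of radius `R`.
  obtain ⟨u₀, w₀, hu₀, hi₀⟩ := D.exists_isSol hν ha hβ hτT.le hg 0
  set μ := volume.restrict (Icc τ T) with hμ
  set E := ∫ s, ‖w₀ s‖ ^ 2 ∂μ with hE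
  have hE0 : 0 ≤ E := integral_nonneg fun _ => by positivity
  have hsq : ∀ {w : ℝ → V}, MemLp w 2 μ → Integrable (fun s => ‖w s‖ ^ 2) μ := fun h =>
    h.integrable_norm_pow (by norm_num)
  have hbd : ∀ u w, IsSol ι b ν a β g τ T u w → ‖u τ‖ ≤ R →
      ∫ s, ‖w s‖ ^ 2 ∂μ ≤ 2 * (L * R ^ 2) + 2 * E := by
    intro u w hu huR
    have h1 := hlip u w u₀ w₀ hu hu₀ (by rw [hi₀, norm_zero]; positivity)
    rw [hi₀, sub_zero] at h1
    have h2 : L * ‖u τ‖ ^ 2 ≤ L * R ^ 2 := by gcongr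
    have h3 : ∫ s, ‖w s‖ ^ 2 ∂μ ≤ ∫ s, (2 * ‖w s - w₀ s‖ ^ 2 + 2 * ‖w₀ s‖ ^ 2) ∂μ := by
      refine integral_mono (hsq hu.memLp)
        (((hsq (hu.memLp.sub hu₀.memLp)).const_mul 2).add ((hsq hu₀.memLp).const_mul 2))
        fun s => ?_
      have h4 := norm_add_le (w s - w₀ s) (w₀ s)
      rw [sub_add_cancel] at h4
      have h5 := pow_le_pow_left₀ (norm_nonneg _) h4 2
      change ‖w s‖ ^ 2 ≤ 2 * ‖w s - w₀ s‖ ^ 2 + 2 * ‖w₀ s‖ ^ 2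
      nlinarith [sq_nonneg (‖w s - w₀ s‖ - ‖w₀ s‖)]
    have h6 : Integrable (fun s => ‖w s - w₀ s‖ ^ 2) μ := hsq (hu.memLp.sub hu₀.memLp)
    rw [integral_add (h6.const_mul 2) ((hsq hu₀.memLp).const_mul 2), integral_const_mul,
      integral_const_mul] at h3
    linarith
  -- The time average of the normalized sum of the two squared `V` norms and the squared `V`
  -- distance.
  set N := (2 * (2 * (L * R ^ 2) + 2 * E) + L) / (T - τ) with hN
  have hTτ : 0 < T - τ := sub_pos.2 hτT
  have hN0 : 0 ≤ N := by positivity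
  obtain ⟨K, hK, hV⟩ := D.isSol_lipschitz_V hν ha hβ hg N
  refine ⟨K * √N, by positivity, fun u w v x hu hv huR hvR => ?_⟩
  have hg' : ∀ s ∈ Icc τ T, MemLp g 2 (volume.restrict (Icc s T)) := fun s hs =>
    hg.mono_measure (Measure.restrict_mono (Icc_subset_Icc_left hs.1) le_rfl)
  have good : ∃ s ∈ Icc τ T, ι (w s) = u s ∧ ι (x s) = v s ∧ ‖w s‖ ^ 2 ≤ N ∧ ‖x s‖ ^ 2 ≤ N ∧
      ‖w s - x s‖ ^ 2 ≤ N * ‖u τ - v τ‖ ^ 2 := by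
    have hi : Integrable (fun s => ‖w s - x s‖ ^ 2) μ := hsq (hu.memLp.sub hv.memLp)
    have hle := hlip u w v x hu hv (hvR.trans (le_abs_self R))
    -- The weight `c = ‖u τ - v τ‖²` puts all three quantities on the same scale, so that one good
    -- time serves for all. If the initial values agree, the distance vanishes almost everywhere and
    -- `c = 1` will do.
    obtain ⟨c, hc, hcL, hcN⟩ : ∃ c : ℝ, 0 < c ∧ ∫ s, ‖w s - x s‖ ^ 2 ∂μ ≤ L * c ∧
        ∀ᵐ s ∂μ, ‖w s - x s‖ ^ 2 ≤ N * c → ‖w s - x s‖ ^ 2 ≤ N * ‖u τ - v τ‖ ^ 2 := by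
      rcases eq_or_ne (u τ - v τ) 0 with h0 | h0
      · rw [h0, norm_zero, zero_pow two_ne_zero, mul_zero] at hle
        refine ⟨1, one_pos, hle.trans (by positivity), ?_⟩
        have h1 := (integral_eq_zero_iff_of_nonneg (fun _ => by positivity) hi).1
          (le_antisymm hle (integral_nonneg fun _ => by positivity))
        filter_upwards [h1] with s hs _
        rw [h0, norm_zero, zero_pow two_ne_zero, mul_zero]
        exact hs.le
      · exact ⟨_, by positivity, hle, ae_of_all _ fun _ h => h⟩
    set F : ℝ → ℝ := fun s => c * (‖w s‖ ^ 2 + ‖x s‖ ^ 2) + ‖w s - x s‖ ^ 2 with hF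
    have hFi : Integrable F μ := (((hsq hu.memLp).add (hsq hv.memLp)).const_mul c).add hi
    have hFint : ∫ s, F s ∂μ ≤ c * (N * (T - τ)) := by
      have h1 : ∫ s, F s ∂μ = c * ((∫ s, ‖w s‖ ^ 2 ∂μ) + ∫ s, ‖x s‖ ^ 2 ∂μ)
          + ∫ s, ‖w s - x s‖ ^ 2 ∂μ := by
        rw [← integral_add (hsq hu.memLp) (hsq hv.memLp), ← integral_const_mul]
        exact integral_add (((hsq hu.memLp).add (hsq hv.memLp)).const_mul c) hi
      rw [h1, hN, div_mul_cancel₀ _ hTτ.ne']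
      have h2 := mul_le_mul_of_nonneg_left (add_le_add (hbd u w hu huR) (hbd v x hv hvR)) hc.le
      linarith
    have hμ0 : μ ≠ 0 := by
      rw [hμ, Ne, Measure.restrict_eq_zero, Real.volume_Icc]
      simpa using hτT
    have hall : ∀ᵐ s ∂μ, s ∈ Icc τ T ∧ ι (w s) = u s ∧ ι (x s) = v s ∧
        (‖w s - x s‖ ^ 2 ≤ N * c → ‖w s - x s‖ ^ 2 ≤ N * ‖u τ - v τ‖ ^ 2) := by
      filter_upwards [ae_restrict_mem measurableSet_Icc, hu.ae_eq, hv.ae_eq, hcN] with s h1 h2 h3 h4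
      exact ⟨h1, h2, h3, h4⟩
    -- A time at which `F` is at most its average, outside the null set where the `V`-valued
    -- representatives fail.
    obtain ⟨s, hs, hsF⟩ := exists_notMem_null_le_average hμ0 hFi (ae_iff.1 hall)
    simp only [mem_ofPred_eq, not_not] at hs
    obtain ⟨h1, h2, h3, h4⟩ := hs
    have hav : F s ≤ c * N := by
      refine hsF.trans ?_
      rw [average_eq, measureReal_restrict_apply_univ, Real.volume_real_Icc_of_le hτT.le,
        smul_eq_mul, inv_mul_le_iff₀ hTτ]
      linarith
    have hw0 : 0 ≤ ‖w s‖ ^ 2 := by positivity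
    have hx0 : 0 ≤ ‖x s‖ ^ 2 := by positivity
    have hwx0 : 0 ≤ ‖w s - x s‖ ^ 2 := by positivity
    have hcw := mul_nonneg hc.le hw0
    have hcx := mul_nonneg hc.le hx0
    simp only [hF] at hav
    refine ⟨s, h1, h2, h3, le_of_mul_le_mul_left ?_ hc, le_of_mul_le_mul_left ?_ hc, h4 ?_⟩ <;>
      linarith
  obtain ⟨s, hs, e1, e2, b1, b2, b3⟩ := good
  obtain ⟨y₁, y₂, hy₁, hy₂, hy⟩ := hV s hs (w s) (x s) u w v x (hu.restart D ha hβ hg hs)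
    (hv.restart D ha hβ hg hs) e1.symm e2.symm b1 b2
  refine ⟨y₁, y₂, hy₁, hy₂, hy.trans ?_⟩
  rw [mul_assoc]
  refine mul_le_mul_of_nonneg_left ?_ hK
  refine abs_le_of_sq_le_sq' ?_ (by positivity) |>.2
  rwa [mul_pow, Real.sq_sqrt hN0]

/-- For `τ < T` the solution operator is continuous from `H` to `V`. -/
theorem IsNSETriple.exists_continuous_lift (D : IsNSETriple ι b C) (hν : 0 < ν)
    (ha : Continuous a) (hβ : Continuous β) (hτT : τ < T) {g : ℝ → H}
    (hg : MemLp g 2 (volume.restrict (Icc τ T))) : ∃ U : H → V, Continuous U ∧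
      ∀ u w, IsSol ι b ν a β g τ T u w → ι (U (u τ)) = u T := by
  choose S W hS hS0 using fun u₀ => D.exists_isSol hν ha hβ hτT.le hg u₀
  have hU : ∀ u₀, ∃ y : V, ι y = S u₀ T := by
    intro u₀
    obtain ⟨L, -, h⟩ := D.isSol_lipschitz_HV hν ha hβ hτT hg ‖u₀‖
    obtain ⟨y, -, hy, -⟩ := h _ _ _ _ (hS u₀) (hS u₀) (by rw [hS0]) (by rw [hS0])
    exact ⟨y, hy⟩
  choose U hU using hU
  refine ⟨U, ?_, fun u w hu => ?_⟩
  · rw [continuous_iff_continuousAt]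
    intro u₀
    obtain ⟨L, hL, h⟩ := D.isSol_lipschitz_HV hν ha hβ hτT hg (‖u₀‖ + 1)
    refine tendsto_iff_norm_sub_tendsto_zero.2 ?_
    have h0 : Tendsto (fun v => L * ‖v - u₀‖) (𝓝 u₀) (𝓝 0) := by
      have : Continuous fun v => L * ‖v - u₀‖ := by fun_prop
      simpa using this.tendsto u₀
    refine squeeze_zero' (Eventually.of_forall fun _ => norm_nonneg _) ?_ h0
    filter_upwards [Metric.ball_mem_nhds u₀ one_pos] with v hv
    have hvn : ‖v‖ ≤ ‖u₀‖ + 1 := by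
      rw [mem_ball_iff_norm] at hv
      have := norm_add_le (v - u₀) u₀
      rw [sub_add_cancel] at this
      linarith
    obtain ⟨y₁, y₂, e₁, e₂, hy⟩ := h _ _ _ _ (hS v) (hS u₀) (by rwa [hS0]) (by rw [hS0]; linarith)
    rw [hS0, hS0] at hy
    rwa [D.injective ((hU v).trans e₁.symm), D.injective ((hU u₀).trans e₂.symm)]
  · rw [hU]
    exact D.isSol_unique hν ha hβ hg (hS _) hu (hS0 _) (right_mem_Icc.2 hτT.le)

end

section

/-! ### The spaces `ℍ` and `𝕍` -/

instance : CompleteSpace spaceH :=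
  (Submodule.isClosed_topologicalClosure _).completeSpace_coe

instance : CompleteSpace spaceV :=
  (Submodule.isClosed_topologicalClosure _).completeSpace_coe

/-- The class of a test field in `𝕍`. -/
def testV (φ : testFields) : spaceV :=
  ⟨testToPair φ, Submodule.le_topologicalClosure _ (LinearMap.mem_range_self _ φ)⟩

lemma field_testV (φ : testFields) : field (testV φ) = testToL2 φ := rfl

lemma denseRange_testV : DenseRange testV := by
  intro v
  have hv : (v : L2Pair) ∈ closure (LinearMap.range testToPair : Set L2Pair) := v.2
  rw [closure_subtype]
  convert hv using 2
  ext x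
  constructor
  · rintro ⟨_, ⟨φ, rfl⟩, rfl⟩
    exact ⟨φ, rfl⟩
  · rintro ⟨φ, rfl⟩
    exact ⟨testV φ, ⟨φ, rfl⟩, rfl⟩

/-- The gradient as a bounded operator. -/
def gradL : spaceV →L[ℝ] L2Grad := (WithLp.sndL 2 ℝ L2 L2Grad) ∘L spaceV.subtypeL

lemma gradL_apply (v : spaceV) : gradL v = gradV v := rfl

/-- The underlying field as a bounded operator. -/
def fieldL : spaceV →L[ℝ] L2 := (WithLp.fstL 2 ℝ L2 L2Grad) ∘L spaceV.subtypeL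

lemma field_mem_spaceH (v : spaceV) : field v ∈ spaceH := by
  refine denseRange_testV.induction_on (p := fun v => field v ∈ spaceH) v ?_ fun φ => ?_
  · exact (Submodule.isClosed_topologicalClosure _).preimage fieldL.continuous
  · exact Submodule.le_topologicalClosure _ (LinearMap.mem_range_self _ φ)

/-- The embedding of `𝕍` in `ℍ`. -/
def embVH : spaceV →L[ℝ] spaceH := fieldL.codRestrict spaceH field_mem_spaceH

lemma coe_embVH (v : spaceV) : (embVH v : L2) = field v := rfl

lemma norm_embVH (v : spaceV) : ‖embVH v‖ = ‖field v‖ := rfl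

lemma norm_sq_spaceV (v : spaceV) : ‖v‖ ^ 2 = ‖field v‖ ^ 2 + ‖gradV v‖ ^ 2 :=
  WithLp.prod_norm_sq_eq_of_L2 _

lemma inner_spaceV (v w : spaceV) : ⟪v, w⟫ = ⟪field v, field w⟫ + ⟪gradV v, gradV w⟫ :=
  WithLp.prod_inner_apply _ _

lemma norm_field_le (v : spaceV) : ‖field v‖ ≤ ‖v‖ := by
  refine abs_le_of_sq_le_sq' ?_ (norm_nonneg _) |>.2
  rw [norm_sq_spaceV]
  nlinarith [sq_nonneg ‖gradV v‖]

lemma norm_gradV_le (v : spaceV) : ‖gradV v‖ ≤ ‖v‖ := by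
  refine abs_le_of_sq_le_sq' ?_ (norm_nonneg _) |>.2
  rw [norm_sq_spaceV]
  nlinarith [sq_nonneg ‖field v‖]

lemma denseRange_embVH : DenseRange embVH := by
  intro u
  have hu : (u : L2) ∈ closure (LinearMap.range testToL2 : Set L2) := u.2
  rw [closure_subtype]
  refine closure_mono ?_ hu
  rintro _ ⟨φ, rfl⟩
  exact ⟨embVH (testV φ), ⟨testV φ, rfl⟩, rfl⟩

/-! ### Translations -/

/-- The translation `v ↦ v(· + h)` of square integrable functions. -/
def trans {E : Type*} [NormedAddCommGroup E] [NormedSpace ℝ E] (h : Plane) :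
    Lp E 2 (volume : Measure Plane) →ₗᵢ[ℝ] Lp E 2 (volume : Measure Plane) :=
  Lp.compMeasurePreservingₗᵢ ℝ (fun x => x + h) (measurePreserving_add_right volume h)

lemma trans_add {E : Type*} [NormedAddCommGroup E] [NormedSpace ℝ E] (h k : Plane)
    (v : Lp E 2 (volume : Measure Plane)) : trans h (trans k v) = trans (h + k) v := by
  have e := Lp.compMeasurePreserving_comp_apply v (measurePreserving_add_right volume k)
    (measurePreserving_add_right volume h)
  refine Eq.trans e.symm ?_
  change Lp.compMeasurePreserving _ _ v = Lp.compMeasurePreserving _ _ v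
  congr 1
  congr 1
  funext x
  simp [add_assoc]

lemma trans_zero {E : Type*} [NormedAddCommGroup E] [NormedSpace ℝ E]
    (v : Lp E 2 (volume : Measure Plane)) : trans 0 v = v := by
  refine Eq.trans ?_ (Lp.compMeasurePreserving_id_apply v)
  change Lp.compMeasurePreserving _ _ v = Lp.compMeasurePreserving _ _ v
  congr 1
  congr 1
  funext x
  simp

lemma inner_trans {E : Type*} [NormedAddCommGroup E] [InnerProductSpace ℝ E] (h : Plane)
    (v w : Lp E 2 (volume : Measure Plane)) : ⟪trans h v, w⟫ = ⟪v, trans (-h) w⟫ := by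
  rw [← (trans (E := E) (-h)).inner_map_map (trans h v) w, trans_add, neg_add_cancel, trans_zero]

lemma grad_comp_add (φ : Plane → Plane) (h x : Plane) :
    grad (fun y => φ (y + h)) x = grad φ (x + h) := by
  simp only [grad, fderiv_comp_add_right]

/-- Translation of test fields. -/
def transTest (h : Plane) (φ : testFields) : testFields :=
  ⟨fun x => (φ : Plane → Plane) (x + h), by
    refine ⟨φ.2.1.comp (contDiff_id.add contDiff_const), ?_, fun x => ?_⟩
    · exact φ.2.2.1.comp_homeomorph (Homeomorph.addRight h)
    · have := φ.2.2.2 (x + h)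
      simpa only [divergence, grad_comp_add] using this⟩

lemma trans_testToL2 (h : Plane) (φ : testFields) :
    trans h (testToL2 φ) = testToL2 (transTest h φ) := rfl

lemma trans_gradV_testV (h : Plane) (φ : testFields) :
    trans h (gradV (testV φ)) = gradV (testV (transTest h φ)) := by
  refine Eq.trans (b := ((memLp_grad_test φ).comp_measurePreserving
    (measurePreserving_add_right volume h)).toLp _) rfl ?_
  refine MemLp.toLp_congr _ (memLp_grad_test (transTest h φ)) (Eventually.of_forall fun x => ?_)
  exact (grad_comp_add _ _ _).symm

/-- Translation preserves smoothness, compact support and vanishing divergence, hence acts on the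
closure. Difference quotients therefore remain admissible divergence-free test fields. -/
lemma trans_pair_mem (h : Plane) (v : spaceV) :
    (WithLp.toLp 2 (trans h (field v), trans h (gradV v)) : L2Pair) ∈ spaceV := by
  refine denseRange_testV.induction_on
    (p := fun v => (WithLp.toLp 2 (trans h (field v), trans h (gradV v)) : L2Pair) ∈ spaceV)
    v ?_ fun φ => ?_
  · refine (Submodule.isClosed_topologicalClosure _).preimage ?_
    refine (WithLp.prod_continuous_toLp 2 L2 L2Grad).comp ?_
    exact ((trans h).continuous.comp fieldL.continuous).prodMk
      ((trans h).continuous.comp gradL.continuous)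
  · rw [field_testV, trans_testToL2, trans_gradV_testV]
    exact (testV (transTest h φ)).2

/-- Translation in `𝕍`. -/
def transV (h : Plane) (v : spaceV) : spaceV :=
  ⟨WithLp.toLp 2 (trans h (field v), trans h (gradV v)), trans_pair_mem h v⟩

lemma field_transV (h : Plane) (v : spaceV) : field (transV h v) = trans h (field v) := rfl

lemma gradV_transV (h : Plane) (v : spaceV) : gradV (transV h v) = trans h (gradV v) := rfl

lemma inner_transV (h : Plane) (v w : spaceV) : ⟪transV h v, w⟫ = ⟪v, transV (-h) w⟫ := by
  rw [inner_spaceV, inner_spaceV, field_transV, gradV_transV, field_transV, gradV_transV,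
    inner_trans, inner_trans]

/-! ### Difference quotients -/

/-- The `i`-th coordinate vector. -/
def basisVec (i : Fin 2) : Plane := EuclideanSpace.single i (1 : ℝ)

lemma norm_basisVec (i : Fin 2) : ‖basisVec i‖ = 1 := by simp [basisVec]

/-- The component `∂ᵢ v` of a gradient field. -/
def gradComp (i : Fin 2) : L2Grad →L[ℝ] L2 :=
  (PiLp.proj 2 (fun _ : Fin 2 => Plane) i : GradVal →L[ℝ] Plane).compLpL 2 volume

lemma coeFn_gradComp (i : Fin 2) (G : L2Grad) : gradComp i G =ᵐ[volume] fun x => G x i :=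
  ContinuousLinearMap.coeFn_compLpL _ _

lemma norm_gradComp_le (i : Fin 2) (G : L2Grad) : ‖gradComp i G‖ ≤ ‖G‖ := by
  refine Lp.norm_le_norm_of_ae_le ?_
  filter_upwards [coeFn_gradComp i G] with x hx
  rw [hx]
  exact PiLp.norm_apply_le _ _

lemma memLp_gradComp_test (φ : testFields) (i : Fin 2) :
    MemLp (fun x => fderiv ℝ (φ : Plane → Plane) x (basisVec i)) 2 (volume : Measure Plane) :=
  (PiLp.proj 2 (fun _ : Fin 2 => Plane) i : GradVal →L[ℝ] Plane).comp_memLp' (memLp_grad_test φ)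

lemma gradComp_testV (φ : testFields) (i : Fin 2) :
    gradComp i (gradV (testV φ)) = (memLp_gradComp_test φ i).toLp _ := by
  refine Lp.ext ?_
  filter_upwards [coeFn_gradComp i (gradV (testV φ)), (memLp_gradComp_test φ i).coeFn_toLp,
    (memLp_grad_test φ).coeFn_toLp] with x h1 h2 h3
  rw [h1, h2]
  change ((memLp_grad_test φ).toLp _ : Plane → GradVal) x i = _
  rw [h3]
  rfl

/-- The derivative is continuous with compact support, hence uniformly continuous, and the mean
value inequality makes the convergence uniform in `x`. -/
lemma exists_norm_slope_sub_le (φ : testFields) (i : Fin 2) {ε : ℝ} (hε : 0 < ε) :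
    ∀ᶠ t in 𝓝[≠] (0 : ℝ), ∀ x : Plane, ‖t⁻¹ • ((φ : Plane → Plane) (x + t • basisVec i) - (φ : Plane → Plane) x)
      - fderiv ℝ (φ : Plane → Plane) x (basisVec i)‖ ≤ ε := by
  have hc : Continuous (fderiv ℝ (φ : Plane → Plane)) := φ.2.1.continuous_fderiv (by simp)
  have huc : UniformContinuous (fderiv ℝ (φ : Plane → Plane)) :=
    (φ.2.2.1.fderiv (𝕜 := ℝ)).uniformContinuous_of_continuous hc
  obtain ⟨δ, hδ, h⟩ := Metric.uniformContinuous_iff.1 huc ε hε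
  have h1 : ∀ᶠ t in 𝓝[≠] (0 : ℝ), |t| < δ := by
    refine nhdsWithin_le_nhds ?_
    filter_upwards [Metric.ball_mem_nhds (0 : ℝ) hδ] with t ht
    simpa using ht
  filter_upwards [h1, self_mem_nhdsWithin] with t ht ht0 x
  have ht0' : t ≠ 0 := ht0
  have hmem : x + t • basisVec i ∈ Metric.ball x δ := by
    simpa [norm_smul, norm_basisVec] using ht
  have h2 := (convex_ball x δ).norm_image_sub_le_of_norm_fderiv_le' (𝕜 := ℝ)
    (f := (φ : Plane → Plane)) (φ := fderiv ℝ (φ : Plane → Plane) x) (C := ε)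
    (fun y _ => φ.2.1.differentiable (by simp) y)
    (fun y hy => by simpa [dist_eq_norm] using (h (Metric.mem_ball.1 hy)).le)
    (Metric.mem_ball_self hδ) hmem
  have e : t⁻¹ • ((φ : Plane → Plane) (x + t • basisVec i) - (φ : Plane → Plane) x)
      - fderiv ℝ (φ : Plane → Plane) x (basisVec i)
      = t⁻¹ • ((φ : Plane → Plane) (x + t • basisVec i) - (φ : Plane → Plane) x
        - fderiv ℝ (φ : Plane → Plane) x (x + t • basisVec i - x)) := by
    rw [add_sub_cancel_left, map_smul, smul_sub, smul_sub, smul_smul, inv_mul_cancel₀ ht0', one_smul,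
      smul_sub]
  rw [e, norm_smul, norm_inv, inv_mul_le_iff₀ (by simpa using ht0')]
  refine h2.trans (le_of_eq ?_)
  simp [norm_smul, norm_basisVec, mul_comm]

/-- Uniform convergence becomes `L²` convergence because for `|t| ≤ 1` the quotients are all
supported in the compact unit thickening of the support. -/
lemma hasDerivAt_trans_zero (φ : testFields) (i : Fin 2) :
    HasDerivAt (fun t : ℝ => trans (t • basisVec i) (testToL2 φ))
      (gradComp i (gradV (testV φ))) 0 := by
  rw [hasDerivAt_iff_tendsto_slope_zero, tendsto_iff_norm_sub_tendsto_zero]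
  set K : Set Plane := Metric.cthickening 1 (tsupport (φ : Plane → Plane)) with hK
  have hKc : IsCompact K := φ.2.2.1.isCompact.cthickening
  set c : ℝ := (volume K ^ (1 / (2 : ℝ≥0∞).toReal)).toReal with hc
  have hctop : volume K ^ (1 / (2 : ℝ≥0∞).toReal) ≠ ∞ :=
    ENNReal.rpow_ne_top_of_nonneg (by positivity) hKc.measure_lt_top.ne
  rw [Metric.tendsto_nhds]
  intro ε hε
  -- Here `c` is the `L²` norm of the indicator of `K`, so a pointwise error `η` costs `η * c < ε`;
  -- the `+ 1` avoids dividing by zero.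
  have hη : 0 < ε / (2 * (c + 1)) := by positivity
  have h1 : ∀ᶠ t in 𝓝[≠] (0 : ℝ), |t| ≤ 1 := by
    refine nhdsWithin_le_nhds ?_
    filter_upwards [Metric.closedBall_mem_nhds (0 : ℝ) one_pos] with t ht
    simpa using ht
  filter_upwards [exists_norm_slope_sub_le φ i hη, h1] with t ht ht1
  set η := ε / (2 * (c + 1)) with hηdef
  set F : Plane → Plane := fun x => t⁻¹ • ((φ : Plane → Plane) (x + t • basisVec i)
    - (φ : Plane → Plane) x) - fderiv ℝ (φ : Plane → Plane) x (basisVec i) with hF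
  have hFm : MemLp F 2 (volume : Measure Plane) :=
    (((memLp_test (transTest (t • basisVec i) φ)).sub (memLp_test φ)).const_smul t⁻¹).sub
      (memLp_gradComp_test φ i)
  have e : t⁻¹ • (trans ((0 + t) • basisVec i) (testToL2 φ)
      - trans ((0 : ℝ) • basisVec i) (testToL2 φ)) - gradComp i (gradV (testV φ)) = hFm.toLp F := by
    rw [zero_add, zero_smul, trans_zero, trans_testToL2, gradComp_testV]
    rfl
  rw [e, dist_zero_right, norm_norm, Lp.norm_toLp]
  have hsupp : ∀ x, ‖F x‖ ≤ ‖K.indicator (fun _ => η) x‖ := by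
    intro x
    by_cases hx : x ∈ K
    · rw [indicator_of_mem hx, Real.norm_of_nonneg hη.le]
      exact ht x
    · have hx1 : x ∉ tsupport (φ : Plane → Plane) := fun h =>
        hx (Metric.self_subset_cthickening _ h)
      have hx2 : x + t • basisVec i ∉ tsupport (φ : Plane → Plane) := fun h => by
        refine hx (Metric.mem_cthickening_of_dist_le _ _ _ _ h ?_)
        simpa [norm_smul, norm_basisVec, dist_eq_norm] using ht1
      have hx3 : fderiv ℝ (φ : Plane → Plane) x = 0 :=
        image_eq_zero_of_notMem_tsupport fun h => hx1 (tsupport_fderiv_subset ℝ h)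
      simp [hF, image_eq_zero_of_notMem_tsupport hx1, image_eq_zero_of_notMem_tsupport hx2, hx3]
  have h2 := (eLpNorm_mono hsupp (p := 2) (μ := volume)).trans
    (eLpNorm_indicator_const_le η 2 (s := K))
  have h3 : (eLpNorm F 2 volume).toReal ≤ η * c := by
    refine (ENNReal.toReal_mono (ENNReal.mul_ne_top (by simp) hctop) h2).trans (le_of_eq ?_)
    rw [ENNReal.toReal_mul, hc]
    simp [abs_of_pos hη]
  refine h3.trans_lt ?_
  have hc0 : 0 ≤ c := ENNReal.toReal_nonneg
  rw [hηdef, div_mul_eq_mul_div, div_lt_iff₀ (by positivity)]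
  nlinarith

lemma hasDerivAt_trans (φ : testFields) (i : Fin 2) (s : ℝ) :
    HasDerivAt (fun t : ℝ => trans (t • basisVec i) (testToL2 φ))
      (trans (s • basisVec i) (gradComp i (gradV (testV φ)))) s := by
  have h0 : HasDerivAt (fun t : ℝ => trans (t • basisVec i) (testToL2 φ))
      (gradComp i (gradV (testV φ))) (s - s) := by
    rw [sub_self]; exact hasDerivAt_trans_zero φ i
  have h1 := h0.comp_sub_const s s
  have h2 := ((trans (E := Plane) (s • basisVec i)).toContinuousLinearMap.hasFDerivAt).comp_hasDerivAt
    s h1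
  refine (h2.congr_of_eventuallyEq (Eventually.of_forall fun t => ?_))
  change _ = trans (s • basisVec i) (trans ((t - s) • basisVec i) (testToL2 φ))
  rw [trans_add, ← add_smul, add_sub_cancel]

/-- For test fields this is the mean value inequality along the translation path, whose velocity has
constant norm because translations are isometries. Both sides are continuous on `𝕍`, so density
concludes. -/
lemma norm_trans_sub_le (v : spaceV) (i : Fin 2) (t : ℝ) :
    ‖trans (t • basisVec i) (field v) - field v‖ ≤ ‖gradComp i (gradV v)‖ * |t| := by
  refine denseRange_testV.induction_on (p := fun v : spaceV =>
    ‖trans (t • basisVec i) (field v) - field v‖ ≤ ‖gradComp i (gradV v)‖ * |t|) v ?_ fun φ => ?_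
  · have h1 := fieldL.continuous
    have h2 := (trans (E := Plane) (t • basisVec i)).continuous.comp h1
    have h3 := (gradComp i).continuous.comp gradL.continuous
    exact isClosed_le (h2.sub h1).norm (h3.norm.mul continuous_const)
  · have h := Convex.norm_image_sub_le_of_norm_hasDerivWithin_le (s := univ)
      (C := ‖gradComp i (gradV (testV φ))‖) (x := (0 : ℝ)) (y := t)
      (fun s _ => (hasDerivAt_trans φ i s).hasDerivWithinAt)
      (fun s _ => by rw [LinearIsometry.norm_map]) convex_univ (mem_univ _) (mem_univ _)
    rw [zero_smul, trans_zero, sub_zero] at h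
    exact h

/-- The difference quotient in direction `i`. -/
def diffQuot (i : Fin 2) (t : ℝ) (v : spaceV) : spaceV := t⁻¹ • (transV (t • basisVec i) v - v)

lemma field_diffQuot (i : Fin 2) (t : ℝ) (v : spaceV) :
    field (diffQuot i t v) = t⁻¹ • (trans (t • basisVec i) (field v) - field v) := rfl

lemma norm_field_diffQuot_le (i : Fin 2) {t : ℝ} (ht : t ≠ 0) (v : spaceV) :
    ‖field (diffQuot i t v)‖ ≤ ‖gradComp i (gradV v)‖ := by
  rw [field_diffQuot, norm_smul, norm_inv, Real.norm_eq_abs, inv_mul_le_iff₀ (abs_pos.2 ht),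
    mul_comm]
  exact norm_trans_sub_le v i t

lemma diffQuot_sub (i : Fin 2) (t : ℝ) (v w : spaceV) :
    field (diffQuot i t (v - w)) = field (diffQuot i t v) - field (diffQuot i t w) := by
  have e : field (v - w) = field v - field w := rfl
  rw [field_diffQuot, field_diffQuot, field_diffQuot, e, map_sub, ← smul_sub]
  congr 1
  abel

/-- Known for test fields; the bound on difference quotients, uniform in `t`, carries it to all of
`𝕍`. -/
lemma tendsto_field_diffQuot (i : Fin 2) (v : spaceV) :
    Tendsto (fun t => field (diffQuot i t v)) (𝓝[≠] 0) (𝓝 (gradComp i (gradV v))) := by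
  rw [Metric.tendsto_nhds]
  intro ε hε
  obtain ⟨φ, hφ⟩ := denseRange_testV.exists_dist_lt v (ε := ε / 3) (by positivity)
  have h1 : Tendsto (fun t => field (diffQuot i t (testV φ))) (𝓝[≠] 0)
      (𝓝 (gradComp i (gradV (testV φ)))) := by
    have := hasDerivAt_iff_tendsto_slope_zero.1 (hasDerivAt_trans_zero φ i)
    simp only [zero_add, zero_smul, trans_zero] at this
    exact this
  have h2 : ‖gradComp i (gradV (v - testV φ))‖ ≤ ‖v - testV φ‖ :=
    (norm_gradComp_le _ _).trans (norm_gradV_le _)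
  rw [dist_eq_norm] at hφ
  filter_upwards [(Metric.tendsto_nhds.1 h1) (ε / 3) (by positivity), self_mem_nhdsWithin]
    with t ht ht0
  rw [dist_eq_norm] at ht ⊢
  have e : field (diffQuot i t v) - gradComp i (gradV v)
      = field (diffQuot i t (v - testV φ))
        + (field (diffQuot i t (testV φ)) - gradComp i (gradV (testV φ)))
        - gradComp i (gradV (v - testV φ)) := by
    rw [diffQuot_sub]
    simp only [← gradL_apply, map_sub]
    abel
  rw [e]
  have h3 := (norm_field_diffQuot_le i ht0 (v - testV φ)).trans h2
  refine (norm_sub_le _ _).trans_lt ?_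
  linarith [norm_add_le (field (diffQuot i t (v - testV φ)))
    (field (diffQuot i t (testV φ)) - gradComp i (gradV (testV φ)))]

lemma gradV_eq_zero_of_comp {G : L2Grad} (h : ∀ i, gradComp i G = 0) : G = 0 := by
  refine Lp.ext ?_
  filter_upwards [coeFn_gradComp 0 G, coeFn_gradComp 1 G, Lp.coeFn_zero GradVal 2 (volume : Measure Plane),
    Lp.coeFn_zero Plane 2 (volume : Measure Plane)] with x h0 h1 h2 h3
  rw [h] at h0 h1
  rw [h3] at h0 h1
  rw [h2]
  ext i : 1
  fin_cases i
  · exact h0.symm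
  · exact h1.symm

/-- The gradient component of an element of `𝕍` is the limit of difference quotients of its field,
so it is determined by the field and the completion creates no ghost gradients. -/
lemma injective_embVH : Function.Injective embVH := by
  rw [injective_iff_map_eq_zero]
  intro v hv
  have h0 : field v = 0 := congrArg Subtype.val hv
  have h1 : gradV v = 0 := by
    refine gradV_eq_zero_of_comp fun i => ?_
    refine tendsto_nhds_unique (tendsto_field_diffQuot i v) ?_
    simp only [field_diffQuot, h0, map_zero, sub_self, smul_zero]
    exact tendsto_const_nhds
  have h2 := norm_sq_spaceV v
  rw [h0, h1] at h2
  simpa using h2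

/-- The `H²` regularity estimate for `K g`, in terms of difference quotients. -/
lemma norm_diffQuot_adjoint_le (g : spaceH) (i : Fin 2) {t : ℝ} (ht : t ≠ 0) :
    ‖diffQuot i t (adjoint embVH g)‖ ≤ ‖g‖ := by
  set v := adjoint embVH g with hv
  set d := diffQuot i t v with hd
  -- Discrete integration by parts in `𝕍`. As `v = ι† g`, the right-hand side is an `L²` pairing
  -- with `g`, and the outer quotient costs only one gradient of `d`.
  have h1 : ‖d‖ ^ 2 = ⟪v, -diffQuot i (-t) d⟫ := by
    have e : -diffQuot i (-t) d = t⁻¹ • (transV (-(t • basisVec i)) d - d) := by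
      rw [diffQuot, inv_neg, neg_smul, neg_neg, neg_smul]
    have e1 : ⟪v, t⁻¹ • (transV (-(t • basisVec i)) d - d)⟫
        = t⁻¹ * ⟪v, transV (-(t • basisVec i)) d - d⟫ := real_inner_smul_right v _ t⁻¹
    have e2 : ⟪d, d⟫ = t⁻¹ * ⟪transV (t • basisVec i) v - v, d⟫ :=
      real_inner_smul_left (transV (t • basisVec i) v - v) d t⁻¹
    rw [e, e1, inner_sub_right, ← inner_transV, ← inner_sub_left, ← e2,
      real_inner_self_eq_norm_sq]
  have h2 : ⟪v, -diffQuot i (-t) d⟫ ≤ ‖g‖ * ‖d‖ := by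
    rw [hv, ContinuousLinearMap.adjoint_inner_left]
    refine (real_inner_le_norm _ _).trans (mul_le_mul_of_nonneg_left ?_ (norm_nonneg _))
    rw [map_neg, norm_neg, norm_embVH]
    exact (norm_field_diffQuot_le i (neg_ne_zero.2 ht) d).trans
      ((norm_gradComp_le _ _).trans (norm_gradV_le _))
  by_contra! h
  nlinarith [norm_nonneg g]

end

section

/-! ### Ladyzhenskaya's inequality -/

lemma norm_fderiv_le_grad (φ : Plane → Plane) (x : Plane) : ‖fderiv ℝ φ x‖ ≤ ‖grad φ x‖ := by
  refine ContinuousLinearMap.opNorm_le_bound _ (norm_nonneg _) fun h => ?_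
  have e : h = ∑ i : Fin 2, h i • basisVec i := by
    ext j
    fin_cases j <;> simp [basisVec, Fin.sum_univ_two]
  have e1 : fderiv ℝ φ x h = ∑ i : Fin 2, h i • grad φ x i := by
    conv_lhs => rw [e]
    simp only [map_sum, map_smul]
    rfl
  rw [e1]
  refine abs_le_of_sq_le_sq' ?_ (by positivity) |>.2
  rw [mul_pow, PiLp.norm_sq_eq_of_L2 _ (grad φ x), EuclideanSpace.norm_sq_eq h, Fin.sum_univ_two,
    Fin.sum_univ_two, Fin.sum_univ_two]
  have h1 := norm_add_le (h 0 • grad φ x 0) (h 1 • grad φ x 1)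
  rw [norm_smul, norm_smul] at h1
  have h2 := pow_le_pow_left₀ (norm_nonneg _) h1 2
  nlinarith [sq_nonneg (‖h 0‖ * ‖grad φ x 1‖ - ‖h 1‖ * ‖grad φ x 0‖)]

/-- The constant in Ladyzhenskaya's inequality. -/
def ladyConst : ℝ≥0 := 2 * eLpNormLESNormFDerivOneConst (volume : Measure Plane) 2

/-- In the plane `W^{1,1}` embeds in `L²`. Applied to `|φ|²`, whose gradient is bounded by `2 |φ|
|∇φ|`, this gives the inequality by Cauchy-Schwarz. -/
lemma sq_eLpNorm_four_test_le (φ : testFields) :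
    eLpNorm (φ : Plane → Plane) 4 volume ^ 2
      ≤ ladyConst * (eLpNorm (φ : Plane → Plane) 2 volume
        * eLpNorm (grad (φ : Plane → Plane)) 2 volume) := by
  set f : Plane → Plane := (φ : Plane → Plane)
  have hfs : ContDiff ℝ 1 f := φ.2.1.of_le (by exact_mod_cast le_top)
  have hu : ContDiff ℝ 1 (fun x => ‖f x‖ ^ 2) := hfs.norm_sq ℝ
  have huc : HasCompactSupport (fun x => ‖f x‖ ^ 2) :=
    φ.2.2.1.comp_left (g := fun y => ‖y‖ ^ 2) (by simp)
  have hconj : NNReal.HolderConjugate (Module.finrank ℝ Plane) 2 := by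
    rw [finrank_euclideanSpace_fin]
    exact ⟨by norm_num, by norm_num, by norm_num⟩
  have h1 := eLpNorm_le_eLpNorm_fderiv_one (volume : Measure Plane) hu huc hconj
  have h2 : eLpNorm (fun x => ‖f x‖ ^ 2) ((2 : ℝ≥0) : ℝ≥0∞) volume
      = eLpNorm f 4 volume ^ 2 := by
    have := eLpNorm_norm_rpow f (p := 2) (μ := (volume : Measure Plane)) (q := 2) (by norm_num)
    simp only [Real.rpow_ofNat, ENNReal.rpow_ofNat] at this
    rw [ENNReal.coe_ofNat, this]
    congr 2
    norm_num
  have hd : ∀ x, ‖fderiv ℝ (fun x => ‖f x‖ ^ 2) x‖ ≤ ‖2 * (‖f x‖ * ‖grad f x‖)‖ := by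
    intro x
    have hdx : DifferentiableAt ℝ f x := hfs.differentiable (by norm_num) x
    rw [Real.norm_of_nonneg (by positivity)]
    refine ContinuousLinearMap.opNorm_le_bound _ (by positivity) fun h => ?_
    have e : fderiv ℝ (fun x => ‖f x‖ ^ 2) x h = 2 * ⟪f x, fderiv ℝ f x h⟫ := by
      rw [(hdx.hasFDerivAt.norm_sq).fderiv]
      simp
    rw [e, norm_mul, Real.norm_ofNat, mul_assoc]
    refine mul_le_mul_of_nonneg_left ?_ (by norm_num)
    rw [mul_assoc]
    refine (norm_inner_le_norm _ _).trans (mul_le_mul_of_nonneg_left ?_ (norm_nonneg _))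
    exact ((fderiv ℝ f x).le_opNorm h).trans
      (mul_le_mul_of_nonneg_right (norm_fderiv_le_grad f x) (norm_nonneg _))
  have h3 : eLpNorm (fderiv ℝ (fun x => ‖f x‖ ^ 2)) 1 volume
      ≤ 2 * (eLpNorm f 2 volume * eLpNorm (grad f) 2 volume) := by
    refine (eLpNorm_mono hd).trans ?_
    have h4 := eLpNorm_le_eLpNorm_mul_eLpNorm_of_nnnorm (p := 2) (q := 2) (r := 1)
      (memLp_test φ).1 (memLp_grad_test φ).1 (fun a G => (2 : ℝ) * (‖a‖ * ‖G‖)) 2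
      (ae_of_all _ fun x => by
        rw [← NNReal.coe_le_coe]
        simp [mul_assoc])
    rw [mul_assoc] at h4
    exact_mod_cast h4
  rw [h2] at h1
  refine h1.trans ((mul_le_mul' le_rfl h3).trans (le_of_eq ?_))
  rw [ladyConst]
  push_cast
  ring

/-- `L⁴` bounds pass to limits in `L²`. -/
lemma eLpNorm_four_le_of_tendsto {ι : Type*} {l : Filter ι} [l.NeBot] [l.IsCountablyGenerated]
    {f : ι → L2} {f' : L2} (hf : Tendsto f l (𝓝 f')) {c : ι → ℝ} {c' : ℝ}
    (hc : Tendsto c l (𝓝 c')) (h : ∀ᶠ n in l, eLpNorm (f n) 4 volume ≤ ENNReal.ofReal (c n)) :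
    eLpNorm f' 4 volume ≤ ENNReal.ofReal c' := by
  obtain ⟨s, hs⟩ := exists_seq_tendsto l
  have h1 := tendstoInMeasure_of_tendsto_Lp (hf.comp hs)
  obtain ⟨ns, hns, hae⟩ := h1.exists_seq_tendsto_ae
  have hs' : Tendsto (fun k => s (ns k)) atTop l := hs.comp hns.tendsto_atTop
  have h2 : ∀ δ : ℝ, 0 < δ → eLpNorm f' 4 volume ≤ ENNReal.ofReal (c' + δ) := by
    intro δ hδ
    refine Lp.eLpNorm_le_of_ae_tendsto (f := fun k => (f (s (ns k)) : Plane → Plane)) ?_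
      (fun k => (Lp.memLp _).1) hae
    filter_upwards [hs'.eventually h, (hc.comp hs').eventually (gt_mem_nhds (lt_add_of_pos_right c' hδ))]
      with k hk1 hk2
    exact hk1.trans (ENNReal.ofReal_le_ofReal hk2.le)
  have h3 : Tendsto (fun n => ENNReal.ofReal (c' + regParam n)) atTop (𝓝 (ENNReal.ofReal c')) := by
    simpa using ENNReal.tendsto_ofReal (tendsto_regParam.const_add c')
  exact ge_of_tendsto' h3 fun n => h2 _ (regParam_pos n)

/-- **Ladyzhenskaya's inequality** on `𝕍`. -/
lemma eLpNorm_four_field_le (v : spaceV) :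
    eLpNorm (field v) 4 volume ≤ ENNReal.ofReal (√(ladyConst * (‖field v‖ * ‖gradV v‖))) := by
  have hv : v ∈ closure (range testV) := denseRange_testV v
  obtain ⟨x, hx, hxv⟩ := mem_closure_iff_seq_limit.1 hv
  choose φ hφ using hx
  have hφv : Tendsto (fun n => testV (φ n)) atTop (𝓝 v) := by simpa only [hφ] using hxv
  have hf := (fieldL.continuous.tendsto v).comp hφv
  have hg := (gradL.continuous.tendsto v).comp hφv
  refine eLpNorm_four_le_of_tendsto hf
    (c := fun n => √(ladyConst * (‖field (testV (φ n))‖ * ‖gradV (testV (φ n))‖))) ?_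
    (Eventually.of_forall fun n => ?_)
  · exact ((hf.norm.mul hg.norm).const_mul _).sqrt
  · have h1 := sq_eLpNorm_four_test_le (φ n)
    have e1 : eLpNorm (fieldL (testV (φ n))) 4 volume
        = eLpNorm (φ n : Plane → Plane) 4 volume :=
      eLpNorm_congr_ae (memLp_test (φ n)).coeFn_toLp
    have e2 : eLpNorm (φ n : Plane → Plane) 2 volume = ENNReal.ofReal ‖field (testV (φ n))‖ := by
      rw [field_testV]
      refine Eq.symm (Eq.trans (congrArg ENNReal.ofReal (Lp.norm_toLp _ (memLp_test (φ n)))) ?_)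
      exact ENNReal.ofReal_toReal (memLp_test (φ n)).2.ne
    have e3 : eLpNorm (grad (φ n : Plane → Plane)) 2 volume
        = ENNReal.ofReal ‖gradV (testV (φ n))‖ := by
      refine Eq.symm (Eq.trans (congrArg ENNReal.ofReal (Lp.norm_toLp _ (memLp_grad_test (φ n)))) ?_)
      exact ENNReal.ofReal_toReal (memLp_grad_test (φ n)).2.ne
    refine (ENNReal.pow_le_pow_left_iff two_ne_zero).1 ?_
    rw [← ENNReal.ofReal_pow (Real.sqrt_nonneg _), Real.sq_sqrt (by positivity)]
    change eLpNorm (fieldL (testV (φ n))) 4 volume ^ 2 ≤ _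
    rw [e1]
    refine h1.trans (le_of_eq ?_)
    rw [e2, e3, ENNReal.ofReal_mul (by positivity), ENNReal.ofReal_mul (norm_nonneg _),
      ENNReal.ofReal_coe_nnreal]

instance fact_one_le_four : Fact ((1 : ℝ≥0∞) ≤ 4) := ⟨by norm_num⟩

instance holderTriple_four : ENNReal.HolderTriple 4 4 2 := ⟨by
  have h : (4 : ℝ≥0∞) = 2 * 2 := by norm_num
  rw [h, ENNReal.mul_inv (by simp) (by simp), ← mul_add, ENNReal.inv_two_add_inv_two, mul_one]⟩

lemma memLp_four_field (v : spaceV) : MemLp (field v) 4 (volume : Measure Plane) :=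
  ⟨(Lp.memLp _).1, (eLpNorm_four_field_le v).trans_lt ENNReal.ofReal_lt_top⟩

lemma norm_toLp_four_le {f : Plane → Plane} (hf : MemLp f 4 (volume : Measure Plane)) {c : ℝ}
    (hc : 0 ≤ c) (h : eLpNorm f 4 volume ≤ ENNReal.ofReal c) : ‖hf.toLp f‖ ≤ c := by
  rw [Lp.norm_toLp]
  exact ENNReal.toReal_le_of_le_ofReal hc h

/-- The embedding of `𝕍` in `L⁴`. -/
def embFour : spaceV →L[ℝ] Lp Plane 4 (volume : Measure Plane) :=
  LinearMap.mkContinuous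
    { toFun := fun v => (memLp_four_field v).toLp _
      map_add' := fun v w => by
        rw [← MemLp.toLp_add]
        exact MemLp.toLp_congr _ _ (Lp.coeFn_add (field v) (field w))
      map_smul' := fun c v => by
        rw [RingHom.id_apply, ← MemLp.toLp_const_smul]
        exact MemLp.toLp_congr _ _ (Lp.coeFn_smul c (field v)) }
    (√ladyConst) (fun v => by
      refine norm_toLp_four_le (memLp_four_field v) (by positivity) ((eLpNorm_four_field_le v).trans
        (ENNReal.ofReal_le_ofReal ?_))
      rw [Real.sqrt_mul (NNReal.coe_nonneg _)]
      refine mul_le_mul_of_nonneg_left ?_ (Real.sqrt_nonneg _)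
      rw [Real.sqrt_le_left (norm_nonneg _), sq]
      exact mul_le_mul (norm_field_le v) (norm_gradV_le v) (norm_nonneg _) (norm_nonneg _))

lemma coeFn_embFour (v : spaceV) : embFour v =ᵐ[volume] field v :=
  (memLp_four_field v).coeFn_toLp

lemma sq_norm_embFour_le (v : spaceV) : ‖embFour v‖ ^ 2 ≤ ladyConst * (‖embVH v‖ * ‖v‖) := by
  have h1 : ‖embFour v‖ ≤ √(ladyConst * (‖field v‖ * ‖gradV v‖)) :=
    norm_toLp_four_le (memLp_four_field v) (Real.sqrt_nonneg _) (eLpNorm_four_field_le v)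
  have h2 := pow_le_pow_left₀ (norm_nonneg _) h1 2
  rw [Real.sq_sqrt (by positivity)] at h2
  refine h2.trans ?_
  rw [norm_embVH]
  have := norm_gradV_le v
  gcongr

/-- The gradient of `K g` is in `L⁴`. -/
lemma eLpNorm_four_grad_adjoint_le (g : spaceH) (i : Fin 2) :
    eLpNorm (gradComp i (gradV (adjoint embVH g))) 4 volume
      ≤ ENNReal.ofReal (√(ladyConst * (‖adjoint embVH g‖ * ‖g‖))) := by
  set v := adjoint embVH g
  -- Ladyzhenskaya's inequality is applied to the difference quotients, which lie in `𝕍` with norm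
  -- at most `‖g‖`, and then `t → 0`.
  refine eLpNorm_four_le_of_tendsto (tendsto_field_diffQuot i v) tendsto_const_nhds ?_
  filter_upwards [self_mem_nhdsWithin] with t ht
  refine (eLpNorm_four_field_le _).trans (ENNReal.ofReal_le_ofReal (Real.sqrt_le_sqrt ?_))
  have h1 : ‖field (diffQuot i t v)‖ ≤ ‖v‖ := (norm_field_diffQuot_le i ht v).trans
    ((norm_gradComp_le _ _).trans (norm_gradV_le _))
  have h2 : ‖gradV (diffQuot i t v)‖ ≤ ‖g‖ :=
    (norm_gradV_le _).trans (norm_diffQuot_adjoint_le g i ht)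
  gcongr

end

section

/-! ### The trilinear form -/

section Abstract

variable {X Y : Type*} [NormedAddCommGroup X] [InnerProductSpace ℝ X] [NormedAddCommGroup Y]
  [InnerProductSpace ℝ Y]

/-- The trilinear form `(u, v, w) ↦ ⟪G v, M u w⟫`. -/
def innerForm (M : X →L[ℝ] X →L[ℝ] Y) (G : X →L[ℝ] Y) : X →L[ℝ] X →L[ℝ] X →L[ℝ] ℝ :=
  ((ContinuousLinearMap.compL ℝ X (Y →L[ℝ] ℝ) (X →L[ℝ] ℝ)).flip
    ((innerSL ℝ : Y →L[ℝ] Y →L[ℝ] ℝ) ∘L G)) ∘L ((ContinuousLinearMap.compL ℝ X Y ℝ).flip ∘L M)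

lemma innerForm_apply (M : X →L[ℝ] X →L[ℝ] Y) (G : X →L[ℝ] Y) (u v w : X) :
    innerForm M G u v w = ⟪G v, M u w⟫ := rfl

lemma skew_of_denseRange (b : X →L[ℝ] X →L[ℝ] X →L[ℝ] ℝ) {ι : Type*} {e : ι → X}
    (he : DenseRange e) (h : ∀ i j k, b (e i) (e j) (e k) = -b (e i) (e k) (e j)) (u v w : X) :
    b u v w = -b u w v := by
  have hc : Continuous fun q : X × X × X => b q.1 q.2.1 q.2.2 := by fun_prop
  have hc' : Continuous fun q : X × X × X => b q.1 q.2.2 q.2.1 := by fun_prop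
  exact he.induction_on₃ (p := fun u v w => b u v w = -b u w v) (isClosed_eq hc hc'.neg) h u v w

end Abstract

/-- The tensor product `(a ⊗ c)ᵢ = aᵢ c`. -/
def tensor : Plane →L[ℝ] Plane →L[ℝ] GradVal :=
  LinearMap.mkContinuous₂
    (LinearMap.mk₂ ℝ (fun a c : Plane => (WithLp.toLp 2 (fun i : Fin 2 => a i • c) : GradVal))
      (fun a a' c => by ext i j; simp [add_mul])
      (fun r a c => by ext i j; simp [mul_assoc])
      (fun a c c' => by ext i j; simp)
      (fun r a c => by ext i j; simp; ring)) 1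
    (fun a c => by
      refine abs_le_of_sq_le_sq' ?_ (by positivity) |>.2
      rw [one_mul, mul_pow, EuclideanSpace.norm_sq_eq a, LinearMap.mk₂_apply,
        PiLp.norm_sq_eq_of_L2, Finset.sum_mul]
      refine le_of_eq (Finset.sum_congr rfl fun i _ => ?_)
      rw [norm_smul, mul_pow])

lemma tensor_apply (a c : Plane) (i : Fin 2) : tensor a c i = a i • c := rfl

lemma norm_tensor_le : ‖tensor‖ ≤ 1 := LinearMap.mkContinuous₂_norm_le _ zero_le_one _

lemma inner_tensor (G : GradVal) (a c : Plane) :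
    ⟪G, tensor a c⟫ = ∑ i : Fin 2, ∑ j : Fin 2, a i * G i j * c j := by
  rw [PiLp.inner_apply]
  refine Finset.sum_congr rfl fun i _ => ?_
  rw [tensor_apply, PiLp.inner_apply]
  refine Finset.sum_congr rfl fun j _ => ?_
  simp
  ring

/-- `(u, w) ↦ u ⊗ w`, from `𝕍 × 𝕍` to `L²`. -/
def tensorV : spaceV →L[ℝ] spaceV →L[ℝ] L2Grad :=
  (tensor.holderL (volume : Measure Plane) 4 4 2).bilinearComp embFour embFour

lemma norm_tensorV_le (u w : spaceV) : ‖tensorV u w‖ ≤ ‖embFour u‖ * ‖embFour w‖ := by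
  refine (tensor.norm_holder_apply_apply_le (embFour u) (embFour w)).trans ?_
  have := norm_tensor_le
  rw [mul_assoc]
  exact mul_le_of_le_one_left (by positivity) this

lemma coeFn_tensorV (u w : spaceV) :
    tensorV u w =ᵐ[volume] fun x => tensor (field u x) (field w x) := by
  filter_upwards [tensor.coeFn_holder (r := 2) (embFour u) (embFour w), coeFn_embFour u,
    coeFn_embFour w] with x h1 h2 h3
  rw [← h2, ← h3]
  exact h1

/-- The trilinear form `b` as a bounded operator. -/
def formB : spaceV →L[ℝ] spaceV →L[ℝ] spaceV →L[ℝ] ℝ := innerForm tensorV gradL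

lemma formB_apply (u v w : spaceV) : formB u v w = ⟪gradV v, tensorV u w⟫ :=
  innerForm_apply _ _ _ _ _

lemma formB_eq_trilinear (u v w : spaceV) : formB u v w = trilinear u v w := by
  rw [formB_apply, L2.inner_def, trilinear]
  refine integral_congr_ae ?_
  filter_upwards [coeFn_tensorV u w] with x hx
  rw [hx, inner_tensor]

lemma formB_test (φ ψ χ : testFields) : formB (testV φ) (testV ψ) (testV χ)
    = ∫ x, ∑ i : Fin 2, (φ : Plane → Plane) x i
      * ⟪fderiv ℝ (ψ : Plane → Plane) x (basisVec i), (χ : Plane → Plane) x⟫ := by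
  rw [formB_eq_trilinear, trilinear]
  refine integral_congr_ae ?_
  filter_upwards [(memLp_test φ).coeFn_toLp, (memLp_grad_test ψ).coeFn_toLp,
    (memLp_test χ).coeFn_toLp] with x h1 h2 h3
  refine Finset.sum_congr rfl fun i _ => ?_
  change ∑ j : Fin 2, ((memLp_test φ).toLp _ : Plane → Plane) x i
    * ((memLp_grad_test ψ).toLp _ : Plane → GradVal) x i j
    * ((memLp_test χ).toLp _ : Plane → Plane) x j = _
  rw [h1, h2, h3, PiLp.inner_apply, Finset.mul_sum]
  refine Finset.sum_congr rfl fun j _ => ?_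
  simp [grad, basisVec]
  ring

/-- Integration by parts: `∫ (u · ∇) v · w = -∫ (u · ∇) w · v` if `div u = 0`. -/
lemma integral_convection_skew {u v w : Plane → Plane} (hus : ContDiff ℝ (⊤ : ℕ∞) u)
    (hvs : ContDiff ℝ (⊤ : ℕ∞) v) (hws : ContDiff ℝ (⊤ : ℕ∞) w) (hwK : HasCompactSupport w)
    (hdiv : ∀ x, divergence u x = 0) :
    (∫ x, ∑ i : Fin 2, u x i * ⟪fderiv ℝ v x (basisVec i), w x⟫)
      + ∫ x, ∑ i : Fin 2, u x i * ⟪fderiv ℝ w x (basisVec i), v x⟫ = 0 := by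
  have hud : Differentiable ℝ u := hus.differentiable (by simp)
  have hvd : Differentiable ℝ v := hvs.differentiable (by simp)
  have hwd : Differentiable ℝ w := hws.differentiable (by simp)
  have hu' : Continuous (fderiv ℝ u) := hus.continuous_fderiv (by simp)
  have hv' : Continuous (fderiv ℝ v) := hvs.continuous_fderiv (by simp)
  have hw' : Continuous (fderiv ℝ w) := hws.continuous_fderiv (by simp)
  have huc := hus.continuous
  have hvc := hvs.continuous
  have hwc := hws.continuous
  set G : Plane → ℝ := fun x => ⟪v x, w x⟫ with hG
  have hGd : Differentiable ℝ G := hvd.inner ℝ hwd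
  have hGf : ∀ x h, fderiv ℝ G x h = ⟪v x, fderiv ℝ w x h⟫ + ⟪fderiv ℝ v x h, w x⟫ := fun x h =>
    fderiv_inner_apply ℝ (hvd x) (hwd x) h
  have hui : ∀ i : Fin 2, Differentiable ℝ (fun x => u x i) := fun i x =>
    ((EuclideanSpace.proj i : Plane →L[ℝ] ℝ).differentiableAt).comp x (hud x)
  have huif : ∀ (i : Fin 2) x h, fderiv ℝ (fun x => u x i) x h = fderiv ℝ u x h i := by
    intro i x h
    have : HasFDerivAt (fun x => u x i) ((EuclideanSpace.proj i : Plane →L[ℝ] ℝ) ∘L fderiv ℝ u x) x :=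
      ((EuclideanSpace.proj i : Plane →L[ℝ] ℝ).hasFDerivAt).comp x (hud x).hasFDerivAt
    rw [this.fderiv]
    rfl
  -- Compact support of `w` alone makes every integrand below integrable.
  have hint : ∀ {F : Plane → ℝ}, Continuous F → (∀ x, w x = 0 ∧ fderiv ℝ w x = 0 → F x = 0) →
      Integrable F := by
    intro F hF h0
    refine hF.integrable_of_hasCompactSupport (hwK.mono' fun x hx => ?_)
    by_contra hx'
    refine hx (h0 x ⟨image_eq_zero_of_notMem_tsupport hx', ?_⟩)
    exact image_eq_zero_of_notMem_tsupport fun h => hx' (tsupport_fderiv_subset ℝ h)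
  have i1 : ∀ i : Fin 2, Integrable fun x => u x i * ⟪fderiv ℝ v x (basisVec i), w x⟫ := fun i =>
    hint (by fun_prop) fun x hx => by simp [hx.1]
  have i2 : ∀ i : Fin 2, Integrable fun x => u x i * ⟪fderiv ℝ w x (basisVec i), v x⟫ := fun i =>
    hint (by fun_prop) fun x hx => by simp [hx.2]
  have i3 : ∀ i : Fin 2, Integrable fun x => fderiv ℝ (fun x => u x i) x (basisVec i) * G x :=
    fun i => by
      simp only [huif, hG]
      exact hint (by fun_prop) fun x hx => by simp [hx.1]
  have i4 : ∀ i : Fin 2, Integrable fun x => u x i * fderiv ℝ G x (basisVec i) := fun i => by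
    simp only [hGf]
    exact hint (by fun_prop) fun x hx => by simp [hx.1, hx.2]
  have i5 : ∀ i : Fin 2, Integrable fun x => u x i * G x := fun i => by
    simp only [hG]
    exact hint (by fun_prop) fun x hx => by simp [hx.1]
  rw [← integral_add (integrable_finsetSum _ fun i _ => i1 i)
    (integrable_finsetSum _ fun i _ => i2 i)]
  -- By the product rule the two terms combine to `u · ∇(v · w)`; integrating by parts leaves `-(div
  -- u) (v · w)`.
  have e1 : ∀ x, ∑ i : Fin 2, u x i * ⟪fderiv ℝ v x (basisVec i), w x⟫
      + ∑ i : Fin 2, u x i * ⟪fderiv ℝ w x (basisVec i), v x⟫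
      = ∑ i : Fin 2, u x i * fderiv ℝ G x (basisVec i) := by
    intro x
    rw [← Finset.sum_add_distrib]
    refine Finset.sum_congr rfl fun i _ => ?_
    rw [hGf, ← mul_add, real_inner_comm (v x), add_comm]
  simp only [e1]
  rw [integral_finsetSum _ fun i _ => i4 i]
  have e2 : ∀ i : Fin 2, ∫ x, u x i * fderiv ℝ G x (basisVec i)
      = -∫ x, fderiv ℝ (fun x => u x i) x (basisVec i) * G x := fun i =>
    integral_mul_fderiv_eq_neg_fderiv_mul_of_integrable (i3 i) (i4 i) (i5 i)
      (fun x _ => hui i x) (fun x _ => hGd x)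
  rw [Finset.sum_congr rfl fun i _ => e2 i, Finset.sum_neg_distrib, neg_eq_zero,
    ← integral_finsetSum _ fun i _ => i3 i]
  refine integral_eq_zero_of_ae (Eventually.of_forall fun x => ?_)
  change ∑ i : Fin 2, fderiv ℝ (fun x => u x i) x (basisVec i) * G x = 0
  rw [← Finset.sum_mul]
  simp only [huif]
  change divergence u x * G x = 0
  rw [hdiv, zero_mul]

lemma formB_test_skew (φ ψ χ : testFields) : formB (testV φ) (testV ψ) (testV χ)
    + formB (testV φ) (testV χ) (testV ψ) = 0 := by
  rw [formB_test, formB_test]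
  exact integral_convection_skew φ.2.1 ψ.2.1 χ.2.1 χ.2.2.1 φ.2.2.2

lemma formB_skew (u v w : spaceV) : formB u v w = -formB u w v :=
  skew_of_denseRange formB denseRange_testV
    (fun φ ψ χ => by linarith [formB_test_skew φ ψ χ]) u v w

/-- Multiplication by the `i`-th component. -/
def compMul (i : Fin 2) : Plane →L[ℝ] Plane →L[ℝ] Plane :=
  (ContinuousLinearMap.lsmul ℝ ℝ) ∘L (EuclideanSpace.proj i : Plane →L[ℝ] ℝ)

lemma norm_compMul_le (i : Fin 2) : ‖compMul i‖ ≤ 1 := by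
  refine ContinuousLinearMap.opNorm_le_bound₂ _ zero_le_one fun a c => ?_
  change ‖a i • c‖ ≤ _
  rw [one_mul, norm_smul]
  exact mul_le_mul_of_nonneg_right (PiLp.norm_apply_le a i) (norm_nonneg _)

/-- Once the gradient is in `L⁴`, the product `u · ∇v` is in `L²` and the test field enters only
through its `L²` norm. -/
lemma formB_eq_sum {u v w : spaceV}
    (hv : ∀ i, MemLp (gradComp i (gradV v)) 4 (volume : Measure Plane)) :
    formB u v w = ∑ i : Fin 2,
      ⟪((compMul i).holder 2 (embFour u) ((hv i).toLp _) : L2), field w⟫ := by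
  rw [formB_apply, L2.inner_def]
  simp only [L2.inner_def]
  rw [← integral_finsetSum _ fun i _ => L2.integrable_inner _ _]
  refine integral_congr_ae ?_
  have h4 : ∀ᵐ x, ∀ i : Fin 2, ((compMul i).holder 2 (embFour u) ((hv i).toLp _) : L2) x
      = field u x i • gradV v x i := by
    rw [ae_all_iff]
    intro i
    filter_upwards [(compMul i).coeFn_holder (r := 2) (embFour u) ((hv i).toLp _), coeFn_embFour u,
      (hv i).coeFn_toLp, coeFn_gradComp i (gradV v)] with x h1 h2 h3 h5
    rw [h1, h2, h3, h5]
    rfl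
  filter_upwards [coeFn_tensorV u w, h4] with x h1 h2
  rw [h1, inner_tensor]
  refine Finset.sum_congr rfl fun i _ => ?_
  rw [h2 i, real_inner_smul_left, PiLp.inner_apply, Finset.mul_sum]
  refine Finset.sum_congr rfl fun j _ => ?_
  simp
  ring

/-- Hölder with exponents `4, 2, 4`, then Ladyzhenskaya's inequality for `u` and for `w`. -/
lemma formB_bound (u v w : spaceV) : formB u v w ^ 2
    ≤ ladyConst ^ 2 * (‖embVH u‖ * ‖u‖) * ‖v‖ ^ 2 * (‖embVH w‖ * ‖w‖) := by
  have h1 : |formB u v w| ≤ ‖v‖ * (‖embFour u‖ * ‖embFour w‖) := by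
    rw [formB_apply]
    refine (abs_real_inner_le_norm _ _).trans ?_
    exact mul_le_mul (norm_gradV_le v) (norm_tensorV_le u w) (norm_nonneg _) (norm_nonneg _)
  rw [← sq_abs]
  refine (pow_le_pow_left₀ (abs_nonneg _) h1 2).trans ?_
  have h2 := sq_norm_embFour_le u
  have h3 := sq_norm_embFour_le w
  calc (‖v‖ * (‖embFour u‖ * ‖embFour w‖)) ^ 2
      = ‖v‖ ^ 2 * (‖embFour u‖ ^ 2 * ‖embFour w‖ ^ 2) := by ring
    _ ≤ ‖v‖ ^ 2 * ((ladyConst * (‖embVH u‖ * ‖u‖)) * (ladyConst * (‖embVH w‖ * ‖w‖))) := by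
      gcongr
    _ = _ := by ring

/-- Hölder with exponents `4, 4, 2`, using the `L⁴` bound on the gradient of `ι† g`. The factor `4`
is the square of the number of coordinate directions. -/
lemma formB_bound_smooth (u : spaceV) (g : spaceH) (w : spaceV) :
    formB u (adjoint embVH g) w ^ 2
      ≤ 4 * ladyConst ^ 2 * (‖embVH u‖ * ‖u‖) * (‖adjoint embVH g‖ * ‖g‖) * ‖embVH w‖ ^ 2 := by
  set v := adjoint embVH g with hv
  have h4 : ∀ i, MemLp (gradComp i (gradV v)) 4 (volume : Measure Plane) := fun i =>
    ⟨(Lp.memLp _).1, (eLpNorm_four_grad_adjoint_le g i).trans_lt ENNReal.ofReal_lt_top⟩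
  set R := √(ladyConst * (‖v‖ * ‖g‖)) with hR
  have h1 : |formB u v w| ≤ 2 * (‖embFour u‖ * R * ‖embVH w‖) := by
    rw [formB_eq_sum h4]
    refine (Finset.abs_sum_le_sum_abs _ _).trans ?_
    have h2 : ∀ i : Fin 2, |⟪((compMul i).holder 2 (embFour u) ((h4 i).toLp _) : L2), field w⟫|
        ≤ ‖embFour u‖ * R * ‖embVH w‖ := by
      intro i
      refine (abs_real_inner_le_norm _ _).trans (mul_le_mul_of_nonneg_right ?_ (norm_nonneg _))
      refine ((compMul i).norm_holder_apply_apply_le _ _).trans ?_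
      refine mul_le_mul ?_ (norm_toLp_four_le (h4 i) (Real.sqrt_nonneg _)
        (eLpNorm_four_grad_adjoint_le g i)) (norm_nonneg _) (norm_nonneg _)
      exact mul_le_of_le_one_left (norm_nonneg _) (norm_compMul_le i)
    rw [Fin.sum_univ_two]
    linarith [h2 0, h2 1]
  rw [← sq_abs]
  refine (pow_le_pow_left₀ (abs_nonneg _) h1 2).trans ?_
  have h3 := sq_norm_embFour_le u
  have h5 : R ^ 2 = ladyConst * (‖v‖ * ‖g‖) := Real.sq_sqrt (by positivity)
  calc (2 * (‖embFour u‖ * R * ‖embVH w‖)) ^ 2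
      = 4 * ‖embFour u‖ ^ 2 * R ^ 2 * ‖embVH w‖ ^ 2 := by ring
    _ ≤ 4 * (ladyConst * (‖embVH u‖ * ‖u‖)) * (ladyConst * (‖v‖ * ‖g‖)) * ‖embVH w‖ ^ 2 := by
      rw [h5]; gcongr
    _ = _ := by ring

/-- The spaces `𝕍 ⊆ ℍ` and the form `b` satisfy the abstract hypotheses. -/
theorem isNSETriple : IsNSETriple embVH formB (4 * ladyConst ^ 2) where
  injective := injective_embVH
  denseRange := denseRange_embVH
  norm_le := norm_field_le
  const_nonneg := by positivity
  skew := formB_skew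
  bound u v w := by
    refine (formB_bound u v w).trans ?_
    have : (ladyConst : ℝ) ^ 2 ≤ 4 * ladyConst ^ 2 := by nlinarith [sq_nonneg (ladyConst : ℝ)]
    gcongr
  bound_smooth := formB_bound_smooth

end

section

/-! ### Global solutions -/

section Global

variable {H V : Type*} [NormedAddCommGroup H] [InnerProductSpace ℝ H]
  [NormedAddCommGroup V] [InnerProductSpace ℝ V]
  {ι : V →L[ℝ] H} {b : V →L[ℝ] V →L[ℝ] V →L[ℝ] ℝ} {C : ℝ}
  {ν : ℝ} {a β : ℝ → ℝ} {τ T : ℝ} {g : ℝ → H}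

lemma intervalIntegral_congr_of_ae_Icc {f f' : ℝ → ℝ} {t : ℝ} (ht : t ∈ Icc τ T)
    (h : f =ᵐ[volume.restrict (Icc τ T)] f') : ∫ s in τ..t, f s = ∫ s in τ..t, f' s := by
  have hle : volume.restrict (Ioc τ t) ≤ volume.restrict (Icc τ T) :=
    Measure.restrict_mono
      (fun _ (hs : _ ∈ Ioc τ t) => (⟨hs.1.le, hs.2.trans ht.2⟩ : _ ∈ Icc τ T)) le_rfl
  rw [intervalIntegral.integral_of_le ht.1, intervalIntegral.integral_of_le ht.1]
  exact integral_congr_ae (hle.absolutelyContinuous.ae_le h)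

lemma IsSol.congr {u u' : ℝ → H} {w w' : ℝ → V} (h : IsSol ι b ν a β g τ T u w)
    (hu : EqOn u u' (Icc τ T)) (hw : w =ᵐ[volume.restrict (Icc τ T)] w') :
    IsSol ι b ν a β g τ T u' w' := by
  have hu' : ∀ᵐ s ∂(volume.restrict (Icc τ T)), u s = u' s :=
    (ae_restrict_iff' measurableSet_Icc).2 (ae_of_all _ fun s hs => hu hs)
  refine ⟨h.continuousOn.congr hu.symm, h.memLp.ae_eq hw, ?_, fun ψ t ht => ?_⟩
  · filter_upwards [h.ae_eq, hu', hw] with s h1 h2 h3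
    rw [← h3, ← h2, h1]
  · have hτ : τ ∈ Icc τ T := ⟨le_rfl, ht.1.trans ht.2⟩
    have e := h.equation ψ t ht
    rw [hu ht, hu hτ] at e
    rw [← e]
    congr 1
    · congr 1
      · congr 2
        exact intervalIntegral_congr_of_ae_Icc ht (by filter_upwards [hw] with s hs; rw [hs])
      · exact intervalIntegral_congr_of_ae_Icc ht (by filter_upwards [hu'] with s hs; rw [hs])
    · exact intervalIntegral_congr_of_ae_Icc ht (by filter_upwards [hw] with s hs; rw [hs])

variable [CompleteSpace H] [CompleteSpace V]

/-- Existence of global weak solutions. -/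
theorem IsNSETriple.exists_isSol_global (D : IsNSETriple ι b C) (hν : 0 < ν) (ha : Continuous a)
    (hβ : Continuous β) (hg : ∀ T, MemLp g 2 (volume.restrict (Icc τ T))) (u₀ : H) :
    ∃ u w, u τ = u₀ ∧ ∀ T, IsSol ι b ν a β g τ T u w := by
  have hτn : ∀ n : ℕ, τ ≤ τ + n := fun n => le_add_of_nonneg_right (Nat.cast_nonneg n)
  choose un wn hs h0 using fun n : ℕ => D.exists_isSol hν ha hβ (hτn n) (hg (τ + n)) u₀
  -- The value at `t` is taken from the first interval `[τ, τ + n]` containing it; uniqueness makes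
  -- the choices consistent.
  set N : ℝ → ℕ := fun t => ⌈t - τ⌉₊ with hN
  have hNt : ∀ t, t ≤ τ + N t := fun t => by linarith [Nat.le_ceil (t - τ)]
  have hNle : ∀ (t : ℝ) (n : ℕ), t ≤ τ + n → N t ≤ n := fun t n h => by
    rw [hN, Nat.ceil_le]; linarith
  have hun : ∀ m n : ℕ, m ≤ n → EqOn (un m) (un n) (Icc τ (τ + m)) := by
    intro m n hmn
    have hmn' : τ + (m : ℝ) ≤ τ + n := by gcongr
    exact D.isSol_unique hν ha hβ (hg _) (hs m) ((hs n).mono_right hmn') ((h0 m).trans (h0 n).symm)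
  have hae : ∀ᵐ s, ∀ n : ℕ, s ∈ Icc τ (τ + n) → ι (wn n s) = un n s := by
    rw [ae_all_iff]
    exact fun n => (ae_restrict_iff' measurableSet_Icc).1 (hs n).ae_eq
  have key : ∀ n : ℕ, IsSol ι b ν a β g τ (τ + n) (fun t => un (N t) t) (fun t => wn (N t) t) := by
    intro n
    have hu : ∀ s ∈ Icc τ (τ + n), un n s = un (N s) s := fun s hsI =>
      (hun (N s) n (hNle s n hsI.2) ⟨hsI.1, hNt s⟩).symm
    refine (hs n).congr hu ?_
    filter_upwards [ae_restrict_of_ae hae, ae_restrict_mem measurableSet_Icc] with s h1 h2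
    refine D.injective ?_
    rw [h1 n h2, h1 (N s) ⟨h2.1, hNt s⟩, hu s h2]
  refine ⟨fun t => un (N t) t, fun t => wn (N t) t, h0 _, fun T => ?_⟩
  exact (key (N T)).mono_right (hNt T)

end Global

/-! ### The Ornstein-Uhlenbeck process -/

section Path

variable {ω : C(ℝ, ℝ)}

lemma integrableOn_exp_mul_Iic (hω : ω ∈ pathSet) (t : ℝ) :
    IntegrableOn (fun ξ : ℝ => Real.exp ξ * ω ξ) (Iic t) := by
  have hc : Continuous fun ξ : ℝ => Real.exp ξ * ω ξ := by fun_prop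
  refine (hω.2.union (hc.integrableOn_Icc (a := 0) (b := t))).mono_set fun x hx => ?_
  rcases le_total x 0 with h | h
  · exact Or.inl h
  · exact Or.inr ⟨h, hx⟩

lemma exp_mul_shift (t ξ : ℝ) :
    Real.exp ξ * ω (ξ + t) = Real.exp (-t) * (Real.exp (ξ + t) * ω (ξ + t)) := by
  rw [← mul_assoc, ← Real.exp_add]
  congr 2
  ring

lemma preimage_add_Iic (t : ℝ) : (fun ξ : ℝ => ξ + t) ⁻¹' Iic t = Iic 0 := by
  ext x
  simp

lemma integrableOn_exp_mul_comp (hω : ω ∈ pathSet) (t : ℝ) :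
    IntegrableOn (fun ξ : ℝ => Real.exp ξ * ω (ξ + t)) (Iic 0) := by
  have h := ((measurePreserving_add_right volume t).integrableOn_comp_preimage
    (measurableEmbedding_addRight t)).2 (integrableOn_exp_mul_Iic hω t)
  rw [preimage_add_Iic] at h
  simp only [exp_mul_shift]
  exact h.const_mul _

lemma integral_exp_mul_comp (hω : ω ∈ pathSet) (t : ℝ) :
    ∫ ξ in Iic (0 : ℝ), Real.exp ξ * ω (ξ + t) = Real.exp (-t) *
      ((∫ ξ in Iic (0 : ℝ), Real.exp ξ * ω ξ) + ∫ ξ in (0 : ℝ)..t, Real.exp ξ * ω ξ) := by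
  have h := (measurePreserving_add_right volume t).setIntegral_preimage_emb
    (measurableEmbedding_addRight t) (fun ξ : ℝ => Real.exp ξ * ω ξ) (Iic t)
  rw [preimage_add_Iic] at h
  simp only [exp_mul_shift]
  rw [integral_const_mul, h, ← intervalIntegral.integral_Iic_sub_Iic hω.2
    (integrableOn_exp_mul_Iic hω t)]
  ring

lemma integrableOn_exp_mul_const (c : ℝ) :
    IntegrableOn (fun ξ : ℝ => Real.exp ξ * c) (Iic 0) :=
  (integrableOn_exp_Iic 0).mul_const c

lemma shift_mem_pathSet (hω : ω ∈ pathSet) (t : ℝ) : shift t ω ∈ pathSet := by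
  refine ⟨by simp [shift], ?_⟩
  have h := (integrableOn_exp_mul_comp hω t).sub (integrableOn_exp_mul_const (ω t))
  refine h.congr_fun (fun ξ _ => ?_) measurableSet_Iic
  simp [shift, mul_sub]

/-- The change of variables `ξ ↦ ξ + t` removes `t` from inside the improper integral, so continuity
in `t` can be read off. -/
lemma ouVar_shift (hω : ω ∈ pathSet) (t : ℝ) : ouVar (shift t ω) = ω t - Real.exp (-t) *
    ((∫ ξ in Iic (0 : ℝ), Real.exp ξ * ω ξ) + ∫ ξ in (0 : ℝ)..t, Real.exp ξ * ω ξ) := by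
  have e : ∀ ξ, Real.exp ξ * shift t ω ξ = Real.exp ξ * ω (ξ + t) - Real.exp ξ * ω t := fun ξ => by
    simp [shift, mul_sub]
  rw [ouVar]
  simp only [e]
  rw [integral_sub (integrableOn_exp_mul_comp hω t) (integrableOn_exp_mul_const (ω t)),
    integral_exp_mul_comp hω, integral_mul_const, integral_exp_Iic_zero]
  ring

lemma continuous_ouVar_shift (hω : ω ∈ pathSet) : Continuous fun t => ouVar (shift t ω) := by
  simp only [ouVar_shift hω]
  have hc : Continuous fun ξ : ℝ => Real.exp ξ * ω ξ := by fun_prop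
  have h1 : Continuous fun t => ∫ ξ in (0 : ℝ)..t, Real.exp ξ * ω ξ :=
    intervalIntegral.continuous_primitive (fun a b => hc.intervalIntegrable a b) 0
  fun_prop

lemma continuous_zFactor (σ : ℝ) (hω : ω ∈ pathSet) : Continuous fun t => zFactor σ t ω := by
  have := continuous_ouVar_shift hω
  unfold zFactor
  fun_prop

lemma zFactor_pos (σ t : ℝ) (ω : C(ℝ, ℝ)) : 0 < zFactor σ t ω := Real.exp_pos _

lemma continuous_zFactor_inv (σ : ℝ) (hω : ω ∈ pathSet) :
    Continuous fun t => (zFactor σ t ω)⁻¹ :=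
  (continuous_zFactor σ hω).inv₀ fun t => (zFactor_pos σ t ω).ne'

end Path

/-! ### The pathwise system -/

/-- The coefficient of the zeroth order term once `ν A` is replaced by `ν (1 + A)`. -/
def dampCoeff (ν σ : ℝ) (ω : C(ℝ, ℝ)) (t : ℝ) : ℝ := σ ^ 2 / 2 - σ * ouVar (shift t ω) - ν

/-- The force `z 𝒫 f`. -/
def force (σ : ℝ) (f : ℝ → L2) (ω : C(ℝ, ℝ)) (t : ℝ) : spaceH :=
  zFactor σ t ω • spaceH.orthogonalProjectionOnto (f t)

end

/-! ### Well-posedness and `(ℍ, 𝕍)`-continuity for the pathwise system -/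

section

section System

variable {ν σ : ℝ} {f : ℝ → L2} {ω : C(ℝ, ℝ)} {τ T : ℝ}

lemma continuous_dampCoeff (hω : ω ∈ pathSet) : Continuous (dampCoeff ν σ ω) := by
  have := continuous_ouVar_shift hω
  unfold dampCoeff
  fun_prop

lemma memLp_force (hf : IsL2Loc f) (hω : ω ∈ pathSet) (σ τ T : ℝ) :
    MemLp (force σ f ω) 2 (volume.restrict (Icc τ T)) :=
  MemLp_weight (continuous_zFactor σ hω) (spaceH.orthogonalProjectionOnto.comp_memLp' (hf τ T))

lemma inner_force (s : ℝ) (ψ : spaceV) :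
    ⟪force σ f ω s, embVH ψ⟫ = zFactor σ s ω * ⟪f s, field ψ⟫ := by
  have h1 : ⟪force σ f ω s, embVH ψ⟫
      = zFactor σ s ω * ⟪spaceH.orthogonalProjectionOnto (f s), embVH ψ⟫ :=
    real_inner_smul_left (spaceH.orthogonalProjectionOnto (f s)) (embVH ψ) (zFactor σ s ω)
  have h2 : ⟪spaceH.orthogonalProjectionOnto (f s), embVH ψ⟫ = ⟪f s, (embVH ψ : L2)⟫ :=
    spaceH.inner_orthogonalProjectionOnto_eq_of_mem_right (embVH ψ) (f s)
  rw [h1, h2, coe_embVH]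

/-- The two forms of the linear terms in the equation agree. -/
lemma linear_terms_eq (hω : ω ∈ pathSet) {u : ℝ → spaceH} {w : ℝ → spaceV}
    (hu : ContinuousOn u (Icc τ T)) (hw : MemLp w 2 (volume.restrict (Icc τ T)))
    (hwu : ∀ᵐ s ∂(volume.restrict (Icc τ T)), embVH (w s) = u s) (ψ : spaceV) {t : ℝ}
    (ht : t ∈ Icc τ T) :
    ν * (∫ s in τ..t, ⟪w s, ψ⟫) + (∫ s in τ..t, dampCoeff ν σ ω s * ⟪u s, embVH ψ⟫)
      = ν * (∫ s in τ..t, ⟪gradV (w s), gradV ψ⟫)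
        + ∫ s in τ..t, (σ ^ 2 / 2 - σ * ouVar (shift s ω)) * ⟪(u s : L2), field ψ⟫ := by
  have hτ : τ ∈ Icc τ T := ⟨le_rfl, ht.1.trans ht.2⟩
  have hc := continuous_ouVar_shift hω
  have hum : MemLp u 2 (volume.restrict (Icc τ T)) := memLp_of_continuousOn hu
  have i1 : IntervalIntegrable (fun s => ⟪gradV (w s), gradV ψ⟫) volume τ t :=
    intervalIntegrable_inner_const (gradL.comp_memLp' hw) (gradV ψ) hτ ht
  have i2 : IntervalIntegrable (fun s => ⟪u s, embVH ψ⟫) volume τ t :=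
    intervalIntegrable_inner_const hum (embVH ψ) hτ ht
  have i3 : IntervalIntegrable (fun s => (σ ^ 2 / 2 - σ * ouVar (shift s ω)) * ⟪u s, embVH ψ⟫)
      volume τ t :=
    i2.continuousOn_mul (continuous_const.sub (continuous_const.mul hc)).continuousOn
  -- The `𝕍` inner product exceeds the gradient pairing by the `L²` pairing; multiplied by `ν`, this
  -- excess cancels the `-ν` in `dampCoeff`.
  have e1 : ∫ s in τ..t, ⟪w s, ψ⟫ = (∫ s in τ..t, ⟪u s, embVH ψ⟫)
      + ∫ s in τ..t, ⟪gradV (w s), gradV ψ⟫ := by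
    rw [← intervalIntegral.integral_add i2 i1]
    refine intervalIntegral_congr_of_ae_Icc ht ?_
    filter_upwards [hwu] with s hs
    rw [inner_spaceV, ← hs]
    rfl
  have e2 : ∫ s in τ..t, dampCoeff ν σ ω s * ⟪u s, embVH ψ⟫
      = (∫ s in τ..t, (σ ^ 2 / 2 - σ * ouVar (shift s ω)) * ⟪u s, embVH ψ⟫)
        - ν * ∫ s in τ..t, ⟪u s, embVH ψ⟫ := by
    rw [← intervalIntegral.integral_const_mul, ← intervalIntegral.integral_sub i3 (i2.const_mul ν)]
    refine intervalIntegral.integral_congr fun s _ => ?_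
    simp only [dampCoeff]
    ring
  have e3 : ∫ s in τ..t, (σ ^ 2 / 2 - σ * ouVar (shift s ω)) * ⟪(u s : L2), field ψ⟫
      = ∫ s in τ..t, (σ ^ 2 / 2 - σ * ouVar (shift s ω)) * ⟪u s, embVH ψ⟫ := rfl
  rw [e1, e2, e3]
  ring

/-- Weak solutions of the pathwise system in terms of the abstract setting. -/
lemma isWeakSolution_iff (hω : ω ∈ pathSet) {u₀ : spaceH} {u : ℝ → spaceH} :
    IsWeakSolution ν σ f ω τ u₀ u ↔ u τ = u₀ ∧ ∃ w : ℝ → spaceV, ∀ T,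
      IsSol embVH formB ν (dampCoeff ν σ ω) (fun t => (zFactor σ t ω)⁻¹) (force σ f ω) τ T u w := by
  constructor
  · rintro ⟨h1, h2, w, h3, h4, h5⟩
    refine ⟨h2, w, fun T => ?_⟩
    have hc : ContinuousOn u (Icc τ T) := h1.mono Icc_subset_Ici_self
    have hae : ∀ᵐ s ∂(volume.restrict (Icc τ T)), embVH (w s) = u s := by
      refine (ae_restrict_of_ae_restrict_of_subset Icc_subset_Ici_self h4).mono fun s hs => ?_
      exact Subtype.ext hs
    refine ⟨hc, h3 T, hae, fun ψ t ht => ?_⟩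
    have e := h5 ψ t ht.1
    have e1 := linear_terms_eq (ν := ν) (σ := σ) hω hc (h3 T) hae ψ ht
    simp only [inner_force, formB_eq_trilinear]
    rw [h2]
    change ⟪(u t : L2), field ψ⟫ + _ + _ + _ = ⟪(u₀ : L2), field ψ⟫ + _
    linarith
  · rintro ⟨h2, w, h⟩
    refine ⟨fun t ht => ?_, h2, w, fun T => (h T).memLp, ?_, fun ψ t ht => ?_⟩
    · have h1 := (h (t + 1)).continuousOn t ⟨ht, by linarith⟩
      refine h1.mono_of_mem_nhdsWithin ?_
      rw [← Ici_inter_Iic]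
      exact inter_mem_nhdsWithin _ (Iic_mem_nhds (by linarith))
    -- A countable cover turns the almost everywhere identities on bounded intervals into one on the
    -- half-line.
    · have e : Ici τ = ⋃ n : ℕ, Icc τ (τ + n) := by
        ext s
        simp only [mem_Ici, mem_iUnion, mem_Icc]
        refine ⟨fun hs => ?_, fun ⟨n, hn⟩ => hn.1⟩
        obtain ⟨n, hn⟩ := exists_nat_ge (s - τ)
        exact ⟨n, hs, by linarith⟩
      rw [e, ae_restrict_iUnion_iff]
      exact fun n => (h (τ + n)).ae_eq.mono fun s hs => congrArg Subtype.val hs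
    · have htI : t ∈ Icc τ t := ⟨ht, le_rfl⟩
      have e := (h t).equation ψ t htI
      have e1 := linear_terms_eq (ν := ν) (σ := σ) hω (h t).continuousOn (h t).memLp (h t).ae_eq
        ψ htI
      simp only [inner_force, formB_eq_trilinear] at e
      rw [h2] at e
      change ⟪(u t : L2), field ψ⟫ + _ + _ + _ = ⟪(u₀ : L2), field ψ⟫ + _ at e
      linarith

lemma exists_isWeakSolution (hν : 0 < ν) (hf : IsL2Loc f) (hω : ω ∈ pathSet) (τ : ℝ)
    (u₀ : spaceH) : ∃ u, IsWeakSolution ν σ f ω τ u₀ u := by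
  obtain ⟨u, w, h0, h⟩ := isNSETriple.exists_isSol_global hν (continuous_dampCoeff (σ := σ) hω)
    (continuous_zFactor_inv σ hω) (fun T => memLp_force hf hω σ τ T) u₀
  exact ⟨u, (isWeakSolution_iff hω).2 ⟨h0, w, h⟩⟩

lemma isWeakSolution_unique (hν : 0 < ν) (hf : IsL2Loc f) (hω : ω ∈ pathSet) {u₀ : spaceH}
    {u u' : ℝ → spaceH} (hu : IsWeakSolution ν σ f ω τ u₀ u)
    (hu' : IsWeakSolution ν σ f ω τ u₀ u') : EqOn u' u (Ici τ) := by
  obtain ⟨h0, w, h⟩ := (isWeakSolution_iff hω).1 hu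
  obtain ⟨h0', w', h'⟩ := (isWeakSolution_iff hω).1 hu'
  intro t ht
  exact isNSETriple.isSol_unique hν (continuous_dampCoeff hω) (continuous_zFactor_inv σ hω)
    (memLp_force hf hω σ τ t) (h' t) (h t) (h0'.trans h0.symm) ⟨ht, le_rfl⟩

lemma isWeakSolution_solution (hν : 0 < ν) (hf : IsL2Loc f) (hω : ω ∈ pathSet) (τ : ℝ)
    (u₀ : spaceH) : IsWeakSolution ν σ f ω τ u₀ (solution ν σ f ω τ u₀) := by
  have h := exists_isWeakSolution (σ := σ) hν hf hω τ u₀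
  rw [solution, dif_pos h]
  exact h.choose_spec

lemma isHVContinuous_solution (hν : 0 < ν) (hf : IsL2Loc f) (hω : ω ∈ pathSet) {t : ℝ}
    (ht : τ < t) : IsHVContinuous (fun u₀ => solution ν σ f ω τ u₀ t) := by
  obtain ⟨U, hU, hUs⟩ := isNSETriple.exists_continuous_lift hν (continuous_dampCoeff (σ := σ) hω)
    (continuous_zFactor_inv σ hω) ht (memLp_force hf hω σ τ t)
  refine ⟨U, fun u₀ => ?_, hU⟩
  obtain ⟨h0, w, h⟩ := (isWeakSolution_iff hω).1 (isWeakSolution_solution (σ := σ) hν hf hω τ u₀)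
  have e := hUs _ _ (h t)
  rw [h0] at e
  exact congrArg Subtype.val e

/-- Shifts preserve the path set, so the solution map for the shifted path is `(ℍ, 𝕍)`-continuous.
For a fixed path the factors `z` are constants, and scaling is continuous in both spaces. -/
lemma isHVContinuous_cocycle (hν : 0 < ν) (hf : IsL2Loc f) (hω : ω ∈ pathSet) {t : ℝ}
    (ht : 0 < t) : IsHVContinuous (cocycle ν σ f t τ ω) := by
  obtain ⟨U, hU, hUc⟩ := isHVContinuous_solution (σ := σ) (τ := τ) (t := t + τ) hν hf
    (shift_mem_pathSet hω (-τ)) (by linarith)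
  refine ⟨fun v₀ => (zFactor σ (t + τ) (shift (-τ) ω))⁻¹ • U (zFactor σ τ (shift (-τ) ω) • v₀),
    fun v₀ => ?_, ?_⟩
  · have e := hU (zFactor σ τ (shift (-τ) ω) • v₀)
    exact congrArg (fun x : L2 => (zFactor σ (t + τ) (shift (-τ) ω))⁻¹ • x) e
  · exact (hUc.comp (continuous_const_smul (zFactor σ τ (shift (-τ) ω)))).const_smul
      (zFactor σ (t + τ) (shift (-τ) ω))⁻¹

end System

end

end SNSE

end

theorem mainTheorem2 (ν σ : ℝ) (hν : 0 < ν) (hσ : 0 < σ) (f : ℝ → SNSE.L2)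
    (hf : SNSE.IsL2Loc f) :
    -- the pathwise system has exactly one weak solution for every initial value in `ℍ`
    (∀ ω ∈ SNSE.pathSet, ∀ (τ : ℝ) (u₀ : SNSE.spaceH),
      ∃ u : ℝ → SNSE.spaceH, SNSE.IsWeakSolution ν σ f ω τ u₀ u ∧
        ∀ u' : ℝ → SNSE.spaceH, SNSE.IsWeakSolution ν σ f ω τ u₀ u' →
          Set.EqOn u' u (Set.Ici τ)) ∧
    -- at every later time the solution depends continuously in `𝕍` on the initial value in `ℍ`
    (∀ ω ∈ SNSE.pathSet, ∀ τ t : ℝ, τ < t →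
      SNSE.IsHVContinuous (fun u₀ => SNSE.solution ν σ f ω τ u₀ t)) ∧
    -- the cocycle is `(ℍ, 𝕍)`-continuous
    (∀ ω ∈ SNSE.pathSet, ∀ τ t : ℝ, 0 < t →
      SNSE.IsHVContinuous (SNSE.cocycle ν σ f t τ ω)) := by
  refine ⟨fun ω hω τ u₀ => ?_, fun ω hω τ t ht => SNSE.isHVContinuous_solution hν hf hω ht,
    fun ω hω τ t ht => SNSE.isHVContinuous_cocycle hν hf hω ht⟩
  obtain ⟨u, hu⟩ := SNSE.exists_isWeakSolution (σ := σ) hν hf hω τ u₀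
  exact ⟨u, hu, fun u' hu' => SNSE.isWeakSolution_unique hν hf hω hu hu'⟩
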